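/- Let $\nu>1$, $\beta,\kappa,\rho>0$, $m_1\ge 0$, $n_1\le n_2$ and $\gamma$ be real numbers with $\kappa\le\gamma^2$ and $n_1=-(\gamma^2-\kappa)$. Put $x_{\max}=e^{-\rho\beta(\gamma^2-\kappa)}$, and let $\mathcal P$ be the set of probability measures $\omega$ on $[0,x_{\max}]$ that are absolutely continuous with density $\omega(x)\le\frac1{\beta\rho\kappa x}$ for almost every $x\in(0,x_{\max}]$. On $\mathcal P$ consider $$\mathcal I[\omega]=-\frac12\int_0^1\!\!\int_0^1\bigl(\ln|x^\nu-y^\nu|+\ln|x-y|\bigr)\,\omega(dx)\,\omega(dy)-\frac1\kappa\int_0^1\!\int_{n_1}^{n_2}\ln\bigl(1-x^{r}e^{-\beta\alpha u}\bigr)\,du\,\omega(dx)-m_1\int_0^1\ln(x)\,\omega(dx)$$ (a well-defined element of $[0,\infty]$), where in Model Problem 1: $r=\nu$ and $\alpha=\nu\rho$; in Model Problem 2: $r=1$ and $\alpha=\rho$. Define in Model Problem 1 $$A=\exp\Bigl[\tfrac{\alpha\beta\kappa}{\nu}\bigl(\nu+1+m_1+\tfrac\nu\kappa(n_2-n_1)\bigr)\Bigr],\quad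 B=\exp\Bigl[\tfrac{\alpha\beta\kappa}{\nu}(1+m_1)\Bigr],$$ $$K_1=\Bigl[e^{n_1\alpha\beta}\tfrac{A(B-1)}{B(A-1)}\Bigr]^{1/\nu},\quad K_2=\Bigl[e^{n_2\alpha\beta}\tfrac{B-1}{A-1}\Bigr]^{1/\nu},$$ and in Model Problem 2 $$A=\exp\Bigl[\alpha\beta\kappa\bigl(\nu+1+m_1+\tfrac1\kappa(n_2-n_1)\bigr)\Bigr],\quad B=\exp\Bigl[\alpha\beta\kappa\bigl(1+m_1+\tfrac{n_2-n_1}\kappa\bigr)\Bigr],$$ $$K_1=e^{n_2\alpha\beta}\Bigl(\tfrac{A(B-1)}{B(A-1)}\Bigr)^{1/\nu},\quad K_2=e^{n_1\alpha\beta}\Bigl(\tfrac{B-1}{A-1}\Bigr)^{1/\nu}.$$ In both cases let $$s_1=A\,\frac{B-1}{A-B},\quad s_2=\frac{B-1}{A-B},\quad c_1=\frac{K_1-K_2}{s_1-s_2},\quad c_0=\frac{K_2s_1-K_1s_2}{s_1-s_2},$$ $$J(s)=J_{c_0,c_1}(s)=(c_1s+c_0)\Bigl(\frac{s+1}s\Bigr)^{1/\nu},\qquad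 s_{a}=-\frac{\nu-1}{2\nu}-\frac{\sqrt{4c_0c_1\nu+c_1^2(\nu-1)^2}}{2\nu c_1},\quad s_{b}=-\frac{\nu-1}{2\nu}+\frac{\sqrt{4c_0c_1\nu+c_1^2(\nu-1)^2}}{2\nu c_1},$$ with the principal power (so $J$ is analytic off $[-1,0]$), $a=J(s_a)$, $b=J(s_b)$. Let $\sigma_+$ be the set of points of the open upper half plane at which $J$ is real. Then $J$ maps $\sigma_+$ bijectively onto $(a,b)$; let $I_+:(a,b)\to\sigma_+$ be the inverse, and put $$\varphi(x)=\frac1{\pi\beta\rho\kappa x}\operatorname{Arg}\Bigl(\frac{s_1-I_+(x)}{s_2-I_+(x)}\Bigr),\qquad x\in(a,b),$$ where $\operatorname{Arg}$ is the principal argument. Then $0<\varphi(x)<\frac1{\beta\rho\kappa x}$ on $(a,b)$, and the following holds. (i) Subcritical regime ($s_1\le s_b$ in Model Problem 1, $s_2\ge s_b$ in Model Problem 2): $0\le a<b\le x_{\max}$, and $\mathcal I$ has a unique minimizer in $\mathcal P$, the measure with density $\omega(x)=\varphi(x)\,\mathbf 1_{x\in(a,b)}$. (ii) Supercritical regime ($s_1>s_b$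 in Model Problem 1, $s_2<s_b$ in Model Problem 2): $0\le a<b<x_{\max}$, and $\mathcal I$ has a unique minimizer in $\mathcal P$, the measure with density $$\omega(x)=\begin{cases}\varphi(x), & x\in(a,b),\\[2pt] \dfrac1{\beta\rho\kappa x}, & x\in(b,x_{\max}),\\[2pt] 0,&\text{otherwise.}\end{cases}$$ -/

import Mathlib

open MeasureTheory Set
open scoped ENNReal

noncomputable section

namespace MuttalibBorodin

/-- The two model problems: `nu` has the potential `ln (1 - x ^ ν e ^ (-β α u))`,
`one` has the potential `ln (1 - x e ^ (-β α u))`. -/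
inductive ModelProblem
  | nu
  | one

/-- The real parameters of a model problem. -/
structure Params where
  ν : ℝ
  α : ℝ
  β : ℝ
  κ : ℝ
  ρ : ℝ
  γ : ℝ
  m₁ : ℝ
  n₁ : ℝ
  n₂ : ℝ

/-- `-ln t` as an element of `[0, ∞]`, for `t ∈ [0, 1]`, with `-ln 0 = ∞`. -/
def negLog (t : ℝ) : ℝ≥0∞ :=
  if t ≤ 0 then ⊤ else ENNReal.ofReal (-Real.log t)

/-- The class `𝒫^δ([0, h])`: the probability measures on `[0, h]` that have a density with respect
to Lebesgue measure, bounded by `1 / (δ x)`. -/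
structure IsConstrained (δ h : ℝ) (ω : Measure ℝ) : Prop where
  prob : IsProbabilityMeasure ω
  supp : ω (Icc 0 h)ᶜ = 0
  ac : ω ≪ volume
  bound : ∀ᵐ x ∂(volume.restrict (Ioc 0 h)), ω.rnDeriv volume x ≤ ENNReal.ofReal (1 / (δ * x))

namespace Params

/-- The exponent of `x` inside the logarithm of the potential. -/
def potExp (p : Params) : ModelProblem → ℝ
  | .nu => p.ν
  | .one => 1

/-- The standing assumptions on the parameters. They make `xmax ^ potExp = e ^ (n₁ α β)`, so that
the argument of the logarithm in the potential is nonnegative on `[0, xmax]` for all `u ≥ n₁`. -/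
structure Admissible (p : Params) (M : ModelProblem) : Prop where
  one_lt_ν : 1 < p.ν
  β_pos : 0 < p.β
  κ_pos : 0 < p.κ
  ρ_pos : 0 < p.ρ
  α_eq : p.α = p.potExp M * p.ρ
  m₁_nonneg : 0 ≤ p.m₁
  n₁_le_n₂ : p.n₁ ≤ p.n₂
  κ_le : p.κ ≤ p.γ ^ 2
  n₁_eq : p.n₁ = -(p.γ ^ 2 - p.κ)

/-- The right end of the hard constraint interval. -/
def xmax (p : Params) : ℝ := Real.exp (-p.ρ * p.β * (p.γ ^ 2 - p.κ))

/-- The energy functional of the model problem. On the measures that live on `[0, xmax]` every one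
of its terms is nonnegative, so that it is a well-defined element of `[0, ∞]`. -/
def energy (p : Params) (M : ModelProblem) (ω : Measure ℝ) : ℝ≥0∞ :=
  2⁻¹ * (∫⁻ x in Icc 0 1, (∫⁻ y in Icc 0 1,
      (negLog |x ^ p.ν - y ^ p.ν| + negLog |x - y|) ∂ω) ∂ω)
    + ENNReal.ofReal (1 / p.κ) * (∫⁻ x in Icc 0 1, (∫⁻ u in Ioc p.n₁ p.n₂,
        negLog (1 - x ^ p.potExp M * Real.exp (-p.β * p.α * u)) ∂volume) ∂ω)
    + ENNReal.ofReal p.m₁ * (∫⁻ x in Icc 0 1, negLog x ∂ω)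

/-- `ω` is an equilibrium measure: it minimizes the energy in `𝒫^{βρκ}([0, xmax])`. -/
def IsEquilibrium (p : Params) (M : ModelProblem) (ω : Measure ℝ) : Prop :=
  IsConstrained (p.β * p.ρ * p.κ) p.xmax ω ∧
    ∀ ω' : Measure ℝ, IsConstrained (p.β * p.ρ * p.κ) p.xmax ω' → p.energy M ω ≤ p.energy M ω'

def A (p : Params) : ModelProblem → ℝ
  | .nu => Real.exp (p.α * p.β * p.κ / p.ν * (p.ν + 1 + p.m₁ + p.ν / p.κ * (p.n₂ - p.n₁)))
  | .one => Real.exp (p.α * p.β * p.κ * (p.ν + 1 + p.m₁ + 1 / p.κ * (p.n₂ - p.n₁)))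

def B (p : Params) : ModelProblem → ℝ
  | .nu => Real.exp (p.α * p.β * p.κ / p.ν * (1 + p.m₁))
  | .one => Real.exp (p.α * p.β * p.κ * (1 + p.m₁ + (p.n₂ - p.n₁) / p.κ))

def s₁ (p : Params) (M : ModelProblem) : ℝ := p.A M * ((p.B M - 1) / (p.A M - p.B M))

def s₂ (p : Params) (M : ModelProblem) : ℝ := (p.B M - 1) / (p.A M - p.B M)

def K₁ (p : Params) (M : ModelProblem) : ℝ :=
  match M with
  | .nu => (Real.exp (p.n₁ * p.α * p.β) *
      (p.A .nu * (p.B .nu - 1) / (p.B .nu * (p.A .nu - 1)))) ^ (1 / p.ν)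
  | .one => Real.exp (p.n₂ * p.α * p.β) *
      (p.A .one * (p.B .one - 1) / (p.B .one * (p.A .one - 1))) ^ (1 / p.ν)

def K₂ (p : Params) (M : ModelProblem) : ℝ :=
  match M with
  | .nu => (Real.exp (p.n₂ * p.α * p.β) * ((p.B .nu - 1) / (p.A .nu - 1))) ^ (1 / p.ν)
  | .one => Real.exp (p.n₁ * p.α * p.β) * ((p.B .one - 1) / (p.A .one - 1)) ^ (1 / p.ν)

def c₁ (p : Params) (M : ModelProblem) : ℝ := (p.K₁ M - p.K₂ M) / (p.s₁ M - p.s₂ M)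

def c₀ (p : Params) (M : ModelProblem) : ℝ :=
  (p.K₂ M * p.s₁ M - p.K₁ M * p.s₂ M) / (p.s₁ M - p.s₂ M)

/-- The map `J_{c₀,c₁}`. The quotient `(s + 1) / s` is a negative real number exactly for
`s ∈ (-1, 0)`, so with the principal power `J` is analytic off `[-1, 0]`
and `J s ∼ c₁ s` at infinity. -/
def J (p : Params) (M : ModelProblem) (s : ℂ) : ℂ :=
  ((p.c₁ M : ℂ) * s + (p.c₀ M : ℂ)) * ((s + 1) / s) ^ ((1 / p.ν : ℝ) : ℂ)

/-- The left critical point of `J`. -/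
def sa (p : Params) (M : ModelProblem) : ℝ :=
  -((p.ν - 1) / (2 * p.ν)) - 1 / (2 * p.ν * p.c₁ M) *
    Real.sqrt (4 * p.c₀ M * p.c₁ M * p.ν + p.c₁ M ^ 2 * (p.ν - 1) ^ 2)

/-- The right critical point of `J`. -/
def sb (p : Params) (M : ModelProblem) : ℝ :=
  -((p.ν - 1) / (2 * p.ν)) + 1 / (2 * p.ν * p.c₁ M) *
    Real.sqrt (4 * p.c₀ M * p.c₁ M * p.ν + p.c₁ M ^ 2 * (p.ν - 1) ^ 2)

/-- The left edge `a = J s_a` (`J` is real on the real line off `(-1, 0)`). -/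
def a (p : Params) (M : ModelProblem) : ℝ := (p.J M (p.sa M : ℂ)).re

/-- The right edge `b = J s_b`. -/
def b (p : Params) (M : ModelProblem) : ℝ := (p.J M (p.sb M : ℂ)).re

/-- The arc `σ₊` (without its end points `s_a`, `s_b`): the points of the open upper half plane
at which `J` is real. -/
def sigmaPlus (p : Params) (M : ModelProblem) : Set ℂ :=
  {s : ℂ | 0 < s.im ∧ (p.J M s).im = 0}

/-- `I₊`, the inverse of `J` on the arc `σ₊`. -/
def Iplus (p : Params) (M : ModelProblem) (x : ℝ) : ℂ :=
  Function.invFunOn (p.J M) (p.sigmaPlus M) (x : ℂ)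

/-- The upper constraint `1 / (β ρ κ x)`. -/
def upper (p : Params) (x : ℝ) : ℝ := 1 / (p.β * p.ρ * p.κ * x)

/-- The density on the band. -/
def bandDensity (p : Params) (M : ModelProblem) (x : ℝ) : ℝ :=
  1 / (Real.pi * p.β * p.ρ * p.κ * x) *
    Complex.arg (((p.s₁ M : ℂ) - p.Iplus M x) / ((p.s₂ M : ℂ) - p.Iplus M x))

def Subcritical (p : Params) : ModelProblem → Prop
  | .nu => p.s₁ .nu ≤ p.sb .nu
  | .one => p.sb .one ≤ p.s₂ .one

def Supercritical (p : Params) : ModelProblem → Prop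
  | .nu => p.sb .nu < p.s₁ .nu
  | .one => p.s₂ .one < p.sb .one

/-- The limit shape of the subcritical regime: a single band on `(a, b)`. -/
def subShape (p : Params) (M : ModelProblem) : Measure ℝ :=
  volume.withDensity fun x =>
    ENNReal.ofReal ((Ioo (p.a M) (p.b M)).indicator (p.bandDensity M) x)

/-- The limit shape of the supercritical regime: a band on `(a, b)`, followed by the saturated
region `(b, xmax)`. -/
def superShape (p : Params) (M : ModelProblem) : Measure ℝ :=
  volume.withDensity fun x =>
    ENNReal.ofReal ((Ioo (p.a M) (p.b M)).indicator (p.bandDensity M) x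
      + (Ioo (p.b M) p.xmax).indicator p.upper x)

end Params

end MuttalibBorodin

end

open MeasureTheory Set
open scoped ENNReal

noncomputable section

namespace MuttalibBorodin

open Filter Topology ComplexConjugate

/-! ### The principal logarithm on the closed upper half plane -/

lemma continuousWithinAt_log_upper {z : ℂ} (hz : z ≠ 0) :
    ContinuousWithinAt Complex.log {w | 0 ≤ w.im} z := by
  by_cases h : z ∈ Complex.slitPlane
  · exact (continuousAt_clog h).continuousWithinAt
  · rw [Complex.mem_slitPlane_iff] at h
    push Not at h
    refine Complex.continuousWithinAt_log_of_re_neg_of_im_zero (lt_of_le_of_ne h.1 ?_) h.2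
    intro h0
    exact hz (Complex.ext h0 h.2)

lemma mem_slitPlane_of_im_pos {z : ℂ} (h : 0 < z.im) : z ∈ Complex.slitPlane :=
  Complex.mem_slitPlane_iff.2 (Or.inr h.ne')

lemma ne_zero_of_im_pos {z : ℂ} (h : 0 < z.im) : z ≠ 0 := by
  rintro rfl; simp at h

lemma arg_pos_of_im_pos {z : ℂ} (h : 0 < z.im) : 0 < z.arg := by
  rcases (Complex.arg_nonneg_iff.2 h.le).lt_or_eq with h1 | h1
  · exact h1
  · exact absurd (Complex.arg_eq_zero_iff.1 h1.symm).2 h.ne'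

lemma arg_lt_pi_of_im_pos {z : ℂ} (h : 0 < z.im) : z.arg < Real.pi :=
  Complex.arg_lt_pi_iff.2 (Or.inr h.ne')

/-- The difference of the arguments of two points of the closed upper half plane is the argument
of the quotient. -/
lemma log_div_of_im_nonneg {z w : ℂ} (hz : z ≠ 0) (hw : w ≠ 0) (hzi : 0 ≤ z.im) (hwi : 0 ≤ w.im)
    (h : ¬ (z.arg = 0 ∧ w.arg = Real.pi)) :
    Complex.log (z / w) = Complex.log z - Complex.log w := by
  have e : z / w = Complex.exp (Complex.log z - Complex.log w) := by
    rw [Complex.exp_sub, Complex.exp_log hz, Complex.exp_log hw]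
  rw [e, Complex.log_exp]
  · simp only [Complex.sub_im, Complex.log_im]
    rcases (Complex.arg_nonneg_iff.2 hzi).lt_or_eq with h1 | h1
    · linarith [Complex.arg_le_pi w]
    · rcases (Complex.arg_le_pi w).lt_or_eq with h2 | h2
      · linarith
      · exact absurd ⟨h1.symm, h2⟩ h
  · simp only [Complex.sub_im, Complex.log_im]
    linarith [Complex.arg_le_pi z, Complex.arg_nonneg_iff.2 hwi]

lemma arg_div_of_im_pos {z w : ℂ} (hz : 0 < z.im) (hw : 0 < w.im) :
    (z / w).arg = z.arg - w.arg := by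
  have := log_div_of_im_nonneg (ne_zero_of_im_pos hz) (ne_zero_of_im_pos hw) hz.le hw.le
    (fun h => (arg_pos_of_im_pos hz).ne' h.1)
  simpa only [Complex.log_im, Complex.sub_im] using congrArg Complex.im this

lemma arg_sub_of_re_lt {z w : ℂ} (hz : 0 < z.im) (h : z.im = w.im) (hre : z.re < w.re) :
    0 < z.arg - w.arg := by
  have hw : 0 < w.im := h ▸ hz
  rw [← arg_div_of_im_pos hz hw]
  apply arg_pos_of_im_pos
  rw [Complex.div_im, ← sub_div, ← h]
  have : 0 < Complex.normSq w := Complex.normSq_pos.2 (ne_zero_of_im_pos hw)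
  apply div_pos _ this
  nlinarith

lemma arg_le_im_div_re {z : ℂ} (hz : 0 < z.re) (hi : 0 ≤ z.im) : z.arg ≤ z.im / z.re := by
  have h1 : Real.tan z.arg = z.im / z.re := Complex.tan_arg z
  rw [← h1]
  have h0 := Complex.arg_nonneg_iff.2 hi
  refine Real.le_tan h0 ?_
  have := Complex.abs_arg_lt_pi_div_two_iff.2 (Or.inl hz)
  rwa [abs_of_nonneg h0] at this

lemma im_div_norm_le_arg {z : ℂ} (hi : 0 ≤ z.im) : z.im / ‖z‖ ≤ z.arg := by
  rw [← Complex.sin_arg]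
  exact Real.sin_le (Complex.arg_nonneg_iff.2 hi)

/-- The coefficients of the map `(c₁ s + c₀) ((s + 1) / s) ^ (1 / ν)`. -/
structure ConfMap where
  ν : ℝ
  c₀ : ℝ
  c₁ : ℝ
  one_lt : 1 < ν
  c₁_pos : 0 < c₁
  c₁_le : c₁ ≤ c₀

namespace ConfMap

variable (d : ConfMap)

/-- The logarithm of the map, on the closed upper half plane. -/
def lam (s : ℂ) : ℂ :=
  Complex.log (d.c₁ * s + d.c₀) + ((1 / d.ν : ℝ) : ℂ) * (Complex.log (s + 1) - Complex.log s)

/-- The derivative of `lam`. -/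
def dlam (s : ℂ) : ℂ :=
  d.c₁ / (d.c₁ * s + d.c₀) + ((1 / d.ν : ℝ) : ℂ) * (1 / (s + 1) - 1 / s)

/-- The points that are neither zeros nor poles of the map. -/
def Reg (s : ℂ) : Prop := s ≠ 0 ∧ s + 1 ≠ 0 ∧ (d.c₁ : ℂ) * s + d.c₀ ≠ 0

lemma c₀_pos : 0 < d.c₀ := d.c₁_pos.trans_le d.c₁_le

lemma ν_pos : 0 < d.ν := zero_lt_one.trans d.one_lt

lemma im_affine (s : ℂ) : ((d.c₁ : ℂ) * s + d.c₀).im = d.c₁ * s.im := by simp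

lemma re_affine (s : ℂ) : ((d.c₁ : ℂ) * s + d.c₀).re = d.c₁ * s.re + d.c₀ := by simp

lemma im_affine_pos {s : ℂ} (h : 0 < s.im) : 0 < ((d.c₁ : ℂ) * s + d.c₀).im := by
  rw [im_affine]; exact mul_pos d.c₁_pos h

lemma im_add_one_pos {s : ℂ} (h : 0 < s.im) : 0 < (s + 1).im := by simpa using h

lemma reg_of_im_pos {s : ℂ} (h : 0 < s.im) : d.Reg s :=
  ⟨ne_zero_of_im_pos h, ne_zero_of_im_pos (im_add_one_pos h),
    ne_zero_of_im_pos (d.im_affine_pos h)⟩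

lemma continuousWithinAt_lam {s : ℂ} (hr : d.Reg s) :
    ContinuousWithinAt d.lam {z | 0 ≤ z.im} s := by
  unfold lam
  refine ContinuousWithinAt.add ?_ (ContinuousWithinAt.mul continuousWithinAt_const
    (ContinuousWithinAt.sub ?_ (continuousWithinAt_log_upper hr.1)))
  · refine ContinuousWithinAt.comp (f := fun z : ℂ => (d.c₁ : ℂ) * z + d.c₀) (g := Complex.log)
      (t := {z | 0 ≤ z.im}) (continuousWithinAt_log_upper hr.2.2)
      (Continuous.continuousWithinAt (by fun_prop)) ?_
    intro z hz
    rw [mem_ofPred_eq] at hz ⊢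
    rw [im_affine]
    exact mul_nonneg d.c₁_pos.le hz
  · refine ContinuousWithinAt.comp (f := fun z : ℂ => z + 1) (g := Complex.log)
      (t := {z | 0 ≤ z.im}) (continuousWithinAt_log_upper hr.2.1)
      (Continuous.continuousWithinAt (by fun_prop)) ?_
    intro z hz
    simpa using hz

lemma hasStrictDerivAt_lam {s : ℂ} (h0 : s ∈ Complex.slitPlane) (h1 : s + 1 ∈ Complex.slitPlane)
    (h2 : (d.c₁ : ℂ) * s + d.c₀ ∈ Complex.slitPlane) : HasStrictDerivAt d.lam (d.dlam s) s := by
  unfold lam dlam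
  have e1 : HasStrictDerivAt (fun s : ℂ => (d.c₁ : ℂ) * s + d.c₀) d.c₁ s := by
    simpa using ((hasStrictDerivAt_id s).const_mul (d.c₁ : ℂ)).add_const (d.c₀ : ℂ)
  have e2 : HasStrictDerivAt (fun s : ℂ => s + 1) 1 s := (hasStrictDerivAt_id s).add_const 1
  exact (e1.clog h2).add (((e2.clog h1).sub
    ((hasStrictDerivAt_id s).clog h0)).const_mul _)

lemma hasStrictDerivAt_lam_of_im_pos {s : ℂ} (h : 0 < s.im) :
    HasStrictDerivAt d.lam (d.dlam s) s :=
  d.hasStrictDerivAt_lam (mem_slitPlane_of_im_pos h) (mem_slitPlane_of_im_pos (im_add_one_pos h))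
    (mem_slitPlane_of_im_pos (d.im_affine_pos h))

lemma mul_dlam {s : ℂ} (hr : d.Reg s) :
    s * d.dlam s = 1 - d.c₀ / (d.c₁ * s + d.c₀) - ((1 / d.ν : ℝ) : ℂ) / (s + 1) := by
  obtain ⟨h0, h1, h2⟩ := hr
  unfold dlam
  generalize hq : (d.c₁ : ℂ) * s + d.c₀ = q at *
  have e1 : s * (d.c₁ / q) = 1 - d.c₀ / q := by
    rw [← mul_div_assoc, mul_comm, eq_sub_of_add_eq hq, sub_div, div_self h2]
  have e2 : s * (1 / (s + 1) - 1 / s) = - 1 / (s + 1) := by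
    field_simp
    ring
  rw [mul_add, e1, mul_left_comm, e2]
  ring

lemma im_neg_inv {z : ℂ} (h : 0 < z.im) {c : ℝ} (hc : 0 < c) : ((c : ℂ) / z).im < 0 := by
  have h3 : 0 < Complex.normSq z := Complex.normSq_pos.2 (ne_zero_of_im_pos h)
  rw [Complex.div_im]
  simp only [Complex.ofReal_im, Complex.ofReal_re, zero_mul, zero_div, zero_sub]
  have : 0 < c * z.im / Complex.normSq z := by positivity
  linarith

lemma im_mul_dlam_pos {s : ℂ} (h : 0 < s.im) : 0 < (s * d.dlam s).im := by
  rw [d.mul_dlam (d.reg_of_im_pos h)]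
  have h1 := im_neg_inv (d.im_affine_pos h) d.c₀_pos
  have h2 := im_neg_inv (im_add_one_pos h) (c := 1 / d.ν) (one_div_pos.2 d.ν_pos)
  simp only [Complex.sub_im, Complex.one_im]
  linarith

lemma dlam_ne_zero {s : ℂ} (h : 0 < s.im) : d.dlam s ≠ 0 := by
  intro h0
  have := d.im_mul_dlam_pos h
  simp [h0] at this

/-- `lam` is injective on the closed upper half plane, except for pairs of real points. -/
lemma lam_ne {s t : ℂ} (hs : 0 < s.im) (ht : 0 ≤ t.im) (hr : d.Reg t) (hst : s ≠ t) :
    d.lam s ≠ d.lam t := by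
  set a := Complex.log s with ha
  set b := Complex.log t with hb
  have hea : Complex.exp a = s := Complex.exp_log (ne_zero_of_im_pos hs)
  have heb : Complex.exp b = t := Complex.exp_log hr.1
  have hab : b - a ≠ 0 := by
    intro h
    apply hst
    rw [← hea, ← heb, sub_eq_zero.1 h]
  have ha0 : 0 < a.im := by rw [ha, Complex.log_im]; exact arg_pos_of_im_pos hs
  have ha1 : a.im < Real.pi := by rw [ha, Complex.log_im]; exact arg_lt_pi_of_im_pos hs
  have hb0 : 0 ≤ b.im := by rw [hb, Complex.log_im]; exact Complex.arg_nonneg_iff.2 ht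
  have hb1 : b.im ≤ Real.pi := by rw [hb, Complex.log_im]; exact Complex.arg_le_pi t
  let p : ℝ → ℂ := fun x => Complex.exp (a + x * (b - a))
  have hp : ∀ x ∈ Ico (0 : ℝ) 1, 0 < (p x).im := by
    intro x hx
    have h1 : (a + x * (b - a)).im = (1 - x) * a.im + x * b.im := by
      simp; ring
    have : 0 < Real.sin (a + x * (b - a)).im := by
      rw [h1]
      apply Real.sin_pos_of_pos_of_lt_pi
      · have := hx.1; have := hx.2; nlinarith
      · have := hx.1; have := hx.2; nlinarith
    simp only [p, Complex.exp_im]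
    positivity
  have hp1 : p 1 = t := by simp [p, heb]
  have hp0 : p 0 = s := by simp [p, hea]
  have hpc : Continuous p := by fun_prop
  have hder : ∀ x ∈ Ioo (0 : ℝ) 1,
      HasDerivAt (fun x => (d.lam (p x) / (b - a)).im) (p x * d.dlam (p x)).im x := by
    intro x hx
    have hx' := hp x ⟨hx.1.le, hx.2⟩
    have e1 : HasDerivAt p (p x * (b - a)) x := by
      have : HasDerivAt (fun x : ℝ => a + x * (b - a)) (b - a) x := by
        simpa using ((Complex.ofRealCLM.hasDerivAt (x := x)).mul_const (b - a)).const_add a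
      exact this.cexp
    have e2 := (((d.hasStrictDerivAt_lam_of_im_pos hx').hasDerivAt).comp x e1).div_const (b - a)
    have e3 : d.dlam (p x) * (p x * (b - a)) / (b - a) = p x * d.dlam (p x) := by
      field_simp
    rw [e3] at e2
    exact (Complex.imCLM.hasFDerivAt.comp_hasDerivAt x e2)
  have hmono : StrictMonoOn (fun x => (d.lam (p x) / (b - a)).im) (Icc 0 1) := by
    apply strictMonoOn_of_deriv_pos (convex_Icc 0 1)
    · have : ContinuousOn (fun x => d.lam (p x)) (Icc 0 1) := by
        intro x hx
        have him : 0 ≤ (p x).im ∧ d.Reg (p x) := by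
          rcases hx.2.lt_or_eq with h | h
          · exact ⟨(hp x ⟨hx.1, h⟩).le, d.reg_of_im_pos (hp x ⟨hx.1, h⟩)⟩
          · rw [h, hp1]; exact ⟨ht, hr⟩
        refine ContinuousWithinAt.comp (f := p) (g := d.lam) (t := {z | 0 ≤ z.im})
          (d.continuousWithinAt_lam him.2) hpc.continuousWithinAt ?_
        intro y hy
        rcases hy.2.lt_or_eq with h | h
        · exact (hp y ⟨hy.1, h⟩).le
        · rw [h, hp1]; exact ht
      exact Complex.continuous_im.comp_continuousOn (this.div_const _)
    · intro x hx
      rw [interior_Icc] at hx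
      rw [(hder x hx).deriv]
      exact d.im_mul_dlam_pos (hp x ⟨hx.1.le, hx.2⟩)
  have := hmono (left_mem_Icc.2 zero_le_one) (right_mem_Icc.2 zero_le_one) zero_lt_one
  simp only [hp0, hp1] at this
  intro h
  rw [h] at this
  exact lt_irrefl _ this

lemma lam_injOn : InjOn d.lam {s | 0 < s.im} := by
  intro s hs t ht h
  by_contra hst
  exact d.lam_ne hs (le_of_lt ht) (d.reg_of_im_pos ht) hst h

/-! ### Real part and imaginary part -/

lemma re_lam (s : ℂ) : (d.lam s).re =
    Real.log ‖(d.c₁ : ℂ) * s + d.c₀‖ + 1 / d.ν * (Real.log ‖s + 1‖ - Real.log ‖s‖) := by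
  unfold lam
  rw [Complex.add_re, Complex.re_ofReal_mul, Complex.sub_re, Complex.log_re, Complex.log_re,
    Complex.log_re]

lemma im_lam (s : ℂ) : (d.lam s).im =
    ((d.c₁ : ℂ) * s + d.c₀).arg - 1 / d.ν * (s.arg - (s + 1).arg) := by
  unfold lam
  rw [Complex.add_im, Complex.im_ofReal_mul, Complex.sub_im, Complex.log_im, Complex.log_im,
    Complex.log_im]
  ring

lemma exp_re_lam_mul {s : ℂ} (hr : d.Reg s) :
    Real.exp (d.ν * (d.lam s).re) * ‖s‖ = ‖(d.c₁ : ℂ) * s + d.c₀‖ ^ d.ν * ‖s + 1‖ := by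
  obtain ⟨h0, h1, h2⟩ := hr
  have hν := d.ν_pos
  have e : d.ν * (d.lam s).re = Real.log ‖(d.c₁ : ℂ) * s + d.c₀‖ * d.ν + Real.log ‖s + 1‖
      - Real.log ‖s‖ := by
    rw [re_lam]; field_simp; ring
  rw [e, Real.exp_sub, Real.exp_add, Real.exp_log (norm_pos_iff.2 h1),
    Real.exp_log (norm_pos_iff.2 h0), ← Real.rpow_def_of_pos (norm_pos_iff.2 h2)]
  have := norm_pos_iff.2 h0
  field_simp

lemma arg_sub_pos {s : ℂ} (h : 0 < s.im) : 0 < s.arg - (s + 1).arg :=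
  arg_sub_of_re_lt h (by simp) (by simp)

lemma im_lam_lt {s : ℂ} (h : 0 < s.im) : (d.lam s).im < Real.pi := by
  rw [im_lam]
  have h1 := arg_lt_pi_of_im_pos (d.im_affine_pos h)
  have h2 := mul_pos (one_div_pos.2 d.ν_pos) (arg_sub_pos h)
  linarith

lemma lt_im_lam {s : ℂ} (h : 0 < s.im) : -(Real.pi / d.ν) < (d.lam s).im := by
  rw [im_lam]
  have h1 := arg_pos_of_im_pos (d.im_affine_pos h)
  have h2 : s.arg - (s + 1).arg < Real.pi := by
    linarith [arg_lt_pi_of_im_pos h, arg_pos_of_im_pos (im_add_one_pos h)]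
  have h3 := mul_lt_mul_of_pos_left h2 (one_div_pos.2 d.ν_pos)
  rw [one_div_mul_eq_div, one_div_mul_eq_div] at h3
  rw [one_div_mul_eq_div]
  linarith

lemma arg_div_self_add_one {s : ℂ} (h : 0 < s.im) : (s / (s + 1)).arg = s.arg - (s + 1).arg :=
  arg_div_of_im_pos h (im_add_one_pos h)

lemma im_div_self_add_one (s : ℂ) : (s / (s + 1)).im = s.im / Complex.normSq (s + 1) := by
  rw [Complex.div_im, ← sub_div]
  congr 1
  simp
  ring

lemma im_lam_le {s : ℂ} (h : 0 < s.im) (hre : 0 < d.c₁ * s.re + d.c₀) :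
    (d.lam s).im ≤ s.im * (d.c₁ / (d.c₁ * s.re + d.c₀) - 1 / (d.ν * (‖s‖ * ‖s + 1‖))) := by
  have h1 := arg_le_im_div_re (z := (d.c₁ : ℂ) * s + d.c₀) (by rwa [re_affine])
    (d.im_affine_pos h).le
  rw [re_affine, im_affine] at h1
  have hs := norm_pos_iff.2 (ne_zero_of_im_pos h)
  have hs1 := norm_pos_iff.2 (ne_zero_of_im_pos (im_add_one_pos h))
  have h2 : s.im / (‖s‖ * ‖s + 1‖) ≤ s.arg - (s + 1).arg := by
    rw [← arg_div_self_add_one h]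
    have him : 0 ≤ (s / (s + 1)).im := by
      rw [im_div_self_add_one]
      exact div_nonneg h.le (Complex.normSq_nonneg _)
    refine le_trans (le_of_eq ?_) (im_div_norm_le_arg him)
    rw [im_div_self_add_one, norm_div, Complex.normSq_eq_norm_sq]
    field_simp
  have h3 := mul_le_mul_of_nonneg_left h2 (one_div_pos.2 d.ν_pos).le
  rw [im_lam]
  have hν := d.ν_pos
  calc _ ≤ d.c₁ * s.im / (d.c₁ * s.re + d.c₀) - 1 / d.ν * (s.im / (‖s‖ * ‖s + 1‖)) := by linarith
    _ = _ := by field_simp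

lemma le_im_lam {s : ℂ} (h : 0 < s.im) (hre : 0 < ‖s‖ ^ 2 + s.re) :
    s.im * (d.c₁ / ‖(d.c₁ : ℂ) * s + d.c₀‖ - 1 / (d.ν * (‖s‖ ^ 2 + s.re))) ≤ (d.lam s).im := by
  have h1 := im_div_norm_le_arg (d.im_affine_pos h).le
  rw [im_affine] at h1
  have hs1 : 0 < Complex.normSq (s + 1) :=
    Complex.normSq_pos.2 (ne_zero_of_im_pos (im_add_one_pos h))
  have hre' : (s / (s + 1)).re = (‖s‖ ^ 2 + s.re) / Complex.normSq (s + 1) := by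
    rw [Complex.div_re, ← add_div, ← Complex.normSq_eq_norm_sq, Complex.normSq_apply s]
    congr 1
    simp
    ring
  have h2 : s.arg - (s + 1).arg ≤ s.im / (‖s‖ ^ 2 + s.re) := by
    rw [← arg_div_self_add_one h]
    have := arg_le_im_div_re (z := s / (s + 1)) (by rw [hre']; positivity)
      (by rw [im_div_self_add_one]; positivity)
    rw [hre', im_div_self_add_one] at this
    refine this.trans (le_of_eq ?_)
    field_simp
  have h3 := mul_le_mul_of_nonneg_left h2 (one_div_pos.2 d.ν_pos).le
  rw [im_lam]
  have hν := d.ν_pos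
  refine le_trans (le_of_eq ?_) (sub_le_sub h1 h3)
  field_simp

end ConfMap

namespace ConfMap

variable (d : ConfMap)

/-! ### The real line -/

/-- The left critical point. -/
def sa : ℝ := -((d.ν - 1) / (2 * d.ν)) - 1 / (2 * d.ν * d.c₁) *
    Real.sqrt (4 * d.c₀ * d.c₁ * d.ν + d.c₁ ^ 2 * (d.ν - 1) ^ 2)

/-- The right critical point. -/
def sb : ℝ := -((d.ν - 1) / (2 * d.ν)) + 1 / (2 * d.ν * d.c₁) *
    Real.sqrt (4 * d.c₀ * d.c₁ * d.ν + d.c₁ ^ 2 * (d.ν - 1) ^ 2)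

/-- The zero of the linear factor. -/
def s0 : ℝ := -d.c₀ / d.c₁

/-- The logarithm of the modulus of the map on the real line. -/
def rlam (t : ℝ) : ℝ :=
  Real.log (d.c₁ * t + d.c₀) + 1 / d.ν * (Real.log (t + 1) - Real.log t)

/-- The left edge. -/
def a : ℝ := (d.c₁ * d.sa + d.c₀) * ((d.sa + 1) / d.sa) ^ (1 / d.ν)

/-- The right edge. -/
def b : ℝ := Real.exp (d.rlam d.sb)

lemma quadratic_factor (t : ℝ) :
    d.ν * d.c₁ * t * (t + 1) - (d.c₁ * t + d.c₀) = d.ν * d.c₁ * (t - d.sa) * (t - d.sb) := by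
  have hν := d.ν_pos
  have h1 := d.c₁_pos
  have h0 := d.c₀_pos
  have hD : 0 ≤ 4 * d.c₀ * d.c₁ * d.ν + d.c₁ ^ 2 * (d.ν - 1) ^ 2 := by positivity
  have hsq := Real.sq_sqrt hD
  unfold sa sb
  generalize Real.sqrt (4 * d.c₀ * d.c₁ * d.ν + d.c₁ ^ 2 * (d.ν - 1) ^ 2) = D at hsq
  have e : d.ν * d.c₁ * (t - (-((d.ν - 1) / (2 * d.ν)) - 1 / (2 * d.ν * d.c₁) * D)) *
      (t - (-((d.ν - 1) / (2 * d.ν)) + 1 / (2 * d.ν * d.c₁) * D)) =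
      d.ν * d.c₁ * (t + (d.ν - 1) / (2 * d.ν)) ^ 2 - D ^ 2 / (4 * d.ν * d.c₁) := by
    field_simp; ring
  rw [e, hsq]
  field_simp
  ring

lemma sa_le_sb : d.sa ≤ d.sb := by
  unfold sa sb
  have hν := d.ν_pos
  have h1 := d.c₁_pos
  have : 0 ≤ 1 / (2 * d.ν * d.c₁) *
    Real.sqrt (4 * d.c₀ * d.c₁ * d.ν + d.c₁ ^ 2 * (d.ν - 1) ^ 2) := by positivity
  linarith

lemma sb_pos : 0 < d.sb := by
  have h := d.quadratic_factor 0
  have hν := d.ν_pos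
  have h1 := d.c₁_pos
  have h0 := d.c₀_pos
  have h2 := d.sa_le_sb
  by_contra! hsb
  have : 0 ≤ d.ν * d.c₁ * ((0 - d.sa) * (0 - d.sb)) :=
    mul_nonneg (by positivity) (mul_nonneg (by linarith) (by linarith))
  nlinarith

lemma sa_le_neg_one : d.sa ≤ -1 := by
  have h := d.quadratic_factor (-1)
  have hνc : 0 < d.ν * d.c₁ := mul_pos d.ν_pos d.c₁_pos
  have hb := d.sb_pos
  have hc := d.c₁_le
  by_contra! hsa
  have : 0 < d.ν * d.c₁ * ((-1 - d.sa) * (-1 - d.sb)) :=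
    mul_pos hνc (mul_pos_of_neg_of_neg (by linarith) (by linarith))
  nlinarith

lemma s0_le_neg_one : d.s0 ≤ -1 := by
  unfold s0
  rw [div_le_iff₀ d.c₁_pos]
  linarith [d.c₁_le]

lemma affine_eq (t : ℝ) : d.c₁ * t + d.c₀ = d.c₁ * (t - d.s0) := by
  unfold s0
  have := d.c₁_pos
  field_simp
  ring

lemma affine_s0 : d.c₁ * d.s0 + d.c₀ = 0 := by rw [affine_eq]; simp

lemma affine_pos_iff {t : ℝ} : 0 < d.c₁ * t + d.c₀ ↔ d.s0 < t := by
  rw [affine_eq, mul_pos_iff_of_pos_left d.c₁_pos, sub_pos]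

lemma s0_le_sa : d.s0 ≤ d.sa := by
  have h := d.quadratic_factor d.s0
  rw [affine_s0] at h
  have hνc : 0 < d.ν * d.c₁ := mul_pos d.ν_pos d.c₁_pos
  have hb := d.sb_pos
  have hs := d.s0_le_neg_one
  by_contra! hsa
  have h1 : 0 ≤ d.ν * d.c₁ * (d.s0 * (d.s0 + 1)) :=
    mul_nonneg hνc.le (mul_nonneg_of_nonpos_of_nonpos (by linarith) (by linarith))
  have : d.ν * d.c₁ * ((d.s0 - d.sa) * (d.s0 - d.sb)) < 0 :=
    mul_neg_of_pos_of_neg hνc (mul_neg_of_pos_of_neg (by linarith) (by linarith))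
  nlinarith

lemma s0_lt_neg_one (h : d.c₁ < d.c₀) : d.s0 < -1 := by
  unfold s0
  rw [div_lt_iff₀ d.c₁_pos]
  linarith

lemma sa_lt_neg_one (h : d.c₁ < d.c₀) : d.sa < -1 := by
  rcases d.sa_le_neg_one.lt_or_eq with h1 | h1
  · exact h1
  · have := d.quadratic_factor (-1)
    rw [h1] at this
    norm_num at this
    linarith

lemma s0_lt_sa (h : d.c₁ < d.c₀) : d.s0 < d.sa := by
  rcases d.s0_le_sa.lt_or_eq with h1 | h1
  · exact h1
  · have := d.quadratic_factor d.s0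
    rw [affine_s0, ← h1, sub_self, sub_zero, mul_zero, zero_mul] at this
    have h2 := d.s0_lt_neg_one h
    have h3 : 0 < d.ν * d.c₁ * (d.s0 * (d.s0 + 1)) :=
      mul_pos (mul_pos d.ν_pos d.c₁_pos) (mul_pos_of_neg_of_neg (by linarith) (by linarith))
    linarith

lemma c₁_lt_of_s0_lt {t : ℝ} (h1 : d.s0 < t) (h2 : t < -1) : d.c₁ < d.c₀ := by
  have := d.affine_pos_iff.2 h1
  nlinarith [d.c₁_pos]

lemma reg_ofReal {t : ℝ} : d.Reg (t : ℂ) ↔ t ≠ 0 ∧ t + 1 ≠ 0 ∧ d.c₁ * t + d.c₀ ≠ 0 := by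
  unfold Reg
  norm_cast

lemma reg_of_pos {t : ℝ} (h : 0 < t) : d.Reg (t : ℂ) :=
  d.reg_ofReal.2 ⟨h.ne', by positivity,
    (by have := mul_pos d.c₁_pos h; have := d.c₀_pos; positivity)⟩

lemma reg_of_mem_left {t : ℝ} (h1 : d.s0 < t) (h2 : t < -1) : d.Reg (t : ℂ) :=
  d.reg_ofReal.2 ⟨by linarith, by linarith, (d.affine_pos_iff.2 h1).ne'⟩

lemma re_lam_ofReal (t : ℝ) : (d.lam t).re = d.rlam t := by
  rw [re_lam, rlam]
  norm_cast
  simp only [Real.norm_eq_abs, Real.log_abs]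

lemma arg_ofReal_of_pos {t : ℝ} (h : 0 < t) : (t : ℂ).arg = 0 := Complex.arg_ofReal_of_nonneg h.le

lemma im_lam_ofReal (t : ℝ) : (d.lam t).im =
    ((d.c₁ * t + d.c₀ : ℝ) : ℂ).arg - 1 / d.ν * ((t : ℂ).arg - ((t + 1 : ℝ) : ℂ).arg) := by
  rw [im_lam]
  push_cast
  rfl

lemma im_lam_of_pos {t : ℝ} (h : 0 < t) : (d.lam t).im = 0 := by
  have := mul_pos d.c₁_pos h
  have := d.c₀_pos
  rw [im_lam_ofReal, arg_ofReal_of_pos h, arg_ofReal_of_pos (t := t + 1) (by linarith),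
    arg_ofReal_of_pos (by linarith)]
  simp

lemma im_lam_of_mem_left {t : ℝ} (h1 : d.s0 < t) (h2 : t < -1) : (d.lam t).im = 0 := by
  rw [im_lam_ofReal, arg_ofReal_of_pos (d.affine_pos_iff.2 h1),
    Complex.arg_ofReal_of_neg (by linarith : t < 0),
    Complex.arg_ofReal_of_neg (by linarith : t + 1 < 0)]
  simp

lemma im_lam_of_mem_cut {t : ℝ} (h1 : -1 < t) (h2 : t < 0) :
    (d.lam t).im = -(Real.pi / d.ν) := by
  have := d.s0_le_neg_one
  rw [im_lam_ofReal, arg_ofReal_of_pos (d.affine_pos_iff.2 (by linarith)),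
    Complex.arg_ofReal_of_neg h2, arg_ofReal_of_pos (by linarith : 0 < t + 1)]
  ring

lemma im_lam_of_lt {t : ℝ} (h : t < d.s0) : (d.lam t).im = Real.pi := by
  have := d.s0_le_neg_one
  have h3 : d.c₁ * t + d.c₀ < 0 := by
    rw [affine_eq]; exact mul_neg_of_pos_of_neg d.c₁_pos (by linarith)
  rw [im_lam_ofReal, Complex.arg_ofReal_of_neg h3,
    Complex.arg_ofReal_of_neg (by linarith : t < 0),
    Complex.arg_ofReal_of_neg (by linarith : t + 1 < 0)]
  simp

lemma lam_of_pos {t : ℝ} (h : 0 < t) : d.lam t = d.rlam t :=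
  Complex.ext (by rw [re_lam_ofReal, Complex.ofReal_re])
    (by rw [d.im_lam_of_pos h, Complex.ofReal_im])

lemma lam_of_mem_left {t : ℝ} (h1 : d.s0 < t) (h2 : t < -1) : d.lam t = d.rlam t :=
  Complex.ext (by rw [re_lam_ofReal, Complex.ofReal_re])
    (by rw [d.im_lam_of_mem_left h1 h2, Complex.ofReal_im])

/-- The derivative of `rlam`. -/
def drlam (t : ℝ) : ℝ :=
  d.c₁ * (t - d.sa) * (t - d.sb) / (t * (t + 1) * (d.c₁ * t + d.c₀))

lemma drlam_eq {t : ℝ} (h : d.Reg (t : ℂ)) :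
    d.drlam t = d.c₁ / (d.c₁ * t + d.c₀) + 1 / d.ν * (1 / (t + 1) - 1 / t) := by
  obtain ⟨h0, h1, h2⟩ := d.reg_ofReal.1 h
  have hν := d.ν_pos
  have hq := d.quadratic_factor t
  unfold drlam
  generalize hy : d.c₁ * t + d.c₀ = y at *
  have e : d.c₁ * (t - d.sa) * (t - d.sb) = (d.ν * d.c₁ * t * (t + 1) - y) / d.ν := by
    rw [hq]; field_simp
  rw [e]
  field_simp
  ring

lemma dlam_ofReal {t : ℝ} (h : d.Reg (t : ℂ)) : d.dlam t = d.drlam t := by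
  rw [d.drlam_eq h, dlam]
  push_cast
  rfl

lemma hasDerivAt_rlam {t : ℝ} (h : d.Reg (t : ℂ)) : HasDerivAt d.rlam (d.drlam t) t := by
  rw [d.drlam_eq h]
  obtain ⟨h0, h1, h2⟩ := d.reg_ofReal.1 h
  unfold rlam
  have e1 : HasDerivAt (fun s : ℝ => d.c₁ * s + d.c₀) d.c₁ t := by
    simpa using ((hasDerivAt_id t).const_mul d.c₁).add_const d.c₀
  have e2 : HasDerivAt (fun s : ℝ => s + 1) 1 t := (hasDerivAt_id t).add_const 1
  have := (e1.log h2).add (((e2.log h1).sub ((hasDerivAt_id t).log h0)).const_mul (1 / d.ν))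
  exact this

lemma drlam_neg_of_pos {t : ℝ} (h0 : 0 < t) (h : t < d.sb) : d.drlam t < 0 := by
  have h1 := d.sa_le_neg_one
  have h2 := d.c₁_pos
  have h3 := d.c₀_pos
  unfold drlam
  apply div_neg_of_neg_of_pos
  · exact mul_neg_of_pos_of_neg (mul_pos h2 (by linarith)) (by linarith)
  · positivity

lemma drlam_pos_of_gt {t : ℝ} (h : d.sb < t) : 0 < d.drlam t := by
  have h1 := d.sa_le_neg_one
  have h2 := d.c₁_pos
  have h3 := d.c₀_pos
  have h4 := d.sb_pos
  have h5 : 0 < t := h4.trans h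
  unfold drlam
  apply div_pos
  · exact mul_pos (mul_pos h2 (by linarith)) (by linarith)
  · positivity

lemma drlam_pos_of_mem_left {t : ℝ} (h0 : d.s0 < t) (h : t < d.sa) : 0 < d.drlam t := by
  have h1 := d.sa_le_neg_one
  have h2 := d.c₁_pos
  have h4 := d.sb_pos
  unfold drlam
  apply div_pos
  · exact mul_pos_of_neg_of_neg (mul_neg_of_pos_of_neg h2 (by linarith)) (by linarith)
  · exact mul_pos (mul_pos_of_neg_of_neg (by linarith) (by linarith)) (d.affine_pos_iff.2 h0)

lemma drlam_neg_of_mem_left {t : ℝ} (h0 : d.sa < t) (h : t < -1) : d.drlam t < 0 := by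
  have h1 := d.s0_le_sa
  have h2 := d.c₁_pos
  have h4 := d.sb_pos
  unfold drlam
  apply div_neg_of_neg_of_pos
  · exact mul_neg_of_pos_of_neg (mul_pos h2 (by linarith)) (by linarith)
  · exact mul_pos (mul_pos_of_neg_of_neg (by linarith) (by linarith))
      (d.affine_pos_iff.2 (by linarith))

lemma continuousOn_rlam_pos : ContinuousOn d.rlam (Ioi 0) := fun _ ht =>
  (d.hasDerivAt_rlam (d.reg_of_pos ht)).continuousAt.continuousWithinAt

lemma continuousOn_rlam_left : ContinuousOn d.rlam (Ioo d.s0 (-1)) := fun _ ht =>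
  (d.hasDerivAt_rlam (d.reg_of_mem_left ht.1 ht.2)).continuousAt.continuousWithinAt

lemma strictAntiOn_rlam : StrictAntiOn d.rlam (Ioc 0 d.sb) := by
  apply strictAntiOn_of_deriv_neg (convex_Ioc _ _)
    (d.continuousOn_rlam_pos.mono fun _ h => h.1)
  intro x hx
  rw [interior_Ioc] at hx
  rw [(d.hasDerivAt_rlam (d.reg_of_pos hx.1)).deriv]
  exact d.drlam_neg_of_pos hx.1 hx.2

lemma strictMonoOn_rlam : StrictMonoOn d.rlam (Ici d.sb) := by
  apply strictMonoOn_of_deriv_pos (convex_Ici _)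
    (d.continuousOn_rlam_pos.mono fun _ h => d.sb_pos.trans_le h)
  intro x hx
  rw [interior_Ici] at hx
  rw [(d.hasDerivAt_rlam (d.reg_of_pos (d.sb_pos.trans hx))).deriv]
  exact d.drlam_pos_of_gt hx

lemma strictMonoOn_rlam_left : StrictMonoOn d.rlam (Ioo d.s0 (-1) ∩ Iic d.sa) := by
  apply strictMonoOn_of_deriv_pos ((convex_Ioo _ _).inter (convex_Iic _))
    (d.continuousOn_rlam_left.mono inter_subset_left)
  intro x hx
  rw [interior_inter, interior_Ioo, interior_Iic] at hx
  rw [(d.hasDerivAt_rlam (d.reg_of_mem_left hx.1.1 hx.1.2)).deriv]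
  exact d.drlam_pos_of_mem_left hx.1.1 hx.2

lemma strictAntiOn_rlam_left : StrictAntiOn d.rlam (Ioo d.s0 (-1) ∩ Ici d.sa) := by
  apply strictAntiOn_of_deriv_neg ((convex_Ioo _ _).inter (convex_Ici _))
    (d.continuousOn_rlam_left.mono inter_subset_left)
  intro x hx
  rw [interior_inter, interior_Ioo, interior_Ici] at hx
  rw [(d.hasDerivAt_rlam (d.reg_of_mem_left hx.1.1 hx.1.2)).deriv]
  exact d.drlam_neg_of_mem_left hx.2 hx.1.2

lemma rlam_sb_le {t : ℝ} (h : 0 < t) : d.rlam d.sb ≤ d.rlam t := by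
  rcases le_total t d.sb with h1 | h1
  · exact d.strictAntiOn_rlam.antitoneOn ⟨h, h1⟩ ⟨d.sb_pos, le_rfl⟩ h1
  · exact d.strictMonoOn_rlam.monotoneOn self_mem_Ici h1 h1

lemma a_eq (h : d.c₁ < d.c₀) : d.a = Real.exp (d.rlam d.sa) := by
  have h1 := d.sa_lt_neg_one h
  have h2 := d.affine_pos_iff.2 (d.s0_lt_sa h)
  have h3 : 0 < (d.sa + 1) / d.sa := div_pos_of_neg_of_neg (by linarith) (by linarith)
  unfold a rlam
  rw [Real.exp_add, Real.exp_log h2, Real.rpow_def_of_pos h3,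
    Real.log_div (by linarith) (by linarith), mul_comm (1 / d.ν)]

lemma a_eq_zero (h : d.c₁ = d.c₀) : d.a = 0 := by
  have h1 : d.s0 = -1 := by
    unfold s0
    rw [h, neg_div, div_self d.c₀_pos.ne']
  have h2 : d.sa = -1 := le_antisymm d.sa_le_neg_one (h1 ▸ d.s0_le_sa)
  unfold a
  rw [h2, h]
  ring

lemma a_nonneg : 0 ≤ d.a := by
  rcases d.c₁_le.lt_or_eq with h | h
  · rw [d.a_eq h]; positivity
  · rw [d.a_eq_zero h]

lemma c₁_lt_of_a_pos (h : 0 < d.a) : d.c₁ < d.c₀ := by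
  rcases d.c₁_le.lt_or_eq with h1 | h1
  · exact h1
  · rw [d.a_eq_zero h1] at h; exact absurd h (lt_irrefl _)

lemma exp_rlam_le_a {t : ℝ} (h1 : d.s0 < t) (h2 : t < -1) : Real.exp (d.rlam t) ≤ d.a := by
  have hc := d.c₁_lt_of_s0_lt h1 h2
  rw [d.a_eq hc, Real.exp_le_exp]
  have hm : d.sa ∈ Ioo d.s0 (-1) := ⟨d.s0_lt_sa hc, d.sa_lt_neg_one hc⟩
  rcases le_total t d.sa with h | h
  · exact d.strictMonoOn_rlam_left.monotoneOn ⟨⟨h1, h2⟩, h⟩ ⟨hm, self_mem_Iic⟩ h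
  · exact d.strictAntiOn_rlam_left.antitoneOn ⟨hm, self_mem_Ici⟩ ⟨⟨h1, h2⟩, h⟩ h

lemma exists_ge_sb {τ : ℝ} (h : d.b ≤ Real.exp τ) : ∃ t, d.sb ≤ t ∧ d.rlam t = τ := by
  have hc1 := d.c₁_pos
  have hc0 := d.c₀_pos
  have hb := d.sb_pos
  rw [b, Real.exp_le_exp] at h
  set T := max d.sb (Real.exp τ / d.c₁)
  have hT : τ ≤ d.rlam T := by
    have hT0 : 0 < T := hb.trans_le (le_max_left _ _)
    have h1 : Real.exp τ ≤ d.c₁ * T + d.c₀ := by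
      have : Real.exp τ / d.c₁ ≤ T := le_max_right _ _
      rw [div_le_iff₀ hc1] at this
      linarith
    have h2 : τ ≤ Real.log (d.c₁ * T + d.c₀) :=
      (Real.le_log_iff_exp_le ((Real.exp_pos _).trans_le h1)).2 h1
    have h3 : Real.log T ≤ Real.log (T + 1) := Real.log_le_log hT0 (by linarith)
    unfold rlam
    have := mul_nonneg (one_div_pos.2 d.ν_pos).le (sub_nonneg.2 h3)
    linarith
  obtain ⟨t, ht, hte⟩ := intermediate_value_Icc (le_max_left d.sb (Real.exp τ / d.c₁))
    (d.continuousOn_rlam_pos.mono fun _ h => hb.trans_le h.1) ⟨h, hT⟩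
  exact ⟨t, ht.1, hte⟩

lemma exists_le_sb {τ : ℝ} (h : d.b ≤ Real.exp τ) : ∃ t, 0 < t ∧ t ≤ d.sb ∧ d.rlam t = τ := by
  have hc1 := d.c₁_pos
  have hc0 := d.c₀_pos
  have hb := d.sb_pos
  have hν := d.ν_pos
  rw [b, Real.exp_le_exp] at h
  set T := min d.sb (Real.exp (-d.ν * (τ - Real.log d.c₀))) with hTd
  have hT0 : 0 < T := lt_min hb (Real.exp_pos _)
  have hT : τ ≤ d.rlam T := by
    have h1 : Real.log T ≤ -d.ν * (τ - Real.log d.c₀) := by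
      rw [Real.log_le_iff_le_exp hT0]
      exact min_le_right _ _
    have h2 : Real.log d.c₀ ≤ Real.log (d.c₁ * T + d.c₀) :=
      Real.log_le_log hc0 (by have := mul_pos hc1 hT0; linarith)
    have h3 : 0 ≤ Real.log (T + 1) := Real.log_nonneg (by linarith)
    have h4 : 1 / d.ν * (d.ν * (τ - Real.log d.c₀)) ≤ 1 / d.ν * (Real.log (T + 1) - Real.log T) :=
      mul_le_mul_of_nonneg_left (by linarith) (by positivity)
    have h5 : 1 / d.ν * (d.ν * (τ - Real.log d.c₀)) = τ - Real.log d.c₀ := by field_simp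
    unfold rlam
    linarith
  obtain ⟨t, ht, hte⟩ := intermediate_value_Icc' (min_le_left d.sb _)
    (d.continuousOn_rlam_pos.mono fun _ h => hT0.trans_le h.1) ⟨h, hT⟩
  exact ⟨t, hT0.trans_le ht.1, ht.2, hte⟩

lemma exists_le_sa {τ : ℝ} (h : Real.exp τ ≤ d.a) : ∃ t, d.s0 < t ∧ t ≤ d.sa ∧ d.rlam t = τ := by
  have hc := d.c₁_lt_of_a_pos ((Real.exp_pos _).trans_le h)
  have hc1 := d.c₁_pos
  have hsa := d.sa_lt_neg_one hc
  have h0a := d.s0_lt_sa hc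
  rw [d.a_eq hc, Real.exp_le_exp] at h
  set T := min d.sa (d.s0 + Real.exp τ / d.c₁) with hTd
  have hT0 : d.s0 < T := lt_min h0a (by have := div_pos (Real.exp_pos τ) hc1; linarith)
  have hTa : T ≤ d.sa := min_le_left _ _
  have hT : d.rlam T ≤ τ := by
    have h1 : d.c₁ * T + d.c₀ ≤ Real.exp τ := by
      rw [affine_eq]
      have : T - d.s0 ≤ Real.exp τ / d.c₁ := by
        have : T ≤ d.s0 + Real.exp τ / d.c₁ := min_le_right _ _
        linarith
      rwa [le_div_iff₀ hc1, mul_comm] at this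
    have h2 : Real.log (d.c₁ * T + d.c₀) ≤ τ :=
      (Real.log_le_iff_le_exp (d.affine_pos_iff.2 hT0)).2 h1
    have h3 : Real.log (T + 1) ≤ Real.log T := by
      rw [← Real.log_neg_eq_log (T + 1), ← Real.log_neg_eq_log T]
      exact Real.log_le_log (by linarith) (by linarith)
    unfold rlam
    have := mul_nonneg (one_div_pos.2 d.ν_pos).le (sub_nonneg.2 h3)
    linarith
  obtain ⟨t, ht, hte⟩ := intermediate_value_Icc hTa
    (d.continuousOn_rlam_left.mono fun _ h => ⟨hT0.trans_le h.1, by linarith [h.2]⟩) ⟨hT, h⟩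
  exact ⟨t, hT0.trans_le ht.1, ht.2, hte⟩

lemma exists_ge_sa {τ : ℝ} (h : Real.exp τ ≤ d.a) : ∃ t, d.sa ≤ t ∧ t < -1 ∧ d.rlam t = τ := by
  have hc := d.c₁_lt_of_a_pos ((Real.exp_pos _).trans_le h)
  have hc1 := d.c₁_pos
  have hν := d.ν_pos
  have hsa := d.sa_lt_neg_one hc
  have h0a := d.s0_lt_sa hc
  rw [d.a_eq hc, Real.exp_le_exp] at h
  set T := max d.sa (-1 - Real.exp (d.ν * (τ - Real.log (d.c₀ - d.c₁)))) with hTd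
  have hT1 : T < -1 := max_lt hsa
    (by have := Real.exp_pos (d.ν * (τ - Real.log (d.c₀ - d.c₁))); linarith)
  have hTa : d.sa ≤ T := le_max_left _ _
  have hT : d.rlam T ≤ τ := by
    have h1 : Real.log (T + 1) ≤ d.ν * (τ - Real.log (d.c₀ - d.c₁)) := by
      rw [← Real.log_neg_eq_log (T + 1), Real.log_le_iff_le_exp (by linarith)]
      have : -1 - Real.exp (d.ν * (τ - Real.log (d.c₀ - d.c₁))) ≤ T := le_max_right _ _
      linarith
    have h2 : Real.log (d.c₁ * T + d.c₀) ≤ Real.log (d.c₀ - d.c₁) :=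
      Real.log_le_log (d.affine_pos_iff.2 (by linarith)) (by nlinarith)
    have h3 : 0 ≤ Real.log T := by
      rw [← Real.log_neg_eq_log T]
      exact Real.log_nonneg (by linarith)
    have h4 : 1 / d.ν * (Real.log (T + 1) - Real.log T) ≤
        1 / d.ν * (d.ν * (τ - Real.log (d.c₀ - d.c₁))) :=
      mul_le_mul_of_nonneg_left (by linarith) (by positivity)
    have h5 : 1 / d.ν * (d.ν * (τ - Real.log (d.c₀ - d.c₁))) = τ - Real.log (d.c₀ - d.c₁) := by
      field_simp
    unfold rlam
    linarith
  obtain ⟨t, ht, hte⟩ := intermediate_value_Icc' hTa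
    (d.continuousOn_rlam_left.mono fun _ h => ⟨by linarith [h.1], by linarith [h.2]⟩) ⟨hT, h⟩
  exact ⟨t, ht.1, by linarith [ht.2], hte⟩

/-! ### The image of the upper half plane -/

/-- A point where the map takes a value along an ultrafilter: the zeros, the poles and infinity
are excluded. -/
lemma exists_tendsto_of_tendsto_lam {U : Ultrafilter ℂ} (hU : {s : ℂ | 0 < s.im} ∈ U) {w : ℂ}
    (hw : Tendsto d.lam U (𝓝 w)) :
    ∃ s : ℂ, 0 ≤ s.im ∧ d.Reg s ∧ ↑U ≤ 𝓝 s ∧ d.lam s = w := by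
  have hν := d.ν_pos
  have hc1 := d.c₁_pos
  have hE : Tendsto (fun s => Real.exp (d.ν * (d.lam s).re)) U (𝓝 (Real.exp (d.ν * w.re))) := by
    have : Continuous fun z : ℂ => Real.exp (d.ν * z.re) := by fun_prop
    exact (this.tendsto w).comp hw
  have hreg : ∀ᶠ s in (U : Filter ℂ), Real.exp (d.ν * (d.lam s).re) * ‖s‖ =
      ‖(d.c₁ : ℂ) * s + d.c₀‖ ^ d.ν * ‖s + 1‖ := by
    filter_upwards [hU] with s hs
    exact d.exp_re_lam_mul (d.reg_of_im_pos hs)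
  have hbd : ∃ R : ℝ, ∀ᶠ s in (U : Filter ℂ), ‖s‖ ≤ R := by
    by_contra! hR
    have hinf : Tendsto (fun s : ℂ => ‖s‖) U atTop := by
      rw [tendsto_atTop]
      intro R
      filter_upwards [hR R] with s hs using hs.le
    have hinf1 : Tendsto (fun s : ℂ => ‖(d.c₁ : ℂ) * s + d.c₀‖) U atTop := by
      have h1 : Tendsto (fun s : ℂ => d.c₁ * ‖s‖ + -d.c₀) U atTop :=
        tendsto_atTop_add_const_right _ _ (hinf.const_mul_atTop hc1)
      refine tendsto_atTop_mono (fun s => ?_) h1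
      have := norm_sub_norm_le ((d.c₁ : ℂ) * s) (-d.c₀)
      rw [sub_neg_eq_add, norm_mul, norm_neg, Complex.norm_of_nonneg hc1.le,
        Complex.norm_of_nonneg d.c₀_pos.le] at this
      linarith
    have hinf2 : Tendsto (fun s : ℂ => ‖(d.c₁ : ℂ) * s + d.c₀‖ ^ d.ν * (1 / 2)) U atTop :=
      ((tendsto_rpow_atTop hν).comp hinf1).atTop_mul_const (by norm_num)
    refine not_tendsto_nhds_of_tendsto_atTop ?_ _ hE
    refine tendsto_atTop_mono' _ ?_ hinf2
    filter_upwards [hreg, hinf.eventually_ge_atTop 2] with s hs hs2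
    have h3 : ‖s‖ / 2 ≤ ‖s + 1‖ := by
      have := norm_sub_norm_le s (-1)
      rw [sub_neg_eq_add, norm_neg, norm_one] at this
      linarith
    have h4 : 0 < ‖s‖ := by linarith
    refine le_of_mul_le_mul_right ?_ h4
    rw [hs, mul_assoc]
    exact mul_le_mul_of_nonneg_left (by linarith) (by positivity)
  obtain ⟨R, hR⟩ := hbd
  obtain ⟨s, -, hs⟩ := (isCompact_closedBall (0 : ℂ) R).ultrafilter_le_nhds U
    (le_principal_iff.2 (by filter_upwards [hR] with s hs; simpa using hs))
  have him : 0 ≤ s.im := by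
    have hcl : IsClosed {s : ℂ | 0 ≤ s.im} := isClosed_le continuous_const Complex.continuous_im
    have hid : Tendsto (fun z : ℂ => z) U (𝓝 s) := hs
    exact hcl.mem_of_tendsto hid (by filter_upwards [hU] with z hz using le_of_lt hz)
  have hid : Tendsto (fun z : ℂ => z) U (𝓝 s) := hs
  have h1 : Tendsto (fun z => Real.exp (d.ν * (d.lam z).re) * ‖z‖) U
      (𝓝 (Real.exp (d.ν * w.re) * ‖s‖)) := hE.mul hid.norm
  have h2 : Tendsto (fun z : ℂ => ‖(d.c₁ : ℂ) * z + d.c₀‖ ^ d.ν * ‖z + 1‖) U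
      (𝓝 (‖(d.c₁ : ℂ) * s + d.c₀‖ ^ d.ν * ‖s + 1‖)) := by
    have : Continuous fun z : ℂ => ‖(d.c₁ : ℂ) * z + d.c₀‖ ^ d.ν * ‖z + 1‖ :=
      (Continuous.rpow_const (by fun_prop) (fun _ => Or.inr hν.le)).mul (by fun_prop)
    exact (this.tendsto s).comp hid
  have h3 := tendsto_nhds_unique (h1.congr' hreg) h2
  have hE0 := Real.exp_pos (d.ν * w.re)
  have hs0 : s ≠ 0 := by
    rintro rfl
    have := d.c₀_pos
    simp only [norm_zero, mul_zero, zero_add, norm_one, mul_one,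
      Complex.norm_of_nonneg this.le] at h3
    have := Real.rpow_pos_of_pos this d.ν
    linarith
  have hn := norm_pos_iff.2 hs0
  have hr : d.Reg s := by
    refine ⟨hs0, ?_, ?_⟩
    · intro h
      rw [h, norm_zero, mul_zero] at h3
      have := mul_pos hE0 hn
      linarith
    · intro h
      rw [h, norm_zero, Real.zero_rpow hν.ne', zero_mul] at h3
      have := mul_pos hE0 hn
      linarith
  refine ⟨s, him, hr, hs, ?_⟩
  refine tendsto_nhds_unique ((d.continuousWithinAt_lam hr).tendsto.mono_left ?_) hw
  refine le_inf hs (le_principal_iff.2 ?_)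
  filter_upwards [hU] with z hz using le_of_lt hz

/-- The image of the upper half plane under `lam`: a strip, slit along the real axis off the
band. -/
def slit : Set ℂ := {w | -(Real.pi / d.ν) < w.im ∧ w.im < Real.pi ∧
  (w.im = 0 → d.a < Real.exp w.re ∧ Real.exp w.re < d.b)}

lemma lam_mem_slit {s : ℂ} (h : 0 < s.im) : d.lam s ∈ d.slit := by
  refine ⟨d.lt_im_lam h, d.im_lam_lt h, fun him => ?_⟩
  have he : d.lam s = ((d.lam s).re : ℂ) := Complex.ext (by simp) (by simp [him])
  have hne : ∀ t : ℝ, d.Reg t → d.lam s ≠ d.lam t := fun t ht =>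
    d.lam_ne h (by simp) ht (by rintro rfl; simp at h)
  constructor
  · by_contra! hle
    obtain ⟨t, h1, h2, h3⟩ := d.exists_le_sa hle
    have hc := d.sa_lt_neg_one (d.c₁_lt_of_a_pos ((Real.exp_pos _).trans_le hle))
    refine hne t (d.reg_of_mem_left h1 (by linarith)) ?_
    rw [d.lam_of_mem_left h1 (by linarith), h3, ← he]
  · by_contra! hle
    obtain ⟨t, h1, h3⟩ := d.exists_ge_sb hle
    have ht := d.sb_pos.trans_le h1
    refine hne t (d.reg_of_pos ht) ?_
    rw [d.lam_of_pos ht, h3, ← he]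

lemma not_mem_slit_of_real {t : ℝ} (h : d.Reg t) : d.lam t ∉ d.slit := by
  rintro ⟨h1, h2, h3⟩
  obtain ⟨g0, g1, g2⟩ := d.reg_ofReal.1 h
  have hs0 := d.s0_le_neg_one
  rcases lt_or_gt_of_ne g0 with h0 | h0
  · rcases lt_or_gt_of_ne (show t ≠ -1 by intro h; apply g1; rw [h]; ring) with h4 | h4
    · rcases lt_trichotomy t d.s0 with h5 | h5 | h5
      · rw [d.im_lam_of_lt h5] at h2; exact lt_irrefl _ h2
      · exact g2 (h5 ▸ d.affine_s0)
      · have := (h3 (d.im_lam_of_mem_left h5 h4)).1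
        rw [re_lam_ofReal] at this
        exact absurd (d.exp_rlam_le_a h5 h4) (not_le.2 this)
    · rw [d.im_lam_of_mem_cut h4 h0] at h1; exact lt_irrefl _ h1
  · have := (h3 (d.im_lam_of_pos h0)).2
    rw [re_lam_ofReal, b, Real.exp_lt_exp] at this
    exact absurd (d.rlam_sb_le h0) (not_le.2 this)

lemma isOpen_image_lam : IsOpen (d.lam '' {s | 0 < s.im}) := by
  rw [isOpen_iff_mem_nhds]
  rintro _ ⟨s, hs, rfl⟩
  rw [← (d.hasStrictDerivAt_lam_of_im_pos hs).map_nhds_eq (d.dlam_ne_zero hs)]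
  exact image_mem_map ((isOpen_lt continuous_const Complex.continuous_im).mem_nhds hs)

lemma closure_image_lam : closure (d.lam '' {s | 0 < s.im}) ∩ d.slit ⊆ d.lam '' {s | 0 < s.im} := by
  rintro w ⟨hw, hws⟩
  obtain ⟨V, hV1, hV2⟩ := mem_closure_iff_ultrafilter.1 hw
  set U := Ultrafilter.ofComapInfPrincipal hV1
  have hU : {s : ℂ | 0 < s.im} ∈ U := Ultrafilter.ofComapInfPrincipal_mem hV1
  have hm : Ultrafilter.map d.lam U = V := Ultrafilter.ofComapInfPrincipal_eq_of_map hV1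
  have ht : Tendsto d.lam U (𝓝 w) := by
    rw [← hm] at hV2
    exact hV2
  obtain ⟨s, hs, hr, -, rfl⟩ := d.exists_tendsto_of_tendsto_lam hU ht
  rcases hs.lt_or_eq with h | h
  · exact mem_image_of_mem _ h
  · have he : s = (s.re : ℂ) := Complex.ext (by simp) (by simp [← h])
    rw [he] at hr hws
    exact absurd hws (d.not_mem_slit_of_real hr)

lemma dlam_continuousAt {s : ℂ} (hr : d.Reg s) : ContinuousAt d.dlam s := by
  obtain ⟨h0, h1, h2⟩ := hr
  unfold dlam
  fun_prop (disch := assumption)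

lemma im_lam_sub_lt {x y : ℝ} (hy : 0 < y) (hr : d.Reg (x : ℂ))
    (h : ∀ v ∈ Ioo 0 y, (d.dlam (x + v * Complex.I)).re < 0) :
    (d.lam (x + y * Complex.I)).im < (d.lam x).im := by
  have hanti : StrictAntiOn (fun v : ℝ => (d.lam (x + v * Complex.I)).im) (Icc 0 y) := by
    apply strictAntiOn_of_deriv_neg (convex_Icc 0 y)
    · apply Complex.continuous_im.comp_continuousOn
      intro v hv
      refine ContinuousWithinAt.comp (f := fun v : ℝ => (x : ℂ) + v * Complex.I) (g := d.lam)
        (t := {z | 0 ≤ z.im}) (d.continuousWithinAt_lam ?_)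
        (Continuous.continuousWithinAt (by fun_prop)) ?_
      · rcases hv.1.lt_or_eq with h0 | h0
        · exact d.reg_of_im_pos (by simpa using h0)
        · rw [← h0]; simpa using hr
      · intro v hv; simpa using hv.1
    · intro v hv
      rw [interior_Icc] at hv
      have e1 : HasDerivAt (fun v : ℝ => (x : ℂ) + v * Complex.I) Complex.I v := by
        simpa using ((Complex.ofRealCLM.hasDerivAt (x := v)).mul_const Complex.I).const_add (x : ℂ)
      have him : 0 < ((x : ℂ) + v * Complex.I).im := by simpa using hv.1
      have e2 := ((d.hasStrictDerivAt_lam_of_im_pos him).hasDerivAt).comp v e1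
      have e3 := (Complex.imCLM.hasFDerivAt.comp_hasDerivAt v e2)
      have e4 : HasDerivAt (fun v : ℝ => (d.lam (x + v * Complex.I)).im)
        (d.dlam (x + v * Complex.I) * Complex.I).im v := e3
      rw [e4.deriv, Complex.mul_I_im]
      exact h v hv
  simpa using hanti (left_mem_Icc.2 hy.le) (right_mem_Icc.2 hy.le) hy

lemma lt_im_lam_sub {x y : ℝ} (hy : 0 < y) (hr : d.Reg (x : ℂ))
    (h : ∀ v ∈ Ioo 0 y, 0 < (d.dlam (x + v * Complex.I)).re) :
    (d.lam x).im < (d.lam (x + y * Complex.I)).im := by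
  have hmono : StrictMonoOn (fun v : ℝ => (d.lam (x + v * Complex.I)).im) (Icc 0 y) := by
    apply strictMonoOn_of_deriv_pos (convex_Icc 0 y)
    · apply Complex.continuous_im.comp_continuousOn
      intro v hv
      refine ContinuousWithinAt.comp (f := fun v : ℝ => (x : ℂ) + v * Complex.I) (g := d.lam)
        (t := {z | 0 ≤ z.im}) (d.continuousWithinAt_lam ?_)
        (Continuous.continuousWithinAt (by fun_prop)) ?_
      · rcases hv.1.lt_or_eq with h0 | h0
        · exact d.reg_of_im_pos (by simpa using h0)
        · rw [← h0]; simpa using hr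
      · intro v hv; simpa using hv.1
    · intro v hv
      rw [interior_Icc] at hv
      have e1 : HasDerivAt (fun v : ℝ => (x : ℂ) + v * Complex.I) Complex.I v := by
        simpa using ((Complex.ofRealCLM.hasDerivAt (x := v)).mul_const Complex.I).const_add (x : ℂ)
      have him : 0 < ((x : ℂ) + v * Complex.I).im := by simpa using hv.1
      have e2 := ((d.hasStrictDerivAt_lam_of_im_pos him).hasDerivAt).comp v e1
      have e3 := (Complex.imCLM.hasFDerivAt.comp_hasDerivAt v e2)
      have e4 : HasDerivAt (fun v : ℝ => (d.lam (x + v * Complex.I)).im)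
        (d.dlam (x + v * Complex.I) * Complex.I).im v := e3
      rw [e4.deriv, Complex.mul_I_im]
      exact h v hv
  simpa using hmono (left_mem_Icc.2 hy.le) (right_mem_Icc.2 hy.le) hy

lemma eventually_vertical {t : ℝ} {p : ℂ → Prop} (h : ∀ᶠ s in 𝓝 (t : ℂ), p s) :
    ∀ᶠ s : ℂ in 𝓝 (t : ℂ), ∀ v : ℝ, v ∈ Ioo 0 s.im → p (s.re + v * Complex.I) := by
  obtain ⟨ε, hε, hb⟩ := Metric.eventually_nhds_iff_ball.1 h
  refine Metric.eventually_nhds_iff_ball.2 ⟨ε, hε, fun s hs v hv => hb (s.re + v * Complex.I) ?_⟩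
  rw [mem_ball_iff_norm] at hs ⊢
  refine lt_of_le_of_lt ?_ hs
  rw [← sq_le_sq₀ (norm_nonneg _) (norm_nonneg _), ← Complex.normSq_eq_norm_sq,
    ← Complex.normSq_eq_norm_sq, Complex.normSq_apply, Complex.normSq_apply]
  simp
  nlinarith [hv.1, hv.2]

/-- Near a real point where the derivative is negative, `lam` maps the upper half plane into the
lower one. -/
lemma eventually_im_lam_neg {t : ℝ} (hr : d.Reg (t : ℂ)) (ht : d.drlam t < 0)
    (him : ∀ᶠ x in 𝓝 t, (d.lam (x : ℝ)).im = 0) :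
    ∀ᶠ s in 𝓝 (t : ℂ), 0 < s.im → (d.lam s).im < 0 := by
  have h1 : ∀ᶠ s in 𝓝 (t : ℂ), (d.dlam s).re < 0 := by
    have := (Complex.continuous_re.continuousAt.comp (d.dlam_continuousAt hr)).eventually_lt_const
      (u := 0) (by simpa [d.dlam_ofReal hr] using ht)
    exact this
  have hre : Tendsto Complex.re (𝓝 (t : ℂ)) (𝓝 t) := Complex.continuous_re.tendsto' _ _ (by simp)
  have hr' : ∀ᶠ x in 𝓝 t, d.Reg ((x : ℝ) : ℂ) := by
    simp only [reg_ofReal] at hr ⊢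
    have c1 : ContinuousAt (fun x : ℝ => x + 1) t := by fun_prop
    have c2 : ContinuousAt (fun x : ℝ => d.c₁ * x + d.c₀) t := by fun_prop
    exact (eventually_ne_nhds hr.1).and ((c1.eventually_ne hr.2.1).and (c2.eventually_ne hr.2.2))
  filter_upwards [eventually_vertical h1, hre.eventually him, hre.eventually hr']
    with s h2 h3 h4 h5
  have := d.im_lam_sub_lt h5 h4 h2
  rwa [Complex.re_add_im, h3] at this

/-- Near a real point where the derivative is positive, `lam` maps the upper half plane into
itself. -/
lemma eventually_im_lam_pos {t : ℝ} (hr : d.Reg (t : ℂ)) (ht : 0 < d.drlam t)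
    (him : ∀ᶠ x in 𝓝 t, (d.lam (x : ℝ)).im = 0) :
    ∀ᶠ s in 𝓝 (t : ℂ), 0 < s.im → 0 < (d.lam s).im := by
  have h1 : ∀ᶠ s in 𝓝 (t : ℂ), 0 < (d.dlam s).re := by
    have := (Complex.continuous_re.continuousAt.comp (d.dlam_continuousAt hr)).eventually_const_lt
      (u := 0) (by simpa [d.dlam_ofReal hr] using ht)
    exact this
  have hre : Tendsto Complex.re (𝓝 (t : ℂ)) (𝓝 t) := Complex.continuous_re.tendsto' _ _ (by simp)
  have hr' : ∀ᶠ x in 𝓝 t, d.Reg ((x : ℝ) : ℂ) := by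
    simp only [reg_ofReal] at hr ⊢
    have c1 : ContinuousAt (fun x : ℝ => x + 1) t := by fun_prop
    have c2 : ContinuousAt (fun x : ℝ => d.c₁ * x + d.c₀) t := by fun_prop
    exact (eventually_ne_nhds hr.1).and ((c1.eventually_ne hr.2.1).and (c2.eventually_ne hr.2.2))
  filter_upwards [eventually_vertical h1, hre.eventually him, hre.eventually hr']
    with s h2 h3 h4 h5
  have := d.lt_im_lam_sub h5 h4 h2
  rwa [Complex.re_add_im, h3] at this

/-- Near the pole `0`, `lam` maps the upper half plane into the lower one. -/
lemma exists_im_lam_neg_near_zero : ∃ ε > 0, ∀ s : ℂ, 0 < s.im → ‖s‖ < ε → (d.lam s).im < 0 := by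
  have hν := d.ν_pos
  have hc1 := d.c₁_pos
  have hc0 := d.c₀_pos
  refine ⟨min (1 / 2) (1 / (4 * d.ν)), by positivity, fun s hs hsε => ?_⟩
  have h1 : ‖s‖ < 1 / 2 := hsε.trans_le (min_le_left _ _)
  have h2 : ‖s‖ < 1 / (4 * d.ν) := hsε.trans_le (min_le_right _ _)
  have hn := norm_pos_iff.2 (ne_zero_of_im_pos hs)
  have hre : -(1 / 2) < s.re := by
    have := neg_le_of_abs_le (Complex.abs_re_le_norm s); linarith
  have h3 : d.c₀ / 2 < d.c₁ * s.re + d.c₀ := by nlinarith [d.c₁_le]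
  refine (d.im_lam_le hs (by linarith)).trans_lt (mul_neg_of_pos_of_neg hs ?_)
  have h4 : d.c₁ / (d.c₁ * s.re + d.c₀) ≤ 2 := by
    rw [div_le_iff₀ (by linarith)]; linarith [d.c₁_le]
  have h5 : 2 < 1 / (d.ν * (‖s‖ * ‖s + 1‖)) := by
    have h6 : ‖s + 1‖ ≤ 2 := by
      have := norm_add_le s 1
      rw [norm_one] at this
      linarith
    have h8 := norm_pos_iff.2 (ne_zero_of_im_pos (im_add_one_pos hs))
    rw [lt_one_div (by norm_num) (by positivity)]
    rw [lt_div_iff₀ (by positivity)] at h2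
    have : ‖s‖ * ‖s + 1‖ ≤ ‖s‖ * 2 := mul_le_mul_of_nonneg_left h6 hn.le
    nlinarith
  linarith

/-- Near the zero `-1`, `lam` maps the upper half plane into the lower one. -/
lemma exists_im_lam_neg_near_neg_one (hc : d.c₁ < d.c₀) :
    ∃ ε > 0, ∀ s : ℂ, 0 < s.im → ‖s + 1‖ < ε → (d.lam s).im < 0 := by
  have hν := d.ν_pos
  have hc1 := d.c₁_pos
  have hc0 := d.c₀_pos
  have hg : 0 < d.c₀ - d.c₁ := sub_pos.2 hc
  refine ⟨min (min 1 ((d.c₀ - d.c₁) / (2 * d.c₁))) ((d.c₀ - d.c₁) / (4 * d.c₁ * d.ν)),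
    by positivity, fun s hs hsε => ?_⟩
  have h0 : ‖s + 1‖ < 1 := hsε.trans_le ((min_le_left _ _).trans (min_le_left _ _))
  have h1 : ‖s + 1‖ < (d.c₀ - d.c₁) / (2 * d.c₁) :=
    hsε.trans_le ((min_le_left _ _).trans (min_le_right _ _))
  have h2 : ‖s + 1‖ < (d.c₀ - d.c₁) / (4 * d.c₁ * d.ν) := hsε.trans_le (min_le_right _ _)
  have hn := norm_pos_iff.2 (ne_zero_of_im_pos hs)
  have hn1 := norm_pos_iff.2 (ne_zero_of_im_pos (im_add_one_pos hs))
  have hre : -‖s + 1‖ ≤ s.re + 1 := by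
    have := neg_le_of_abs_le (Complex.abs_re_le_norm (s + 1))
    simpa using this
  rw [lt_div_iff₀ (by positivity)] at h1 h2
  have h3 : (d.c₀ - d.c₁) / 2 < d.c₁ * s.re + d.c₀ := by nlinarith
  refine (d.im_lam_le hs (by linarith)).trans_lt (mul_neg_of_pos_of_neg hs ?_)
  have h4 : d.c₁ / (d.c₁ * s.re + d.c₀) ≤ 2 * d.c₁ / (d.c₀ - d.c₁) := by
    rw [div_le_div_iff₀ (by linarith) hg]; nlinarith
  have h5 : 2 * d.c₁ / (d.c₀ - d.c₁) < 1 / (d.ν * (‖s‖ * ‖s + 1‖)) := by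
    have h6 : ‖s‖ ≤ 2 := by
      have := norm_sub_le (s + 1) 1
      rw [norm_one, add_sub_cancel_right] at this
      linarith
    rw [div_lt_div_iff₀ hg (by positivity)]
    have : ‖s‖ * ‖s + 1‖ ≤ 2 * ‖s + 1‖ := mul_le_mul_of_nonneg_right h6 hn1.le
    have : 2 * d.c₁ * d.ν * (‖s‖ * ‖s + 1‖) ≤ 2 * d.c₁ * d.ν * (2 * ‖s + 1‖) :=
      mul_le_mul_of_nonneg_left this (by positivity)
    nlinarith
  linarith

/-- Near infinity, `lam` maps the upper half plane into itself. -/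
lemma exists_im_lam_pos_near_infty : ∃ R > 0, ∀ s : ℂ, 0 < s.im → R < ‖s‖ → 0 < (d.lam s).im := by
  have hν := d.ν_pos
  have hc1 := d.c₁_pos
  have hc0 := d.c₀_pos
  refine ⟨max (max 2 (d.c₀ / d.c₁)) (4 / d.ν), by positivity, fun s hs hR => ?_⟩
  have h1 : 2 < ‖s‖ := ((le_max_left _ _).trans (le_max_left _ _)).trans_lt hR
  have h2 : d.c₀ / d.c₁ < ‖s‖ := ((le_max_right _ _).trans (le_max_left _ _)).trans_lt hR
  have h3 : 4 / d.ν < ‖s‖ := (le_max_right _ _).trans_lt hR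
  rw [div_lt_iff₀ (by positivity)] at h2 h3
  have hre : -‖s‖ ≤ s.re := neg_le_of_abs_le (Complex.abs_re_le_norm s)
  have h4 : ‖s‖ ^ 2 / 2 < ‖s‖ ^ 2 + s.re := by nlinarith
  have h4' : 0 < ‖s‖ ^ 2 / 2 := by positivity
  refine lt_of_lt_of_le (mul_pos hs ?_) (d.le_im_lam hs (by linarith))
  have hq := norm_pos_iff.2 (ne_zero_of_im_pos (d.im_affine_pos hs))
  have h5 : ‖(d.c₁ : ℂ) * s + d.c₀‖ < 2 * d.c₁ * ‖s‖ := by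
    have := norm_add_le ((d.c₁ : ℂ) * s) d.c₀
    rw [norm_mul, Complex.norm_of_nonneg hc1.le, Complex.norm_of_nonneg hc0.le] at this
    linarith
  rw [sub_pos, div_lt_div_iff₀ (by nlinarith) hq]
  have h6 : 2 * d.c₁ * ‖s‖ < d.c₁ * (d.ν * (‖s‖ ^ 2 / 2)) := by
    have : 2 * d.c₁ * ‖s‖ * 4 < 2 * d.c₁ * ‖s‖ * (‖s‖ * d.ν) :=
      mul_lt_mul_of_pos_left h3 (by positivity)
    nlinarith
  have h7 : d.c₁ * (d.ν * (‖s‖ ^ 2 / 2)) < d.c₁ * (d.ν * (‖s‖ ^ 2 + s.re)) := by gcongr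
  linarith

lemma exists_im_lam_eq_zero : ∃ s : ℂ, 0 < s.im ∧ (d.lam s).im = 0 := by
  obtain ⟨ε, hε, h0⟩ := d.exists_im_lam_neg_near_zero
  obtain ⟨R, hR, h1⟩ := d.exists_im_lam_pos_near_infty
  have hpc : ContinuousOn (fun y : ℝ => (d.lam (y * Complex.I)).im) (Ioi 0) := by
    apply Complex.continuous_im.comp_continuousOn
    intro y hy
    have : 0 < ((y : ℂ) * Complex.I).im := by simpa using hy
    exact ((d.hasStrictDerivAt_lam_of_im_pos this).hasDerivAt.continuousAt.comp
      (f := fun y : ℝ => (y : ℂ) * Complex.I) (by fun_prop)).continuousWithinAt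
  have hn : ∀ y : ℝ, 0 < y → ‖(y : ℂ) * Complex.I‖ = y := by
    intro y hy
    rw [norm_mul, Complex.norm_I, mul_one, Complex.norm_of_nonneg hy.le]
  have e0 := h0 ((ε / 2 : ℝ) * Complex.I) (by simp; positivity)
    (by rw [hn _ (by positivity)]; linarith)
  have e1 := h1 ((R + 1 : ℝ) * Complex.I) (by simp; positivity)
    (by rw [hn _ (by positivity)]; linarith)
  obtain ⟨y, hy, hye⟩ := isPreconnected_Ioi.intermediate_value (a := ε / 2) (b := R + 1)
    (by simp; positivity) (by simp; positivity) hpc ⟨e0.le, e1.le⟩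
  exact ⟨y * Complex.I, by simpa using hy, hye⟩

lemma exists_mem_band : ∃ s : ℂ, 0 < s.im ∧ (d.lam s).im = 0 ∧ d.a < Real.exp (d.lam s).re ∧
    Real.exp (d.lam s).re < d.b := by
  obtain ⟨s, hs, h⟩ := d.exists_im_lam_eq_zero
  exact ⟨s, hs, h, (d.lam_mem_slit hs).2.2 h⟩

lemma a_lt_b : d.a < d.b := by
  obtain ⟨s, -, -, h1, h2⟩ := d.exists_mem_band
  exact h1.trans h2

lemma convex_reProdIm {s t : Set ℝ} (hs : Convex ℝ s) (ht : Convex ℝ t) : Convex ℝ (s ×ℂ t) :=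
  (hs.linear_preimage Complex.reLm).inter (ht.linear_preimage Complex.imLm)

lemma isPreconnected_slit : IsPreconnected d.slit := by
  have hν := d.ν_pos
  have hpi := Real.pi_pos
  have hpν : 0 < Real.pi / d.ν := by positivity
  obtain ⟨s, hs, h0, h1, h2⟩ := d.exists_mem_band
  set x := (d.lam s).re
  set A : Set ℝ := Real.exp ⁻¹' Ioo d.a d.b
  have hx : x ∈ A := ⟨h1, h2⟩
  have hA : Convex ℝ A := (ordConnected_Ioo.preimage_mono Real.exp_monotone).convex
  have hP := (convex_reProdIm convex_univ (convex_Ioo 0 Real.pi)).isPreconnected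
  have hN := (convex_reProdIm convex_univ (convex_Ioo (-(Real.pi / d.ν)) 0)).isPreconnected
  have hV := (convex_reProdIm hA (convex_Ioo (-(Real.pi / d.ν)) Real.pi)).isPreconnected
  have hPV := hP.union (x + (Real.pi / 2 : ℝ) * Complex.I) (by simp [Complex.mem_reProdIm, hpi])
    (by simp [Complex.mem_reProdIm, hpi, hx]; linarith) hV
  have hN' := hPV.union (x + (-(Real.pi / d.ν / 2) : ℝ) * Complex.I)
    (by right; rw [Complex.mem_reProdIm]; simp [hx]; constructor <;> linarith)
    (by rw [Complex.mem_reProdIm]; simp; exact hpν) hN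
  convert hN' using 1
  ext w
  simp only [slit, mem_union, Complex.mem_reProdIm, mem_ofPred_eq, mem_univ, true_and, mem_Ioo, A,
    mem_preimage]
  constructor
  · rintro ⟨g1, g2, g3⟩
    rcases lt_trichotomy w.im 0 with h | h | h
    · exact Or.inr ⟨g1, h⟩
    · exact Or.inl (Or.inr ⟨g3 h, g1, g2⟩)
    · exact Or.inl (Or.inl ⟨h, g2⟩)
  · rintro ((⟨g1, g2⟩ | ⟨g1, g2, g3⟩) | ⟨g1, g2⟩)
    · exact ⟨by linarith, g2, fun h => absurd h g1.ne'⟩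
    · exact ⟨g2, g3, fun _ => g1⟩
    · exact ⟨g1, by linarith, fun h => absurd h g2.ne⟩

lemma slit_subset_image : d.slit ⊆ d.lam '' {s | 0 < s.im} := by
  refine d.isPreconnected_slit.subset_of_closure_inter_subset d.isOpen_image_lam ?_
    d.closure_image_lam
  obtain ⟨s, hs, -⟩ := d.exists_mem_band
  exact ⟨d.lam s, d.lam_mem_slit hs, mem_image_of_mem _ hs⟩

/-- The inverse of `lam`. -/
def inv (w : ℂ) : ℂ := Function.invFunOn d.lam {s | 0 < s.im} w

lemma inv_im_pos {w : ℂ} (h : w ∈ d.slit) : 0 < (d.inv w).im :=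
  Function.invFunOn_mem (d.slit_subset_image h)

lemma lam_inv {w : ℂ} (h : w ∈ d.slit) : d.lam (d.inv w) = w :=
  Function.invFunOn_eq (d.slit_subset_image h)

lemma inv_lam {s : ℂ} (h : 0 < s.im) : d.inv (d.lam s) = s :=
  d.lam_injOn (d.inv_im_pos (d.lam_mem_slit h)) h (d.lam_inv (d.lam_mem_slit h))

lemma isOpen_slit : IsOpen d.slit := by
  have : d.slit = d.lam '' {s | 0 < s.im} := by
    refine d.slit_subset_image.antisymm ?_
    rintro _ ⟨s, hs, rfl⟩
    exact d.lam_mem_slit hs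
  rw [this]
  exact d.isOpen_image_lam

lemma continuousAt_inv {w : ℂ} (h : w ∈ d.slit) : ContinuousAt d.inv w := by
  have h1 := d.inv_im_pos h
  have h2 := (d.hasStrictDerivAt_lam_of_im_pos h1).map_nhds_eq (d.dlam_ne_zero h1)
  rw [d.lam_inv h] at h2
  rw [ContinuousAt, ← h2, tendsto_map'_iff]
  refine tendsto_id.congr' ?_
  filter_upwards [(isOpen_lt continuous_const Complex.continuous_im).mem_nhds h1] with s hs
  exact (d.inv_lam hs).symm

lemma differentiableAt_inv {w : ℂ} (h : w ∈ d.slit) : DifferentiableAt ℂ d.inv w := by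
  have h1 := d.inv_im_pos h
  refine (HasDerivAt.of_local_left_inverse (d.continuousAt_inv h)
    (d.hasStrictDerivAt_lam_of_im_pos h1).hasDerivAt (d.dlam_ne_zero h1) ?_).differentiableAt
  filter_upwards [d.isOpen_slit.mem_nhds h] with z hz using d.lam_inv hz

end ConfMap

/-! ### Holomorphic functions on the strip `0 < Im w < π` -/

/-- The open strip `0 < Im w < π`. -/
def strip : Set ℂ := {w | 0 < w.im ∧ w.im < Real.pi}

lemma mem_strip {τ η : ℝ} (h0 : 0 < η) (h1 : η < Real.pi) :
    (τ : ℂ) + η * Complex.I ∈ strip := by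
  simp [strip, h0, h1]

lemma integrable_exp_neg_abs_half : Integrable (fun τ : ℝ => Real.exp (-|τ| / 2)) := by
  have h1 : IntegrableOn (fun τ : ℝ => Real.exp (-|τ| / 2)) (Ioi 0) := by
    refine (exp_neg_integrableOn_Ioi 0 (b := 1 / 2) (by norm_num)).congr_fun ?_ measurableSet_Ioi
    intro x hx
    simp only [abs_of_pos (show 0 < x from hx)]
    ring_nf
  have h2 : IntegrableOn (fun τ : ℝ => Real.exp (-|τ| / 2)) (Iic 0) := by
    refine (integrableOn_exp_mul_Iic (a := 1 / 2) (by norm_num) 0).congr_fun ?_ measurableSet_Iic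
    intro x hx
    simp only [abs_of_nonpos (show x ≤ 0 from hx)]
    ring_nf
  rw [← integrableOn_univ, ← Iic_union_Ioi (a := (0 : ℝ))]
  exact h2.union h1

lemma integrableOn_abs_rpow (p a b : ℝ) :
    IntegrableOn (fun τ : ℝ => |τ - p| ^ (-1 / 2 : ℝ)) (Icc a b) := by
  have h0 : LocallyIntegrable (fun τ : ℝ => |τ| ^ (-1 / 2 : ℝ)) volume := by
    refine locallyIntegrable_of_norm_le_rpow (E := ℝ) (C := 1) (α := 1 / 2) (by simp)
      (by simp; norm_num) ?_ ?_
    · refine ae_of_all _ fun x => ?_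
      rw [one_mul, Real.norm_eq_abs, Real.norm_eq_abs, abs_of_nonneg (by positivity), neg_div]
    · exact (by fun_prop : Measurable fun τ : ℝ => |τ| ^ (-1 / 2 : ℝ)).aestronglyMeasurable
  have h1 := h0.integrableOn_isCompact (isCompact_Icc (a := a - p) (b := b - p))
  rw [← (measurePreserving_sub_right volume p).integrableOn_comp_preimage
    (MeasurableEquiv.subRight p).measurableEmbedding] at h1
  refine h1.mono_set ?_
  intro x hx
  simp only [mem_preimage, mem_Icc]
  exact ⟨by linarith [hx.1], by linarith [hx.2]⟩

lemma integrable_exp_mul_abs_rpow (p : ℝ) :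
    Integrable (fun τ : ℝ => Real.exp (-|τ| / 2) * |τ - p| ^ (-1 / 2 : ℝ)) := by
  have hm : Measurable (fun τ : ℝ => Real.exp (-|τ| / 2) * |τ - p| ^ (-1 / 2 : ℝ)) := by
    fun_prop
  have h1 : Integrable ((Icc (p - 1) (p + 1)).indicator fun τ : ℝ => |τ - p| ^ (-1 / 2 : ℝ)) :=
    (integrableOn_abs_rpow p _ _).integrable_indicator measurableSet_Icc
  refine (h1.add integrable_exp_neg_abs_half).mono' hm.aestronglyMeasurable (ae_of_all _ ?_)
  intro τ
  have hn : 0 ≤ |τ - p| ^ (-1 / 2 : ℝ) := by positivity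
  have he : Real.exp (-|τ| / 2) ≤ 1 := Real.exp_le_one_iff.2 (by linarith [abs_nonneg τ])
  rw [Real.norm_of_nonneg (by positivity), Pi.add_apply]
  by_cases h : τ ∈ Icc (p - 1) (p + 1)
  · rw [indicator_of_mem h]
    have := mul_le_mul_of_nonneg_right he hn
    linarith [Real.exp_pos (-|τ| / 2)]
  · rw [indicator_of_notMem h, zero_add]
    refine mul_le_of_le_one_right (Real.exp_pos _).le ?_
    refine Real.rpow_le_one_of_one_le_of_nonpos ?_ (by norm_num)
    rw [mem_Icc, not_and_or, not_le, not_le] at h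
    rw [le_abs]
    rcases h with h | h
    · right; linarith
    · left; linarith

/-- A dominating function on the real line with integrable singularities at `p`, `q` and `0`. -/
def domFun (M p q τ : ℝ) : ℝ :=
  M * (Real.exp (-|τ| / 2) * 1 + Real.exp (-|τ| / 2) * |τ - 0| ^ (-1 / 2 : ℝ) +
    Real.exp (-|τ| / 2) * |τ - p| ^ (-1 / 2 : ℝ) + Real.exp (-|τ| / 2) * |τ - q| ^ (-1 / 2 : ℝ))

lemma integrable_domFun (M p q : ℝ) : Integrable (domFun M p q) :=
  ((((integrable_exp_neg_abs_half.mul_const 1).add (integrable_exp_mul_abs_rpow 0)).add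
    (integrable_exp_mul_abs_rpow p)).add (integrable_exp_mul_abs_rpow q)).const_mul M

lemma abs_sub_rpow_le_one {τ p : ℝ} {r : ℝ} (hr : r ≤ 0) (h : |p| + 1 ≤ |τ|) :
    |τ - p| ^ r ≤ 1 := by
  refine Real.rpow_le_one_of_one_le_of_nonpos ?_ hr
  have := abs_sub_abs_le_abs_sub τ p
  linarith

lemma tendsto_exp_neg_abs : Tendsto (fun τ : ℝ => Real.exp (-|τ| / 2)) (cocompact ℝ) (𝓝 0) := by
  have h1 : Tendsto (fun τ : ℝ => |τ|) (cocompact ℝ) atTop := tendsto_norm_cocompact_atTop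
  have : Tendsto (fun τ : ℝ => -|τ| / 2) (cocompact ℝ) atBot :=
    ((tendsto_neg_atTop_atBot.comp h1)).atBot_div_const (by norm_num)
  exact Real.tendsto_exp_atBot.comp this

lemma tendsto_domFun {M : ℝ} (hM : 0 ≤ M) (p q : ℝ) :
    Tendsto (domFun M p q) (cocompact ℝ) (𝓝 0) := by
  have h1 : Tendsto (fun τ : ℝ => |τ|) (cocompact ℝ) atTop := tendsto_norm_cocompact_atTop
  have h2 : Tendsto (fun τ : ℝ => M * (4 * Real.exp (-|τ| / 2))) (cocompact ℝ) (𝓝 0) := by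
    simpa using (tendsto_exp_neg_abs.const_mul 4).const_mul M
  refine squeeze_zero' (Eventually.of_forall fun τ => ?_) ?_ h2
  · unfold domFun; positivity
  · filter_upwards [h1.eventually_ge_atTop (|p| + 1), h1.eventually_ge_atTop (|q| + 1),
      h1.eventually_ge_atTop (|(0 : ℝ)| + 1)] with τ hp hq h0
    have hp' := abs_sub_rpow_le_one (r := -1 / 2) (by norm_num) hp
    have hq' := abs_sub_rpow_le_one (r := -1 / 2) (by norm_num) hq
    have h0' := abs_sub_rpow_le_one (r := -1 / 2) (by norm_num) h0
    unfold domFun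
    have he := (Real.exp_pos (-|τ| / 2)).le
    refine mul_le_mul_of_nonneg_left ?_ hM
    have := mul_le_mul_of_nonneg_left hp' he
    have := mul_le_mul_of_nonneg_left hq' he
    have := mul_le_mul_of_nonneg_left h0' he
    linarith

/-- The integral of a holomorphic function over horizontal lines of a strip. -/
lemma integral_horizontal_eq {f : ℂ → ℂ} {G : ℝ → ℝ} (hf : DifferentiableOn ℂ f strip)
    (hG : Integrable G) (hG0 : Tendsto G (cocompact ℝ) (𝓝 0)) {F : Set ℝ} (hF : F.Finite)
    (hb : ∀ w ∈ strip, w.re ∉ F → ‖f w‖ ≤ G w.re) {η η' : ℝ} (h0 : 0 < η) (h1 : η < Real.pi)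
    (h0' : 0 < η') (h1' : η' < Real.pi) :
    ∫ τ : ℝ, f (τ + η * Complex.I) = ∫ τ : ℝ, f (τ + η' * Complex.I) := by
  have hcont : ∀ {y : ℝ}, 0 < y → y < Real.pi → Continuous fun τ : ℝ => f (τ + y * Complex.I) := by
    intro y hy0 hy1
    exact hf.continuousOn.comp_continuous (by fun_prop) (fun τ => mem_strip hy0 hy1)
  have hint : ∀ {y : ℝ}, 0 < y → y < Real.pi →
      Integrable fun τ : ℝ => f (τ + y * Complex.I) := by
    intro y hy0 hy1
    refine hG.mono' (hcont hy0 hy1).aestronglyMeasurable ?_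
    filter_upwards [compl_mem_ae_iff.2 (hF.measure_zero volume)] with τ hτ
    simpa using hb _ (mem_strip hy0 hy1) (by simpa using hτ)
  have hl : ∀ {y : ℝ}, 0 < y → y < Real.pi →
      Tendsto (fun R : ℝ => ∫ τ in (-R)..R, f (τ + y * Complex.I)) atTop
        (𝓝 (∫ τ : ℝ, f (τ + y * Complex.I))) := fun hy0 hy1 =>
    intervalIntegral_tendsto_integral (hint hy0 hy1) tendsto_neg_atTop_atBot tendsto_id
  have hFt : ∀ᶠ R in cocompact ℝ, R ∉ F := hF.isCompact.compl_mem_cocompact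
  have hside : ∀ {r : ℝ → ℝ}, Tendsto r atTop (cocompact ℝ) →
      Tendsto (fun R : ℝ => ∫ y in η..η', f (r R + y * Complex.I)) atTop (𝓝 0) := by
    intro r hr
    refine squeeze_zero_norm' (a := fun R => G (r R) * |η' - η|) ?_
      (by simpa using (hG0.comp hr).mul_const |η' - η|)
    filter_upwards [hr.eventually hFt] with R hR
    refine intervalIntegral.norm_integral_le_of_norm_le_const fun y hy => ?_
    have hy' : 0 < y ∧ y < Real.pi := by
      rcases le_total η η' with h | h
      · rw [uIoc_of_le h] at hy; exact ⟨by linarith [hy.1], by linarith [hy.2]⟩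
      · rw [uIoc_of_ge h] at hy; exact ⟨by linarith [hy.1], by linarith [hy.2]⟩
    simpa using hb _ (mem_strip hy'.1 hy'.2) (by simpa using hR)
  have hr1 : Tendsto (fun R : ℝ => R) atTop (cocompact ℝ) := atTop_le_cocompact
  have hr2 : Tendsto (fun R : ℝ => -R) atTop (cocompact ℝ) :=
    tendsto_neg_atTop_atBot.mono_right atBot_le_cocompact
  have key : ∀ R : ℝ, (∫ τ in (-R)..R, f (τ + η * Complex.I)) -
      (∫ τ in (-R)..R, f (τ + η' * Complex.I)) + Complex.I • (∫ y in η..η', f (R + y * Complex.I)) -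
      Complex.I • (∫ y in η..η', f ((-R : ℝ) + y * Complex.I)) = 0 := by
    intro R
    have := Complex.integral_boundary_rect_eq_zero_of_differentiableOn f
      ((-R : ℝ) + η * Complex.I) (R + η' * Complex.I) (hf.mono ?_)
    · simpa using this
    · rintro w ⟨-, hw⟩
      simp only [Complex.add_im, Complex.ofReal_im, Complex.mul_im, Complex.ofReal_re,
        Complex.I_im, mul_one, Complex.I_re, mul_zero, add_zero, zero_add, mem_preimage] at hw
      rcases le_total η η' with h | h
      · rw [uIcc_of_le h] at hw; exact ⟨by linarith [hw.1], by linarith [hw.2]⟩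
      · rw [uIcc_of_ge h] at hw; exact ⟨by linarith [hw.1], by linarith [hw.2]⟩
  have hlim := ((hl h0 h1).sub (hl h0' h1')).add ((hside hr1).const_smul Complex.I)
  have hlim2 := hlim.sub ((hside hr2).const_smul Complex.I)
  have := tendsto_nhds_unique (hlim2.congr key) tendsto_const_nhds
  simpa [sub_eq_zero] using this

/-- If the boundary values on the upper side of the strip are real, the boundary values on the
lower side have a real integral. -/
lemma integral_im_boundary_eq_zero {f : ℂ → ℂ} {f₀ : ℝ → ℂ} {G : ℝ → ℝ}
    (hf : DifferentiableOn ℂ f strip)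
    (hG : Integrable G) (hG0 : Tendsto G (cocompact ℝ) (𝓝 0)) {F : Set ℝ} (hF : F.Finite)
    (hb : ∀ w ∈ strip, w.re ∉ F → ‖f w‖ ≤ G w.re)
    (hbot : ∀ᵐ τ : ℝ, Tendsto (fun η : ℝ => f (τ + η * Complex.I)) (𝓝[>] 0) (𝓝 (f₀ τ)))
    (htop : ∀ᵐ τ : ℝ, Tendsto (fun η : ℝ => (f (τ + (Real.pi - η : ℝ) * Complex.I)).im)
      (𝓝[>] 0) (𝓝 0)) :
    ∫ τ, (f₀ τ).im = 0 := by
  have hπ := Real.pi_pos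
  have hη : ∀ᶠ η : ℝ in 𝓝[>] 0, 0 < η ∧ η < Real.pi := by
    filter_upwards [Ioo_mem_nhdsGT hπ] with η h using h
  have hcont : ∀ {y : ℝ}, 0 < y → y < Real.pi → Continuous fun τ : ℝ => f (τ + y * Complex.I) := by
    intro y hy0 hy1
    exact hf.continuousOn.comp_continuous (by fun_prop) (fun τ => mem_strip hy0 hy1)
  have hbd : ∀ {y : ℝ}, 0 < y → y < Real.pi → ∀ᵐ τ : ℝ, ‖f (τ + y * Complex.I)‖ ≤ G τ := by
    intro y hy0 hy1
    filter_upwards [compl_mem_ae_iff.2 (hF.measure_zero volume)] with τ hτ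
    simpa using hb _ (mem_strip hy0 hy1) (by simpa using hτ)
  have hint : ∀ {y : ℝ}, 0 < y → y < Real.pi →
      Integrable fun τ : ℝ => f (τ + y * Complex.I) := by
    intro y hy0 hy1
    exact hG.mono' (hcont hy0 hy1).aestronglyMeasurable (hbd hy0 hy1)
  have l1 : Tendsto (fun η : ℝ => ∫ τ : ℝ, (f (τ + η * Complex.I)).im) (𝓝[>] 0)
      (𝓝 (∫ τ, (f₀ τ).im)) := by
    refine tendsto_integral_filter_of_dominated_convergence G ?_ ?_ hG ?_
    · filter_upwards [hη] with η h
      exact (Complex.continuous_im.comp (hcont h.1 h.2)).aestronglyMeasurable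
    · filter_upwards [hη] with η h
      filter_upwards [hbd h.1 h.2] with τ hτ
      exact (Complex.abs_im_le_norm _).trans hτ
    · filter_upwards [hbot] with τ hτ
      exact (Complex.continuous_im.tendsto _).comp hτ
  have l2 : Tendsto (fun η : ℝ => ∫ τ : ℝ, (f (τ + (Real.pi - η : ℝ) * Complex.I)).im) (𝓝[>] 0)
      (𝓝 (∫ _ : ℝ, 0)) := by
    refine tendsto_integral_filter_of_dominated_convergence G ?_ ?_ hG htop
    · filter_upwards [hη] with η h
      exact (Complex.continuous_im.comp (hcont (y := Real.pi - η) (by linarith [h.2])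
        (by linarith [h.1]))).aestronglyMeasurable
    · filter_upwards [hη] with η h
      filter_upwards [hbd (y := Real.pi - η) (by linarith [h.2]) (by linarith [h.1])] with τ hτ
      exact (Complex.abs_im_le_norm _).trans hτ
  have him : ∀ {y : ℝ}, 0 < y → y < Real.pi →
      ∫ τ : ℝ, (f (τ + y * Complex.I)).im = (∫ τ : ℝ, f (τ + y * Complex.I)).im := fun hy0 hy1 =>
    integral_im (hint hy0 hy1)
  rw [integral_zero] at l2
  refine tendsto_nhds_unique (l1.congr' ?_) l2
  filter_upwards [hη] with η h
  rw [him h.1 h.2, him (y := Real.pi - η) (by linarith [h.2]) (by linarith [h.1])]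
  rw [integral_horizontal_eq hf hG hG0 hF hb h.1 h.2 (η' := Real.pi - η) (by linarith [h.2])
    (by linarith [h.1])]

/-! ### The logarithmic kernel on the strip -/

lemma norm_log_one_sub_exp_le {w : ℂ} (hre : w.re ≠ 0) :
    ‖Complex.log (1 - Complex.exp w)‖ ≤
      16 * min (Real.exp w.re) (Real.exp (w.re / 2)) * (1 + |w.re| ^ (-1 / 4 : ℝ)) := by
  set τ := w.re
  have hv : ‖Complex.exp w‖ = Real.exp τ := Complex.norm_exp w
  have hpos : 0 ≤ |τ| ^ (-1 / 4 : ℝ) := by positivity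
  have he := Real.exp_pos τ
  rcases le_or_gt (Real.exp τ) (1 / 2) with h | h
  · have h1 := Complex.norm_log_one_add_half_le_self (z := -Complex.exp w) (by rwa [norm_neg, hv])
    rw [← sub_eq_add_neg, norm_neg, hv] at h1
    have hτ : τ ≤ 0 := by
      by_contra! h0
      have := Real.one_le_exp h0.le
      linarith
    rw [min_eq_left (Real.exp_le_exp.2 (by linarith))]
    nlinarith
  · have hz : 1 - Complex.exp w ≠ 0 := by
      intro h0
      have h2 : Complex.exp w = 1 := (sub_eq_zero.1 h0).symm
      rw [h2, norm_one] at hv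
      exact hre (Real.exp_eq_one_iff _ |>.1 hv.symm)
    set n := ‖1 - Complex.exp w‖ with hn
    have hn0 : 0 < n := norm_pos_iff.2 hz
    have hn1 : n ≤ 1 + Real.exp τ := by
      have := norm_sub_le 1 (Complex.exp w)
      rwa [norm_one, hv] at this
    have hn2 : |τ| / 2 ≤ n := by
      have h3 := abs_norm_sub_norm_le 1 (Complex.exp w)
      rw [norm_one, hv] at h3
      refine le_trans ?_ h3
      rcases le_total 0 τ with h0 | h0
      · rw [abs_of_nonneg h0, abs_sub_comm]
        have := Real.add_one_le_exp τ
        refine le_trans ?_ (le_abs_self _)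
        linarith
      · rw [abs_of_nonpos h0]
        refine le_trans ?_ (le_abs_self _)
        have h4 := Real.add_one_le_exp (-τ)
        have h5 : Real.exp (-τ) * Real.exp τ = 1 := by rw [← Real.exp_add]; simp
        nlinarith
    have hmin : 1 / 2 ≤ min (Real.exp τ) (Real.exp (τ / 2)) ∧
        Real.exp (τ / 2) ≤ 2 * min (Real.exp τ) (Real.exp (τ / 2)) := by
      have h6 : Real.exp τ = Real.exp (τ / 2) * Real.exp (τ / 2) := by
        rw [← Real.exp_add]; ring_nf
      have h7 := Real.exp_pos (τ / 2)
      rcases le_total 0 τ with h0 | h0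
      · rw [min_eq_right (Real.exp_le_exp.2 (by linarith))]
        have := Real.one_le_exp (x := τ / 2) (by linarith)
        constructor <;> linarith
      · rw [min_eq_left (Real.exp_le_exp.2 (by linarith))]
        have := Real.exp_le_one_iff.2 (show τ / 2 ≤ 0 by linarith)
        constructor <;> linarith
    have hlog1 : Real.log n ≤ 2 + 2 * Real.exp (τ / 2) := by
      have h8 : (1 + Real.exp τ) ≤ (1 + Real.exp (τ / 2)) ^ 2 := by
        have h6 : Real.exp τ = Real.exp (τ / 2) * Real.exp (τ / 2) := by
          rw [← Real.exp_add]; ring_nf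
        have h7 := Real.exp_pos (τ / 2)
        nlinarith
      have h9 : Real.log n ≤ Real.log ((1 + Real.exp (τ / 2)) ^ 2) :=
        Real.log_le_log hn0 (hn1.trans h8)
      rw [Real.log_pow] at h9
      have h10 := Real.log_le_sub_one_of_pos (show 0 < 1 + Real.exp (τ / 2) by positivity)
      push_cast at h9
      linarith
    have hlog2 : -Real.log n ≤ 8 * |τ| ^ (-1 / 4 : ℝ) := by
      have h3 := Real.log_le_rpow_div (x := n⁻¹) (ε := 1 / 4) (by positivity) (by norm_num)
      rw [Real.log_inv] at h3
      have h4 : (n⁻¹) ^ (1 / 4 : ℝ) ≤ 2 * |τ| ^ (-1 / 4 : ℝ) := by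
        have h5 : 0 < |τ| := abs_pos.2 hre
        calc (n⁻¹) ^ (1 / 4 : ℝ) ≤ (2 * |τ|⁻¹) ^ (1 / 4 : ℝ) := by
              refine Real.rpow_le_rpow (by positivity) ?_ (by norm_num)
              rw [inv_le_comm₀ hn0 (by positivity)]
              refine le_trans (le_of_eq ?_) hn2
              field_simp
          _ = 2 ^ (1 / 4 : ℝ) * |τ| ^ (-1 / 4 : ℝ) := by
              rw [Real.mul_rpow (by norm_num) (by positivity), Real.inv_rpow (by positivity),
                ← Real.rpow_neg (by positivity)]
              norm_num
          _ ≤ 2 * |τ| ^ (-1 / 4 : ℝ) := by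
              refine mul_le_mul_of_nonneg_right ?_ hpos
              calc (2 : ℝ) ^ (1 / 4 : ℝ) ≤ 2 ^ (1 : ℝ) :=
                    Real.rpow_le_rpow_of_exponent_le (by norm_num) (by norm_num)
                _ = 2 := Real.rpow_one 2
      have : (n⁻¹) ^ (1 / 4 : ℝ) / (1 / 4) = 4 * (n⁻¹) ^ (1 / 4 : ℝ) := by ring
      linarith
    have hfin := Complex.norm_le_abs_re_add_abs_im (Complex.log (1 - Complex.exp w))
    rw [Complex.log_re, Complex.log_im] at hfin
    have harg := Complex.abs_arg_le_pi (1 - Complex.exp w)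
    have hlog : |Real.log n| ≤ 2 + 2 * Real.exp (τ / 2) + 8 * |τ| ^ (-1 / 4 : ℝ) := by
      rw [abs_le]
      have := Real.exp_pos (τ / 2)
      constructor <;> linarith
    have hpi := Real.pi_lt_d2
    have hm := mul_le_mul_of_nonneg_right hmin.1 hpos
    have hA : ‖Complex.log (1 - Complex.exp w)‖ ≤
        2 + 2 * Real.exp (τ / 2) + 8 * |τ| ^ (-1 / 4 : ℝ) + Real.pi := by linarith
    linarith [hmin.1, hmin.2]

lemma one_sub_exp_mem_slitPlane {w : ℂ} (h : w ∈ strip) : 1 - Complex.exp w ∈ Complex.slitPlane := by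
  refine Complex.mem_slitPlane_iff.2 (Or.inr ?_)
  have := mul_pos (Real.exp_pos w.re) (Real.sin_pos_of_pos_of_lt_pi h.1 h.2)
  simp [Complex.exp_im]
  exact (Real.sin_pos_of_pos_of_lt_pi h.1 h.2).ne'

lemma differentiableOn_log_one_sub_exp :
    DifferentiableOn ℂ (fun w => Complex.log (1 - Complex.exp w)) strip := fun _ hw =>
  ((Complex.differentiable_exp.const_sub 1).differentiableAt.clog
    (one_sub_exp_mem_slitPlane hw)).differentiableWithinAt

/-- The boundary values of `log (1 - e ^ w)` on the real axis, approached from above. -/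
lemma tendsto_log_one_sub_exp {τ : ℝ} (hτ : τ ≠ 0) :
    Tendsto (fun η : ℝ => Complex.log (1 - Complex.exp (τ + η * Complex.I))) (𝓝[>] 0)
      (𝓝 (Real.log |1 - Real.exp τ| + (if 0 < τ then -Real.pi else 0 : ℝ) * Complex.I)) := by
  have hc : Tendsto (fun η : ℝ => 1 - Complex.exp (τ + η * Complex.I)) (𝓝[>] 0)
      (𝓝 ((1 - Real.exp τ : ℝ) : ℂ)) := by
    have : Continuous fun η : ℝ => 1 - Complex.exp (τ + η * Complex.I) := by fun_prop
    refine (this.tendsto' 0 _ ?_).mono_left nhdsWithin_le_nhds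
    simp
  rcases lt_or_gt_of_ne hτ with h | h
  · have h1 : 0 < 1 - Real.exp τ := by
      have := Real.exp_lt_exp.2 h; rw [Real.exp_zero] at this; linarith
    rw [if_neg (by linarith), abs_of_pos h1]
    have h2 : ((1 - Real.exp τ : ℝ) : ℂ) ∈ Complex.slitPlane :=
      Complex.ofReal_mem_slitPlane.2 h1
    have := (continuousAt_clog h2).tendsto.comp hc
    rw [← Complex.ofReal_log h1.le] at this
    simpa [Function.comp_def] using this
  · have h1 : 1 - Real.exp τ < 0 := by
      have := Real.one_lt_exp_iff.2 h; linarith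
    rw [if_pos h]
    have h3 := Complex.tendsto_log_nhdsWithin_im_neg_of_re_neg_of_im_zero
      (z := ((1 - Real.exp τ : ℝ) : ℂ)) (by rwa [Complex.ofReal_re]) (by rw [Complex.ofReal_im])
    have h4 : Tendsto (fun η : ℝ => 1 - Complex.exp (τ + η * Complex.I)) (𝓝[>] 0)
        (𝓝[{z | z.im < 0}] ((1 - Real.exp τ : ℝ) : ℂ)) := by
      refine tendsto_nhdsWithin_iff.2 ⟨hc, ?_⟩
      filter_upwards [Ioo_mem_nhdsGT Real.pi_pos] with η hη
      have := mul_pos (Real.exp_pos τ) (Real.sin_pos_of_pos_of_lt_pi hη.1 hη.2)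
      simpa [Complex.exp_im] using this
    have := h3.comp h4
    rw [Complex.norm_real, Real.norm_eq_abs] at this
    simpa [Function.comp_def, sub_eq_add_neg] using this

lemma tendsto_log_one_sub_exp_top (τ : ℝ) :
    Tendsto (fun η : ℝ => Complex.log (1 - Complex.exp (τ + (Real.pi - η : ℝ) * Complex.I)))
      (𝓝[>] 0) (𝓝 (Real.log (1 + Real.exp τ) : ℝ)) := by
  have hc : Tendsto (fun η : ℝ => 1 - Complex.exp (τ + (Real.pi - η : ℝ) * Complex.I)) (𝓝[>] 0)
      (𝓝 ((1 + Real.exp τ : ℝ) : ℂ)) := by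
    have : Continuous fun η : ℝ => 1 - Complex.exp (τ + (Real.pi - η : ℝ) * Complex.I) := by
      fun_prop
    refine (this.tendsto' 0 _ ?_).mono_left nhdsWithin_le_nhds
    simp [Complex.exp_add]
  have h1 : 0 < 1 + Real.exp τ := by positivity
  have := (continuousAt_clog (Complex.ofReal_mem_slitPlane.2 h1)).tendsto.comp hc
  rwa [← Complex.ofReal_log h1.le] at this

/-- A holomorphic function on the strip `0 < Im w < π`, with integrable logarithmic type
singularities at two boundary points, exponential decay on the right, boundary values `ℓ₀` on the
lower side and real boundary values on the upper side. -/
structure StripFun (ℓ : ℂ → ℂ) (ℓ₀ : ℝ → ℂ) (C p q : ℝ) : Prop where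
  diff : DifferentiableOn ℂ ℓ strip
  bound : ∀ w ∈ strip, w.re ≠ p → w.re ≠ q → ‖ℓ w‖ ≤ C * min 1 (Real.exp (-w.re)) *
    (1 + |w.re - p| ^ (-1 / 4 : ℝ) + |w.re - q| ^ (-1 / 4 : ℝ))
  bot : ∀ᵐ τ : ℝ, Tendsto (fun η : ℝ => ℓ (τ + η * Complex.I)) (𝓝[>] 0) (𝓝 (ℓ₀ τ))
  top : ∀ᵐ τ : ℝ, Tendsto (fun η : ℝ => (ℓ (τ + (Real.pi - η : ℝ) * Complex.I)).im)
    (𝓝[>] 0) (𝓝 0)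

lemma sq_rpow_quarter {x : ℝ} (hx : 0 ≤ x) :
    (x ^ (-1 / 4 : ℝ)) ^ 2 = x ^ (-1 / 2 : ℝ) := by
  rw [← Real.rpow_natCast, ← Real.rpow_mul hx]
  norm_num

lemma mul_bound_le_domFun {C : ℝ} (hC : 0 ≤ C) (τ p q : ℝ) :
    C * min 1 (Real.exp (-τ)) * (1 + |τ - p| ^ (-1 / 4 : ℝ) + |τ - q| ^ (-1 / 4 : ℝ)) *
      (16 * min (Real.exp τ) (Real.exp (τ / 2)) * (1 + |τ| ^ (-1 / 4 : ℝ))) ≤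
    domFun (48 * C) p q τ := by
  have hx := sq_rpow_quarter (abs_nonneg (τ - p))
  have hy := sq_rpow_quarter (abs_nonneg (τ - q))
  have hz := sq_rpow_quarter (abs_nonneg τ)
  have hmin : min 1 (Real.exp (-τ)) * min (Real.exp τ) (Real.exp (τ / 2)) ≤
      Real.exp (-|τ| / 2) := by
    rcases le_total 0 τ with h | h
    · rw [abs_of_nonneg h]
      calc _ ≤ Real.exp (-τ) * Real.exp (τ / 2) := by
            gcongr <;> simp
        _ = _ := by rw [← Real.exp_add]; ring_nf
    · rw [abs_of_nonpos h]
      calc _ ≤ 1 * Real.exp τ := by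
            gcongr <;> simp
        _ ≤ _ := by rw [one_mul]; exact Real.exp_le_exp.2 (by linarith)
  unfold domFun
  rw [sub_zero, ← hx, ← hy, ← hz]
  generalize |τ - p| ^ (-1 / 4 : ℝ) = x
  generalize |τ - q| ^ (-1 / 4 : ℝ) = y
  generalize |τ| ^ (-1 / 4 : ℝ) = z
  generalize Real.exp (-|τ| / 2) = e at *
  have h1 : (1 + x + y) * (1 + z) ≤ 3 * (1 + z ^ 2 + x ^ 2 + y ^ 2) := by
    nlinarith [sq_nonneg (x - y), sq_nonneg (x - z), sq_nonneg (y - z), sq_nonneg (x - 1),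
      sq_nonneg (y - 1), sq_nonneg (z - 1)]
  have hm0 : 0 ≤ min 1 (Real.exp (-τ)) * min (Real.exp τ) (Real.exp (τ / 2)) := by positivity
  calc _ = 16 * C * (min 1 (Real.exp (-τ)) * min (Real.exp τ) (Real.exp (τ / 2))) *
        ((1 + x + y) * (1 + z)) := by ring
    _ ≤ 16 * C * (min 1 (Real.exp (-τ)) * min (Real.exp τ) (Real.exp (τ / 2))) *
        (3 * (1 + z ^ 2 + x ^ 2 + y ^ 2)) := by gcongr
    _ ≤ 16 * C * e * (3 * (1 + z ^ 2 + x ^ 2 + y ^ 2)) := by gcongr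
    _ = _ := by ring

lemma bound_le_domFun {C : ℝ} (hC : 0 ≤ C) (p q : ℝ) {τ u : ℝ} (hτ : u < τ) :
    C * min 1 (Real.exp (-τ)) * (1 + |τ - p| ^ (-1 / 4 : ℝ) + |τ - q| ^ (-1 / 4 : ℝ)) ≤
    domFun (48 * C * max 1 (Real.exp (-u))) p q τ := by
  have hx := sq_rpow_quarter (abs_nonneg (τ - p))
  have hy := sq_rpow_quarter (abs_nonneg (τ - q))
  have hm : min 1 (Real.exp (-τ)) ≤ max 1 (Real.exp (-u)) * Real.exp (-|τ| / 2) := by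
    rcases le_total 0 τ with h0 | h0
    · rw [abs_of_nonneg h0]
      calc min 1 (Real.exp (-τ)) ≤ Real.exp (-τ) := min_le_right _ _
        _ ≤ Real.exp (-τ / 2) := Real.exp_le_exp.2 (by linarith)
        _ ≤ _ := le_mul_of_one_le_left (Real.exp_pos _).le (le_max_left _ _)
    · rw [abs_of_nonpos h0]
      calc min 1 (Real.exp (-τ)) ≤ 1 := min_le_left _ _
        _ ≤ Real.exp (-u + τ) * 1 + (1 - Real.exp (-u + τ)) := by linarith
        _ ≤ Real.exp (-u) * Real.exp (- -τ / 2) := ?_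
        _ ≤ _ := by gcongr; exact le_max_right _ _
      rw [← Real.exp_add]
      have : 1 ≤ Real.exp (-u + - -τ / 2) := Real.one_le_exp (by
        linarith)
      linarith
  have e0 := Real.exp_pos (-|τ| / 2)
  have e1 : 0 ≤ |τ - 0| ^ (-1 / 2 : ℝ) := by positivity
  unfold domFun
  rw [← hx, ← hy]
  generalize |τ - p| ^ (-1 / 4 : ℝ) = x
  generalize |τ - q| ^ (-1 / 4 : ℝ) = y
  generalize |τ - 0| ^ (-1 / 2 : ℝ) = z at *
  generalize Real.exp (-|τ| / 2) = e at *
  have h1 : 1 + x + y ≤ 48 * (1 + z + x ^ 2 + y ^ 2) := by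
    nlinarith [sq_nonneg (x - 1), sq_nonneg (y - 1)]
  have h2 : 0 ≤ max 1 (Real.exp (-u)) := by positivity
  calc C * min 1 (Real.exp (-τ)) * (1 + x + y)
      ≤ C * min 1 (Real.exp (-τ)) * (48 * (1 + z + x ^ 2 + y ^ 2)) := by gcongr
    _ ≤ C * (max 1 (Real.exp (-u)) * e) * (48 * (1 + z + x ^ 2 + y ^ 2)) := by gcongr
    _ = _ := by ring

namespace StripFun

variable {ℓ : ℂ → ℂ} {ℓ₀ : ℝ → ℂ} {C p q : ℝ}

lemma ae_mem_strip : ∀ᶠ η : ℝ in 𝓝[>] 0, ∀ τ : ℝ, (τ : ℂ) + η * Complex.I ∈ strip := by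
  filter_upwards [Ioo_mem_nhdsGT Real.pi_pos] with η h τ using mem_strip h.1 h.2

lemma ae_mem_strip_top :
    ∀ᶠ η : ℝ in 𝓝[>] 0, ∀ τ : ℝ, (τ : ℂ) + (Real.pi - η : ℝ) * Complex.I ∈ strip := by
  filter_upwards [Ioo_mem_nhdsGT Real.pi_pos] with η h τ using
    mem_strip (by linarith [h.2]) (by linarith [h.1])

lemma ae_ne (r : ℝ) : ∀ᵐ τ : ℝ, τ ≠ r := by
  rw [ae_iff]; simp

lemma norm_boundary_le (h : StripFun ℓ ℓ₀ C p q) : ∀ᵐ τ : ℝ, ‖ℓ₀ τ‖ ≤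
    C * min 1 (Real.exp (-τ)) * (1 + |τ - p| ^ (-1 / 4 : ℝ) + |τ - q| ^ (-1 / 4 : ℝ)) := by
  filter_upwards [h.bot, ae_ne p, ae_ne q] with τ hτ h1 h2
  refine le_of_tendsto hτ.norm ?_
  filter_upwards [ae_mem_strip] with η hη
  simpa using h.bound _ (hη τ) (by simpa using h1) (by simpa using h2)

lemma aestronglyMeasurable (h : StripFun ℓ ℓ₀ C p q) : AEStronglyMeasurable ℓ₀ := by
  have hu : Tendsto (fun n : ℕ => (1 / ((n : ℝ) + 1))) atTop (𝓝[>] 0) :=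
    tendsto_nhdsWithin_iff.2 ⟨tendsto_one_div_add_atTop_nhds_zero_nat,
      Eventually.of_forall fun n => by simp only [mem_Ioi]; positivity⟩
  refine aestronglyMeasurable_of_tendsto_ae atTop
    (f := fun (n : ℕ) (τ : ℝ) => ℓ (τ + (1 / ((n : ℝ) + 1) : ℝ) * Complex.I)) (fun n => ?_) ?_
  · refine Continuous.aestronglyMeasurable
      (h.diff.continuousOn.comp_continuous (by fun_prop) fun τ => mem_strip (by positivity) ?_)
    have : 1 / ((n : ℝ) + 1) ≤ 1 := by
      rw [div_le_one (by positivity)]; linarith [Nat.cast_nonneg (α := ℝ) n]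
    linarith [Real.pi_gt_three]
  · filter_upwards [h.bot] with τ hτ
    exact hτ.comp hu

lemma bound_mul (h : StripFun ℓ ℓ₀ C p q) (hC : 0 ≤ C) {w : ℂ} (hw : w ∈ strip)
    (hF : w.re ∉ ({p, q, 0} : Set ℝ)) :
    ‖ℓ w * Complex.log (1 - Complex.exp w)‖ ≤ domFun (48 * C) p q w.re := by
  simp only [mem_insert_iff, mem_singleton_iff, not_or] at hF
  rw [norm_mul]
  refine le_trans (mul_le_mul (h.bound w hw hF.1 hF.2.1) (norm_log_one_sub_exp_le hF.2.2)
    (norm_nonneg _) (by positivity)) (mul_bound_le_domFun hC _ _ _)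

lemma integrableOn_boundary (h : StripFun ℓ ℓ₀ C p q) (hC : 0 ≤ C) (u : ℝ) :
    IntegrableOn ℓ₀ (Ioi u) := by
  refine Integrable.mono' (g := fun τ => domFun (48 * C * max 1 (Real.exp (-u))) p q τ)
    (integrable_domFun _ _ _).integrableOn
    h.aestronglyMeasurable.restrict ?_
  rw [ae_restrict_iff' measurableSet_Ioi]
  filter_upwards [h.norm_boundary_le] with τ hτ hτu
  refine hτ.trans ?_
  exact bound_le_domFun hC p q hτu

/-- The logarithmic potential of the imaginary part of the boundary values, at the origin. -/
lemma integral_log_zero (h : StripFun ℓ ℓ₀ C p q) (hC : 0 ≤ C) :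
    Integrable (fun τ => (ℓ₀ τ).im * Real.log |1 - Real.exp τ|) ∧
    ∫ τ, (ℓ₀ τ).im * Real.log |1 - Real.exp τ| = Real.pi * ∫ τ in Ioi 0, (ℓ₀ τ).re := by
  have hFfin : ({p, q, 0} : Set ℝ).Finite := by simp
  set D₀ : ℝ → ℂ := fun τ =>
    Real.log |1 - Real.exp τ| + (if 0 < τ then -Real.pi else 0 : ℝ) * Complex.I with hD₀
  have hlogb : ∀ τ : ℝ, τ ≠ 0 → |Real.log (abs (1 - Real.exp τ))| ≤
      16 * min (Real.exp τ) (Real.exp (τ / 2)) * (1 + |τ| ^ (-1 / 4 : ℝ)) := by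
    intro τ hτ
    have h1 := norm_log_one_sub_exp_le (w := (τ : ℂ)) (by simpa using hτ)
    refine le_trans ?_ h1
    refine le_trans (le_of_eq ?_) (Complex.abs_re_le_norm _)
    rw [Complex.log_re, ← Complex.ofReal_exp, ← Complex.ofReal_one, ← Complex.ofReal_sub,
      Complex.norm_real, Real.norm_eq_abs]
  have i1 : Integrable (fun τ => (ℓ₀ τ).im * Real.log |1 - Real.exp τ|) := by
    refine (integrable_domFun (48 * C) p q).mono' ?_ ?_
    · exact (Complex.continuous_im.comp_aestronglyMeasurable h.aestronglyMeasurable).mul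
        (by fun_prop : Measurable fun τ : ℝ => Real.log |1 - Real.exp τ|).aestronglyMeasurable
    · filter_upwards [h.norm_boundary_le, ae_ne 0] with τ h1 h2
      rw [norm_mul]
      exact le_trans (mul_le_mul ((Complex.abs_im_le_norm _).trans h1) (hlogb τ h2)
        (abs_nonneg _) (by positivity)) (mul_bound_le_domFun hC _ _ _)
  have i2 : IntegrableOn (fun τ => (ℓ₀ τ).re) (Ioi 0) := (h.integrableOn_boundary hC 0).re
  refine ⟨i1, ?_⟩
  have key := integral_im_boundary_eq_zero (f₀ := fun τ => ℓ₀ τ * D₀ τ)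
    (h.diff.mul differentiableOn_log_one_sub_exp)
    (integrable_domFun (48 * C) p q) (tendsto_domFun (by positivity) p q) hFfin
    (fun w hw hF => h.bound_mul hC hw hF) ?_ ?_
  · have e : ∀ τ, (ℓ₀ τ * D₀ τ).im = (ℓ₀ τ).im * Real.log |1 - Real.exp τ| -
        (Ioi (0 : ℝ)).indicator (fun τ => Real.pi * (ℓ₀ τ).re) τ := by
      intro τ
      simp only [hD₀, Complex.mul_im, Complex.add_re, Complex.add_im, Complex.ofReal_re,
        Complex.ofReal_im, Complex.mul_re, Complex.I_re, Complex.I_im, indicator, mem_Ioi]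
      split_ifs <;> ring
    simp only [e] at key
    rw [integral_sub i1 ((integrable_indicator_iff measurableSet_Ioi).2 (i2.const_mul _)),
      integral_indicator measurableSet_Ioi, integral_const_mul] at key
    linarith
  · filter_upwards [h.bot, ae_ne 0] with τ h1 h2
    exact h1.mul (tendsto_log_one_sub_exp h2)
  · filter_upwards [h.top, ae_ne p, ae_ne q] with τ h1 h2 h3
    have h4 := tendsto_log_one_sub_exp_top τ
    have h5 := (Complex.continuous_re.tendsto _).comp h4
    have h6 := (Complex.continuous_im.tendsto _).comp h4
    have h7 := h1.mul h5
    rw [zero_mul] at h7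
    simp only [Complex.ofReal_im] at h6
    have h8 : Tendsto (fun η : ℝ => (ℓ (τ + (Real.pi - η : ℝ) * Complex.I)).re *
        (Complex.log (1 - Complex.exp (τ + (Real.pi - η : ℝ) * Complex.I))).im)
        (𝓝[>] 0) (𝓝 0) := by
      refine bdd_le_mul_tendsto_zero' (C * min 1 (Real.exp (-τ)) *
        (1 + |τ - p| ^ (-1 / 4 : ℝ) + |τ - q| ^ (-1 / 4 : ℝ))) ?_ h6
      filter_upwards [ae_mem_strip_top] with η hη
      refine (Complex.abs_re_le_norm _).trans ?_
      simpa using h.bound _ (hη τ) (by simpa using h2) (by simpa using h3)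
    have h9 := h8.add h7
    rw [zero_add] at h9
    simpa only [Complex.mul_im, Pi.mul_apply, Function.comp_def] using h9

lemma shift (h : StripFun ℓ ℓ₀ C p q) (hC : 0 ≤ C) (u : ℝ) :
    StripFun (fun w => ℓ (w + u)) (fun τ => ℓ₀ (τ + u)) (C * max 1 (Real.exp (-u)))
      (p - u) (q - u) where
  diff := by
    refine h.diff.comp (by fun_prop) ?_
    intro w hw
    simpa [strip] using hw
  bound := by
    intro w hw h1 h2
    refine (h.bound (w + u) (by simpa [strip] using hw)
      (by simp only [Complex.add_re, Complex.ofReal_re]; intro h3; apply h1; linarith)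
      (by simp only [Complex.add_re, Complex.ofReal_re]; intro h3; apply h2; linarith)).trans ?_
    simp only [Complex.add_re, Complex.ofReal_re, add_sub_assoc, sub_sub_eq_add_sub]
    refine mul_le_mul_of_nonneg_right ?_ (by positivity)
    rw [mul_assoc]
    refine mul_le_mul_of_nonneg_left ?_ hC
    rw [show -(w.re + u) = -u + -w.re by ring, Real.exp_add]
    rcases le_total 1 (Real.exp (-w.re)) with h3 | h3
    · rw [min_eq_left h3, mul_one]
      exact (min_le_left _ _).trans (le_max_left _ _)
    · rw [min_eq_right h3]
      exact (min_le_right _ _).trans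
        (mul_le_mul_of_nonneg_right (le_max_right _ _) (Real.exp_pos _).le)
  bot := by
    have := (measurePreserving_add_right volume u).quasiMeasurePreserving.ae h.bot
    filter_upwards [this] with τ hτ
    refine hτ.congr fun η => ?_
    push_cast
    ring_nf
  top := by
    have := (measurePreserving_add_right volume u).quasiMeasurePreserving.ae h.top
    filter_upwards [this] with τ hτ
    refine hτ.congr fun η => ?_
    push_cast
    ring_nf

/-- The logarithmic potential of the imaginary part of the boundary values. -/
lemma integral_log (h : StripFun ℓ ℓ₀ C p q) (hC : 0 ≤ C) (u : ℝ) :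
    Integrable (fun τ => (ℓ₀ τ).im * Real.log |1 - Real.exp (τ - u)|) ∧
    ∫ τ, (ℓ₀ τ).im * Real.log |1 - Real.exp (τ - u)| = Real.pi * ∫ τ in Ioi u, (ℓ₀ τ).re := by
  obtain ⟨h1, h2⟩ := (h.shift hC u).integral_log_zero (by positivity)
  constructor
  · have := h1.comp_sub_right u
    simpa using this
  · rw [← integral_add_right_eq_self _ u]
    simp only [add_sub_cancel_right]
    rw [h2]
    congr 1
    have := (measurePreserving_add_right volume u).setIntegral_preimage_emb
      (MeasurableEquiv.addRight u).measurableEmbedding (fun τ => (ℓ₀ τ).re) (Ioi u)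
    rw [← this]
    congr 2
    ext x
    simp

/-- The total mass of the imaginary part of the boundary values. -/
lemma integral_im (h : StripFun ℓ ℓ₀ C p q) (hC : 0 ≤ C) {c : ℝ}
    (hc : ∀ ε > 0, ∃ T : ℝ, ∀ w ∈ strip, w.re < T → ‖ℓ w - c‖ < ε)
    (hpos : ∀ τ, 0 ≤ (ℓ₀ τ).im) :
    Integrable (fun τ => (ℓ₀ τ).im) ∧ ∫ τ, (ℓ₀ τ).im = Real.pi * c := by
  have hint : ∀ R, IntegrableOn (fun τ => (ℓ₀ τ).im) (Ioi R) := fun R =>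
    (h.integrableOn_boundary hC R).im
  have hlim : Tendsto (fun R : ℝ => ∫ τ in (-R)..R, (ℓ₀ τ).im) atTop (𝓝 (Real.pi * c)) := by
    rw [Metric.tendsto_atTop]
    intro ε hε
    obtain ⟨T, hT⟩ := hc (ε / (3 * Real.pi)) (by positivity)
    have hexp : Tendsto (fun R : ℝ => C * Real.exp (-R) * 3) atTop (𝓝 0) := by
      simpa using (Real.tendsto_exp_neg_atTop_nhds_zero.const_mul C).mul_const 3
    obtain ⟨N, hN⟩ := eventually_atTop.1
      (hexp.eventually_lt_const (show 0 < ε / (3 * Real.pi) by positivity))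
    refine ⟨max (max N (-T + 1)) (max (|p| + 1) (|q| + 1)), fun R hR => ?_⟩
    simp only [ge_iff_le, max_le_iff] at hR
    obtain ⟨⟨hR1, hR2⟩, hR3, hR4⟩ := hR
    have hp0 := abs_nonneg p
    have hR0 : 0 < R := by linarith
    have hRp : R ≠ p := by have := le_abs_self p; intro h; linarith
    have hRq : R ≠ q := by have := le_abs_self q; intro h; linarith
    have hright : ∀ y, 0 < y → y < Real.pi →
        ‖ℓ (R + y * Complex.I)‖ ≤ ε / (3 * Real.pi) := by
      intro y h0 h1
      have h2 := h.bound _ (mem_strip (τ := R) h0 h1) (by simpa using hRp) (by simpa using hRq)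
      have h3 := hN R hR1
      have h4 := abs_sub_rpow_le_one (τ := R) (p := p) (r := -1 / 4) (by norm_num)
        (by rwa [abs_of_pos hR0])
      have h5 := abs_sub_rpow_le_one (τ := R) (p := q) (r := -1 / 4) (by norm_num)
        (by rwa [abs_of_pos hR0])
      have he : (((R : ℂ) + y * Complex.I)).re = R := by simp
      rw [he] at h2
      refine h2.trans (le_trans ?_ h3.le)
      refine mul_le_mul (mul_le_mul_of_nonneg_left (min_le_right _ _) hC) (by linarith)
        (by positivity) (by positivity)
    have hleft : ∀ y, 0 < y → y < Real.pi →
        ‖ℓ ((-R : ℝ) + y * Complex.I) - c‖ ≤ ε / (3 * Real.pi) := by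
      intro y h0 h1
      refine (hT _ (mem_strip h0 h1) ?_).le
      simp only [Complex.add_re, Complex.ofReal_re, Complex.mul_re, Complex.I_re, mul_zero,
        Complex.ofReal_im, Complex.I_im, mul_one, sub_zero, add_zero]
      linarith
    have hcont : ∀ {y : ℝ}, 0 < y → y < Real.pi →
        Continuous fun τ : ℝ => ℓ (τ + y * Complex.I) := by
      intro y hy0 hy1
      exact h.diff.continuousOn.comp_continuous (by fun_prop) (fun τ => mem_strip hy0 hy1)
    have hbd : ∀ {y : ℝ}, 0 < y → y < Real.pi → ∀ᵐ τ : ℝ, τ ∈ uIoc (-R) R →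
        ‖ℓ (τ + y * Complex.I)‖ ≤ domFun (48 * C * max 1 (Real.exp (- -R))) p q τ := by
      intro y hy0 hy1
      filter_upwards [ae_ne p, ae_ne q] with τ h1 h2 hτ
      rw [uIoc_of_le (by linarith)] at hτ
      have := h.bound _ (mem_strip (τ := τ) hy0 hy1) (by simpa using h1) (by simpa using h2)
      simp only [Complex.add_re, Complex.ofReal_re, Complex.mul_re, Complex.I_re, mul_zero,
        Complex.ofReal_im, Complex.I_im, mul_one, sub_zero, add_zero] at this
      exact this.trans (bound_le_domFun hC p q hτ.1)
    have l1 : Tendsto (fun η : ℝ => ∫ τ in (-R)..R, (ℓ (τ + η * Complex.I)).im) (𝓝[>] 0)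
        (𝓝 (∫ τ in (-R)..R, (ℓ₀ τ).im)) := by
      refine intervalIntegral.tendsto_integral_filter_of_dominated_convergence _ ?_ ?_
        (integrable_domFun (48 * C * max 1 (Real.exp (- -R))) p q).intervalIntegrable ?_
      · filter_upwards [Ioo_mem_nhdsGT Real.pi_pos] with η hη
        exact (Complex.continuous_im.comp (hcont hη.1 hη.2)).aestronglyMeasurable
      · filter_upwards [Ioo_mem_nhdsGT Real.pi_pos] with η hη
        filter_upwards [hbd hη.1 hη.2] with τ h1 h2
        exact (Complex.abs_im_le_norm _).trans (h1 h2)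
      · filter_upwards [h.bot] with τ hτ _
        exact (Complex.continuous_im.tendsto _).comp hτ
    have l2 : Tendsto (fun η : ℝ => ∫ τ in (-R)..R, (ℓ (τ + (Real.pi - η : ℝ) * Complex.I)).im)
        (𝓝[>] 0) (𝓝 (∫ _ in (-R)..R, 0)) := by
      refine intervalIntegral.tendsto_integral_filter_of_dominated_convergence _ ?_ ?_
        (integrable_domFun (48 * C * max 1 (Real.exp (- -R))) p q).intervalIntegrable ?_
      · filter_upwards [Ioo_mem_nhdsGT Real.pi_pos] with η hη
        exact (Complex.continuous_im.comp (hcont (y := Real.pi - η) (by linarith [hη.2])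
          (by linarith [hη.1]))).aestronglyMeasurable
      · filter_upwards [Ioo_mem_nhdsGT Real.pi_pos] with η hη
        filter_upwards [hbd (y := Real.pi - η) (by linarith [hη.2]) (by linarith [hη.1])]
          with τ h1 h2
        exact (Complex.abs_im_le_norm _).trans (h1 h2)
      · filter_upwards [h.top] with τ hτ _ using hτ
    rw [intervalIntegral.integral_zero] at l2
    have l3 : Tendsto (fun η : ℝ => c * (Real.pi - η - η)) (𝓝[>] 0) (𝓝 (c * Real.pi)) := by
      have : Continuous fun η : ℝ => c * (Real.pi - η - η) := by fun_prop
      exact (this.tendsto' 0 _ (by simp)).mono_left nhdsWithin_le_nhds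
    have key : ∀ᶠ η : ℝ in 𝓝[>] 0, |(∫ τ in (-R)..R, (ℓ (τ + η * Complex.I)).im) -
        (∫ τ in (-R)..R, (ℓ (τ + (Real.pi - η : ℝ) * Complex.I)).im) - c * (Real.pi - η - η)| ≤
        2 / 3 * ε := by
      filter_upwards [Ioo_mem_nhdsGT (show 0 < Real.pi / 2 by positivity)] with η hη
      have hη0 := hη.1
      have hη1 := hη.2
      have hη2 : η < Real.pi - η := by linarith
      have hrect := Complex.integral_boundary_rect_eq_zero_of_differentiableOn ℓ
        ((-R : ℝ) + η * Complex.I) (R + (Real.pi - η : ℝ) * Complex.I) (h.diff.mono (by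
          rintro w ⟨-, hw⟩
          simp only [Complex.add_im, Complex.ofReal_im, Complex.mul_im, Complex.ofReal_re,
            Complex.I_im, mul_one, Complex.I_re, mul_zero, add_zero, zero_add, mem_preimage] at hw
          rw [uIcc_of_le hη2.le] at hw
          exact ⟨by linarith [hw.1], by linarith [hw.2]⟩))
      simp only [Complex.add_im, Complex.ofReal_im, Complex.mul_im, Complex.ofReal_re,
        Complex.I_im, mul_one, Complex.I_re, mul_zero, add_zero, zero_add, Complex.add_re,
        Complex.mul_re, sub_self, smul_eq_mul] at hrect
      have im_int : ∀ {y : ℝ}, 0 < y → y < Real.pi →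
          (∫ τ in (-R)..R, (ℓ (τ + y * Complex.I)).im) =
          (∫ τ in (-R)..R, ℓ (τ + y * Complex.I)).im := fun hy0 hy1 =>
        Complex.imCLM.intervalIntegral_comp_comm ((hcont hy0 hy1).intervalIntegrable _ _)
      rw [im_int hη0 (by linarith), im_int (y := Real.pi - η) (by linarith) (by linarith)]
      have hv1 : ‖∫ y in η..(Real.pi - η), ℓ (R + y * Complex.I)‖ ≤ ε / 3 := by
        refine (intervalIntegral.norm_integral_le_of_norm_le_const
          (C := ε / (3 * Real.pi)) fun y hy => ?_).trans ?_
        · rw [uIoc_of_le hη2.le] at hy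
          exact hright y (by linarith [hy.1]) (by linarith [hy.2])
        · rw [abs_of_pos (by linarith)]
          calc ε / (3 * Real.pi) * (Real.pi - η - η) ≤ ε / (3 * Real.pi) * Real.pi := by
                gcongr; linarith
            _ = ε / 3 := by field_simp
      have hv2 : ‖(∫ y in η..(Real.pi - η), ℓ ((-R : ℝ) + y * Complex.I)) -
          c * (Real.pi - η - η : ℝ)‖ ≤ ε / 3 := by
        have hci : IntervalIntegrable (fun y : ℝ => ℓ ((-R : ℝ) + y * Complex.I)) volume η
            (Real.pi - η) := by
          refine ContinuousOn.intervalIntegrable ?_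
          refine h.diff.continuousOn.comp (Continuous.continuousOn (by fun_prop)) fun y hy => ?_
          rw [uIcc_of_le hη2.le] at hy
          exact mem_strip (by linarith [hy.1]) (by linarith [hy.2])
        have : (∫ y in η..(Real.pi - η), ℓ ((-R : ℝ) + y * Complex.I)) -
            c * (Real.pi - η - η : ℝ) =
            ∫ y in η..(Real.pi - η), (ℓ ((-R : ℝ) + y * Complex.I) - c) := by
          rw [intervalIntegral.integral_sub hci intervalIntegrable_const,
            intervalIntegral.integral_const, Complex.real_smul, mul_comm]
        rw [this]
        refine (intervalIntegral.norm_integral_le_of_norm_le_const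
          (C := ε / (3 * Real.pi)) fun y hy => ?_).trans ?_
        · rw [uIoc_of_le hη2.le] at hy
          exact hleft y (by linarith [hy.1]) (by linarith [hy.2])
        · rw [abs_of_pos (by linarith)]
          calc ε / (3 * Real.pi) * (Real.pi - η - η) ≤ ε / (3 * Real.pi) * Real.pi := by
                gcongr; linarith
            _ = ε / 3 := by field_simp
      have him := congrArg Complex.im hrect
      generalize (∫ y in η..(Real.pi - η), ℓ (R + y * Complex.I)) = V1 at *
      generalize (∫ y in η..(Real.pi - η), ℓ ((-R : ℝ) + y * Complex.I)) = V2 at *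
      simp only [Complex.sub_im, Complex.add_im, Complex.mul_im, Complex.I_re, zero_mul,
        Complex.I_im, one_mul, zero_add, Complex.zero_im] at him
      have g1 := (Complex.abs_re_le_norm _).trans hv1
      have g2 := (Complex.abs_re_le_norm _).trans hv2
      rw [Complex.sub_re, ← Complex.ofReal_mul, Complex.ofReal_re] at g2
      rw [abs_le] at g1 g2 ⊢
      constructor <;> linarith [g1.1, g1.2, g2.1, g2.2]
    have := le_of_tendsto ((l1.sub l2).sub l3).abs key
    rw [sub_zero, mul_comm c] at this
    rw [Real.dist_eq]
    linarith
  have hI : Integrable (fun τ => (ℓ₀ τ).im) := by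
    refine integrable_of_intervalIntegral_norm_tendsto (Real.pi * c) (a := fun R : ℝ => -R)
      (b := fun R => R) (l := atTop)
      (fun R => (hint (-R)).mono_set Ioc_subset_Ioi_self) tendsto_neg_atTop_atBot tendsto_id ?_
    refine hlim.congr fun R => ?_
    congr 1
    ext τ
    rw [Real.norm_of_nonneg (hpos τ)]
  exact ⟨hI, tendsto_nhds_unique
    (intervalIntegral_tendsto_integral hI tendsto_neg_atTop_atBot tendsto_id) hlim⟩

end StripFun

/-! ### The logarithm of the cross ratio -/

/-- `log ((s - s₁) / (s - s₂))` on the closed upper half plane. -/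
def logRatio (s₁ s₂ : ℝ) (s : ℂ) : ℂ := Complex.log (s - s₁) - Complex.log (s - s₂)

section logRatio

variable {s₁ s₂ : ℝ}

lemma im_sub_ofReal (s : ℂ) (r : ℝ) : (s - r).im = s.im := by simp

lemma logRatio_eq_log_div {s : ℂ} (hs : 0 < s.im) :
    logRatio s₁ s₂ s = Complex.log ((s - s₁) / (s - s₂)) := by
  have h1 : 0 < (s - s₁).im := by rwa [im_sub_ofReal]
  have h2 : 0 < (s - s₂).im := by rwa [im_sub_ofReal]
  rw [log_div_of_im_nonneg (ne_zero_of_im_pos h1) (ne_zero_of_im_pos h2) h1.le h2.le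
    (fun h => (arg_pos_of_im_pos h1).ne' h.1), logRatio]

lemma im_logRatio {s : ℂ} (hs : 0 < s.im) :
    (logRatio s₁ s₂ s).im = (((s₁ : ℂ) - s) / (s₂ - s)).arg := by
  rw [logRatio_eq_log_div hs, Complex.log_im, ← neg_sub (s : ℂ) s₁, ← neg_sub (s : ℂ) s₂,
    neg_div_neg_eq]

lemma im_logRatio_pos (h12 : s₂ < s₁) {s : ℂ} (hs : 0 < s.im) : 0 < (logRatio s₁ s₂ s).im := by
  rw [logRatio, Complex.sub_im, Complex.log_im, Complex.log_im]
  exact arg_sub_of_re_lt (by rwa [im_sub_ofReal]) (by simp) (by simpa using h12)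

lemma im_logRatio_lt_pi {s : ℂ} (hs : 0 < s.im) : (logRatio s₁ s₂ s).im < Real.pi := by
  rw [logRatio, Complex.sub_im, Complex.log_im, Complex.log_im]
  have h1 := arg_lt_pi_of_im_pos (z := s - s₁) (by rwa [im_sub_ofReal])
  have h2 := arg_pos_of_im_pos (z := s - s₂) (by rwa [im_sub_ofReal])
  linarith

lemma re_logRatio (s : ℂ) :
    (logRatio s₁ s₂ s).re = Real.log ‖s - s₁‖ - Real.log ‖s - s₂‖ := by
  rw [logRatio, Complex.sub_re, Complex.log_re, Complex.log_re]

lemma re_logRatio_ofReal (t : ℝ) :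
    (logRatio s₁ s₂ t).re = Real.log (t - s₁) - Real.log (t - s₂) := by
  rw [re_logRatio, ← Complex.ofReal_sub, ← Complex.ofReal_sub, Complex.norm_real,
    Complex.norm_real, Real.norm_eq_abs, Real.norm_eq_abs, Real.log_abs, Real.log_abs]

lemma im_logRatio_ofReal (t : ℝ) : (logRatio s₁ s₂ t).im =
    ((t - s₁ : ℝ) : ℂ).arg - ((t - s₂ : ℝ) : ℂ).arg := by
  rw [logRatio, Complex.sub_im, Complex.log_im, Complex.log_im]
  push_cast
  rfl

lemma im_logRatio_of_lt (h12 : s₂ < s₁) {t : ℝ} (h : t < s₂) : (logRatio s₁ s₂ t).im = 0 := by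
  rw [im_logRatio_ofReal, Complex.arg_ofReal_of_neg (by linarith),
    Complex.arg_ofReal_of_neg (by linarith), sub_self]

lemma im_logRatio_of_gt (h12 : s₂ < s₁) {t : ℝ} (h : s₁ ≤ t) : (logRatio s₁ s₂ t).im = 0 := by
  rw [im_logRatio_ofReal, Complex.arg_ofReal_of_nonneg (by linarith),
    Complex.arg_ofReal_of_nonneg (by linarith), sub_self]

lemma im_logRatio_of_mem {t : ℝ} (h2 : s₂ ≤ t) (h1 : t < s₁) :
    (logRatio s₁ s₂ t).im = Real.pi := by
  rw [im_logRatio_ofReal, Complex.arg_ofReal_of_neg (by linarith),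
    Complex.arg_ofReal_of_nonneg (by linarith), sub_zero]

lemma continuousWithinAt_logRatio {s : ℂ} (h1 : s ≠ s₁) (h2 : s ≠ s₂) :
    ContinuousWithinAt (logRatio s₁ s₂) {z | 0 ≤ z.im} s := by
  have key : ∀ r : ℝ, s ≠ r →
      ContinuousWithinAt (fun z : ℂ => Complex.log (z - r)) {z | 0 ≤ z.im} s := by
    intro r hr
    refine ContinuousWithinAt.comp (f := fun z : ℂ => z - r) (g := Complex.log)
      (t := {z | 0 ≤ z.im}) (continuousWithinAt_log_upper (sub_ne_zero.2 hr))
      (Continuous.continuousWithinAt (by fun_prop)) ?_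
    intro z hz
    simpa using hz
  exact (key s₁ h1).sub (key s₂ h2)

lemma differentiableAt_logRatio {s : ℂ} (hs : 0 < s.im) :
    DifferentiableAt ℂ (logRatio s₁ s₂) s := by
  unfold logRatio
  refine DifferentiableAt.sub ?_ ?_
  · exact (differentiableAt_id.sub_const _).clog
      (mem_slitPlane_of_im_pos (by simpa using hs))
  · exact (differentiableAt_id.sub_const _).clog
      (mem_slitPlane_of_im_pos (by simpa using hs))

lemma log_one_add_le {y : ℝ} (hy : 0 ≤ y) : Real.log (1 + y) ≤ 4 + 4 * y ^ (1 / 4 : ℝ) := by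
  have h1 := Real.log_le_rpow_div (x := 1 + y) (ε := 1 / 4) (by positivity) (by norm_num)
  have h2 : (1 + y) ^ (1 / 4 : ℝ) ≤ 1 ^ (1 / 4 : ℝ) + y ^ (1 / 4 : ℝ) :=
    Real.rpow_add_le_add_rpow zero_le_one hy (by norm_num) (by norm_num)
  rw [Real.one_rpow] at h2
  have : (1 + y) ^ (1 / 4 : ℝ) / (1 / 4) = 4 * (1 + y) ^ (1 / 4 : ℝ) := by ring
  linarith

lemma log_sub_log_le {x y D : ℝ} (hx : 0 < x) (hy : 0 < y) (hD : 0 ≤ D) (h : x ≤ y + D) :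
    Real.log x - Real.log y ≤ 4 + 4 * D ^ (1 / 4 : ℝ) * y ^ (-1 / 4 : ℝ) := by
  have h1 : Real.log x ≤ Real.log (y * (1 + D / y)) := by
    refine Real.log_le_log hx (h.trans (le_of_eq ?_))
    field_simp
  rw [Real.log_mul hy.ne' (by positivity)] at h1
  have h2 := log_one_add_le (y := D / y) (by positivity)
  have h3 : (D / y) ^ (1 / 4 : ℝ) = D ^ (1 / 4 : ℝ) * y ^ (-1 / 4 : ℝ) := by
    rw [Real.div_rpow hD hy.le, neg_div, Real.rpow_neg hy.le, div_eq_mul_inv]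
  rw [h3] at h2
  linarith

lemma norm_logRatio_le (h12 : s₂ < s₁) {s : ℂ} (hs : 0 < s.im) : ‖logRatio s₁ s₂ s‖ ≤
    12 + 4 * (s₁ - s₂) ^ (1 / 4 : ℝ) *
      (‖s - s₁‖ ^ (-1 / 4 : ℝ) + ‖s - s₂‖ ^ (-1 / 4 : ℝ)) := by
  have h1 : 0 < ‖s - s₁‖ := norm_pos_iff.2 (ne_zero_of_im_pos (by simpa using hs))
  have h2 : 0 < ‖s - s₂‖ := norm_pos_iff.2 (ne_zero_of_im_pos (by simpa using hs))
  have hD : 0 ≤ s₁ - s₂ := by linarith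
  have e : ‖((s₁ - s₂ : ℝ) : ℂ)‖ = s₁ - s₂ := Complex.norm_of_nonneg hD
  have t1 : ‖s - s₁‖ ≤ ‖s - s₂‖ + (s₁ - s₂) := by
    rw [← e]
    refine le_trans (le_of_eq ?_) (norm_sub_le _ _)
    push_cast; ring_nf
  have t2 : ‖s - s₂‖ ≤ ‖s - s₁‖ + (s₁ - s₂) := by
    rw [← e]
    refine le_trans (le_of_eq ?_) (norm_add_le _ _)
    push_cast; ring_nf
  have l1 := log_sub_log_le h1 h2 hD t1
  have l2 := log_sub_log_le h2 h1 hD t2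
  have hfin := Complex.norm_le_abs_re_add_abs_im (logRatio s₁ s₂ s)
  have hi : |(logRatio s₁ s₂ s).im| ≤ 4 := by
    rw [abs_of_pos (im_logRatio_pos h12 hs)]
    exact (im_logRatio_lt_pi hs).le.trans Real.pi_le_four
  have n1 : 0 ≤ 4 * (s₁ - s₂) ^ (1 / 4 : ℝ) * ‖s - s₁‖ ^ (-1 / 4 : ℝ) := by positivity
  have n2 : 0 ≤ 4 * (s₁ - s₂) ^ (1 / 4 : ℝ) * ‖s - s₂‖ ^ (-1 / 4 : ℝ) := by positivity
  have hr : |(logRatio s₁ s₂ s).re| ≤ 4 + 4 * (s₁ - s₂) ^ (1 / 4 : ℝ) * ‖s - s₁‖ ^ (-1 / 4 : ℝ)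
      + 4 * (s₁ - s₂) ^ (1 / 4 : ℝ) * ‖s - s₂‖ ^ (-1 / 4 : ℝ) := by
    rw [re_logRatio, abs_le]
    constructor <;> linarith
  linarith

lemma exists_norm_logRatio_le_far (h2 : 0 < s₂) (h12 : s₂ < s₁) : ∃ R > 0, ∃ C > 0, ∀ s : ℂ,
    0 < s.im → R ≤ ‖s‖ → ‖logRatio s₁ s₂ s‖ ≤ C / ‖s‖ := by
  have hD : 0 < s₁ - s₂ := by linarith
  refine ⟨2 * s₂ + 4 * (s₁ - s₂), by positivity, 3 * (s₁ - s₂), by positivity, fun s hs hR => ?_⟩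
  have hn : 0 < ‖s‖ := by linarith
  have hz : s - s₂ ≠ 0 := ne_zero_of_im_pos (by simpa using hs)
  have h3 : ‖s‖ / 2 ≤ ‖s - s₂‖ := by
    have := norm_sub_norm_le s s₂
    rw [Complex.norm_of_nonneg h2.le] at this
    linarith
  have e : (s - s₁) / (s - s₂) = 1 + (-((s₁ - s₂ : ℝ) : ℂ) / (s - s₂)) := by
    field_simp
    push_cast
    ring
  have hb : ‖-((s₁ - s₂ : ℝ) : ℂ) / (s - s₂)‖ ≤ 2 * (s₁ - s₂) / ‖s‖ := by
    rw [norm_div, norm_neg, Complex.norm_of_nonneg hD.le,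
      div_le_div_iff₀ (norm_pos_iff.2 hz) hn]
    nlinarith
  rw [logRatio_eq_log_div hs, e]
  refine (Complex.norm_log_one_add_half_le_self (hb.trans ?_)).trans ?_
  · rw [div_le_div_iff₀ hn (by norm_num)]
    linarith
  · calc _ ≤ 3 / 2 * (2 * (s₁ - s₂) / ‖s‖) := by gcongr
      _ = _ := by ring

lemma exists_norm_logRatio_sub_le_near (h2 : 0 < s₂) (h12 : s₂ < s₁) : ∃ r > 0, ∃ C > 0, ∀ s : ℂ,
    0 < s.im → ‖s‖ ≤ r → ‖logRatio s₁ s₂ s - Real.log (s₁ / s₂)‖ ≤ C * ‖s‖ := by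
  have hD : 0 < s₁ - s₂ := by linarith
  have h1 : 0 < s₁ := by linarith
  refine ⟨s₂ / 4, by positivity, 3 / s₂, by positivity, fun s hs hr => ?_⟩
  have hz : s - s₂ ≠ 0 := ne_zero_of_im_pos (by simpa using hs)
  have h3 : s₂ / 2 ≤ ‖s - s₂‖ := by
    have := norm_sub_norm_le (s₂ : ℂ) s
    rw [Complex.norm_of_nonneg h2.le, norm_sub_rev] at this
    linarith
  have h1' : (s₁ : ℂ) ≠ 0 := by exact_mod_cast h1.ne'
  have h2' : (s₂ : ℂ) ≠ 0 := by exact_mod_cast h2.ne'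
  set z : ℂ := -(((s₁ - s₂) / s₁ : ℝ) : ℂ) * s / (s - s₂) with hzd
  have e : (s - s₁) / (s - s₂) = ((s₁ / s₂ : ℝ) : ℂ) * (1 + z) := by
    rw [hzd]
    push_cast
    field_simp
    ring
  have hq : (s₁ - s₂) / s₁ ≤ 1 := by rw [div_le_one h1]; linarith
  have hb : ‖z‖ ≤ 2 / s₂ * ‖s‖ := by
    rw [hzd, norm_div, norm_mul, norm_neg, Complex.norm_of_nonneg (by positivity),
      div_le_iff₀ (norm_pos_iff.2 hz)]
    calc (s₁ - s₂) / s₁ * ‖s‖ ≤ 1 * ‖s‖ := by gcongr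
      _ = 2 / s₂ * ‖s‖ * (s₂ / 2) := by field_simp
      _ ≤ _ := by gcongr
  have hb2 : ‖z‖ ≤ 1 / 2 := by
    refine hb.trans ?_
    calc 2 / s₂ * ‖s‖ ≤ 2 / s₂ * (s₂ / 4) := by gcongr
      _ = 1 / 2 := by field_simp; norm_num
  have hz1 : 1 + z ≠ 0 := by
    intro h0
    have : z = -1 := by linear_combination h0
    rw [this, norm_neg, norm_one] at hb2
    norm_num at hb2
  rw [logRatio_eq_log_div hs, e, Complex.log_ofReal_mul (by positivity) hz1, add_sub_cancel_left]
  refine (Complex.norm_log_one_add_half_le_self hb2).trans ?_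
  calc _ ≤ 3 / 2 * (2 / s₂ * ‖s‖) := by gcongr
    _ = _ := by ring

end logRatio

namespace ConfMap

variable (d : ConfMap)

lemma exists_norm_sub_rpow_le {t : ℝ} (ht : 0 < t) : ∃ C > 0, ∀ s : ℂ, 0 < s.im →
    (d.lam s).re ≠ d.rlam t →
    ‖s - t‖ ^ (-1 / 4 : ℝ) ≤ C * (1 + |(d.lam s).re - d.rlam t| ^ (-1 / 4 : ℝ)) := by
  have hder : HasDerivAt d.lam (d.dlam t) t := by
    refine (d.hasStrictDerivAt_lam ?_ ?_ ?_).hasDerivAt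
    · exact Complex.ofReal_mem_slitPlane.2 ht
    · have : (0 : ℝ) < t + 1 := by positivity
      exact_mod_cast Complex.ofReal_mem_slitPlane.2 this
    · have h0 := d.c₀_pos
      have h1 := mul_pos d.c₁_pos ht
      have : (0 : ℝ) < d.c₁ * t + d.c₀ := by positivity
      exact_mod_cast Complex.ofReal_mem_slitPlane.2 this
  obtain ⟨K, hK0, hK⟩ := hder.isBigO_sub.exists_pos
  rw [Asymptotics.isBigOWith_iff] at hK
  obtain ⟨r, hr, hball⟩ := Metric.eventually_nhds_iff_ball.1 hK
  refine ⟨r ^ (-1 / 4 : ℝ) + K ^ (1 / 4 : ℝ), by positivity, fun s hs hne => ?_⟩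
  have hst : 0 < ‖s - t‖ := norm_pos_iff.2 (ne_zero_of_im_pos (by simpa using hs))
  have hx : 0 < |(d.lam s).re - d.rlam t| := abs_pos.2 (sub_ne_zero.2 hne)
  have hx4 : 0 < |(d.lam s).re - d.rlam t| ^ (-1 / 4 : ℝ) := Real.rpow_pos_of_pos hx _
  have hr4 : 0 < r ^ (-1 / 4 : ℝ) := Real.rpow_pos_of_pos hr _
  have hK4 : 0 < K ^ (1 / 4 : ℝ) := Real.rpow_pos_of_pos hK0 _
  rcases lt_or_ge ‖s - t‖ r with h | h
  · have h1 := hball s (mem_ball_iff_norm.2 h)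
    have h2 : |(d.lam s).re - d.rlam t| ≤ K * ‖s - t‖ := by
      refine le_trans ?_ h1
      rw [d.lam_of_pos ht]
      refine le_trans (le_of_eq ?_) (Complex.abs_re_le_norm _)
      simp
    have h3 : |(d.lam s).re - d.rlam t| / K ≤ ‖s - t‖ := by
      rw [div_le_iff₀ hK0, mul_comm]; exact h2
    calc ‖s - t‖ ^ (-1 / 4 : ℝ) ≤ (|(d.lam s).re - d.rlam t| / K) ^ (-1 / 4 : ℝ) :=
          Real.rpow_le_rpow_of_nonpos (by positivity) h3 (by norm_num)
      _ = K ^ (1 / 4 : ℝ) * |(d.lam s).re - d.rlam t| ^ (-1 / 4 : ℝ) := by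
          rw [Real.div_rpow hx.le hK0.le, neg_div, Real.rpow_neg hK0.le, div_inv_eq_mul, mul_comm]
      _ ≤ _ := by nlinarith
  · calc ‖s - t‖ ^ (-1 / 4 : ℝ) ≤ r ^ (-1 / 4 : ℝ) :=
          Real.rpow_le_rpow_of_nonpos hr h (by norm_num)
      _ ≤ _ := by nlinarith [mul_pos hr4 hx4, mul_pos hK4 hx4]

lemma exists_norm_logRatio_le {s₁ s₂ : ℝ} (h2 : 0 < s₂) (h12 : s₂ < s₁) : ∃ C > 0, ∀ s : ℂ,
    0 < s.im → (d.lam s).re ≠ d.rlam s₁ → (d.lam s).re ≠ d.rlam s₂ → ‖logRatio s₁ s₂ s‖ ≤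
    C * (1 + |(d.lam s).re - d.rlam s₁| ^ (-1 / 4 : ℝ) +
      |(d.lam s).re - d.rlam s₂| ^ (-1 / 4 : ℝ)) := by
  obtain ⟨C1, hC1, hb1⟩ := d.exists_norm_sub_rpow_le (h2.trans h12)
  obtain ⟨C2, hC2, hb2⟩ := d.exists_norm_sub_rpow_le h2
  have hD : 0 < s₁ - s₂ := by linarith
  have hD4 : 0 < (s₁ - s₂) ^ (1 / 4 : ℝ) := Real.rpow_pos_of_pos hD _
  refine ⟨12 + 4 * (s₁ - s₂) ^ (1 / 4 : ℝ) * (C1 + C2), by positivity, fun s hs hn1 hn2 => ?_⟩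
  refine (norm_logRatio_le h12 hs).trans ?_
  have g1 := hb1 s hs hn1
  have g2 := hb2 s hs hn2
  have p1 : 0 ≤ |(d.lam s).re - d.rlam s₁| ^ (-1 / 4 : ℝ) := by positivity
  have p2 : 0 ≤ |(d.lam s).re - d.rlam s₂| ^ (-1 / 4 : ℝ) := by positivity
  generalize |(d.lam s).re - d.rlam s₁| ^ (-1 / 4 : ℝ) = x at *
  generalize |(d.lam s).re - d.rlam s₂| ^ (-1 / 4 : ℝ) = y at *
  have g3 : ‖s - s₁‖ ^ (-1 / 4 : ℝ) + ‖s - s₂‖ ^ (-1 / 4 : ℝ) ≤ (C1 + C2) * (1 + x + y) := by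
    nlinarith [mul_nonneg hC1.le p2, mul_nonneg hC2.le p1]
  have g4 := mul_le_mul_of_nonneg_left g3 (show 0 ≤ 4 * (s₁ - s₂) ^ (1 / 4 : ℝ) by positivity)
  nlinarith

/-- Decay of the logarithm on the outer domain. -/
lemma exists_norm_logRatio_le_out {s₁ s₂ : ℝ} (h2 : 0 < s₂) (h12 : s₂ < s₁) : ∃ C > 0, ∀ s : ℂ,
    0 < s.im → 0 < (d.lam s).im → (d.lam s).re ≠ d.rlam s₁ → (d.lam s).re ≠ d.rlam s₂ →
    ‖logRatio s₁ s₂ s‖ ≤ C * min 1 (Real.exp (-(d.lam s).re)) *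
      (1 + |(d.lam s).re - d.rlam s₁| ^ (-1 / 4 : ℝ) +
        |(d.lam s).re - d.rlam s₂| ^ (-1 / 4 : ℝ)) := by
  obtain ⟨C, hC, hb⟩ := d.exists_norm_logRatio_le h2 h12
  obtain ⟨R, hR, C', hC', hfar⟩ := exists_norm_logRatio_le_far h2 h12
  obtain ⟨ε, hε, hnear⟩ := d.exists_im_lam_neg_near_zero
  have hν := d.ν_pos
  have hc1 := d.c₁_pos
  have hc0 := d.c₀_pos
  set M := (d.c₁ + d.c₀ / ε) * (1 + 1 / ε) with hM
  have hM0 : 0 < M := by positivity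
  refine ⟨(C * R + C') * (1 / ε + M), by positivity, fun s hs him hn1 hn2 => ?_⟩
  have hs0 : 0 < ‖s‖ := norm_pos_iff.2 (ne_zero_of_im_pos hs)
  have hsε : ε ≤ ‖s‖ := by
    by_contra! h
    exact absurd (hnear s hs h) (not_lt.2 him.le)
  have p1 : 0 ≤ |(d.lam s).re - d.rlam s₁| ^ (-1 / 4 : ℝ) := by positivity
  have p2 : 0 ≤ |(d.lam s).re - d.rlam s₂| ^ (-1 / 4 : ℝ) := by positivity
  have hb' := hb s hs hn1 hn2
  generalize |(d.lam s).re - d.rlam s₁| ^ (-1 / 4 : ℝ) = x at *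
  generalize |(d.lam s).re - d.rlam s₂| ^ (-1 / 4 : ℝ) = y at *
  have h3 : ‖logRatio s₁ s₂ s‖ ≤ (C * R + C') * (1 + x + y) * (1 / ‖s‖) := by
    rw [mul_one_div, le_div_iff₀ hs0]
    rcases le_total R ‖s‖ with h | h
    · have := hfar s hs h
      rw [le_div_iff₀ hs0] at this
      nlinarith [mul_pos hC hR, mul_nonneg (mul_pos hC hR).le (add_nonneg p1 p2),
        mul_nonneg hC'.le (add_nonneg p1 p2)]
    · calc _ ≤ C * (1 + x + y) * R := by gcongr
        _ ≤ _ := by nlinarith [mul_nonneg hC'.le (add_nonneg p1 p2)]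
  have h4 : 1 / ‖s‖ ≤ (1 / ε + M) * min 1 (Real.exp (-(d.lam s).re)) := by
    have e1 : 1 / ‖s‖ ≤ 1 / ε := one_div_le_one_div_of_le hε hsε
    have e2 : Real.exp (d.lam s).re ≤ M * ‖s‖ := by
      have key := d.exp_re_lam_mul (d.reg_of_im_pos hs)
      have k1 : ‖(d.c₁ : ℂ) * s + d.c₀‖ ≤ (d.c₁ + d.c₀ / ε) * ‖s‖ := by
        have := norm_add_le ((d.c₁ : ℂ) * s) d.c₀
        rw [norm_mul, Complex.norm_of_nonneg hc1.le, Complex.norm_of_nonneg hc0.le] at this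
        have h5 : d.c₀ ≤ d.c₀ / ε * ‖s‖ := by
          rw [div_mul_eq_mul_div, le_div_iff₀ hε]; gcongr
        linarith
      have k2 : ‖s + 1‖ ≤ (1 + 1 / ε) * ‖s‖ := by
        have := norm_add_le s 1
        rw [norm_one] at this
        have h5 : 1 ≤ 1 / ε * ‖s‖ := by
          rw [one_div_mul_eq_div, le_div_iff₀ hε]; linarith
        linarith
      have k3 : (1 + 1 / ε) ≤ (1 + 1 / ε) ^ d.ν := by
        have : (1 : ℝ) ≤ 1 + 1 / ε := by
          have := one_div_pos.2 hε; linarith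
        calc (1 + 1 / ε) = (1 + 1 / ε) ^ (1 : ℝ) := (Real.rpow_one _).symm
          _ ≤ _ := Real.rpow_le_rpow_of_exponent_le this d.one_lt.le
      have k4 : Real.exp (d.ν * (d.lam s).re) * ‖s‖ ≤ (M * ‖s‖) ^ d.ν * ‖s‖ := by
        rw [key]
        calc _ ≤ ((d.c₁ + d.c₀ / ε) * ‖s‖) ^ d.ν * ((1 + 1 / ε) ^ d.ν * ‖s‖) := by
              gcongr
              exact k2.trans (by gcongr)
          _ = _ := by
              rw [← mul_assoc, ← Real.mul_rpow (by positivity) (by positivity), hM]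
              ring_nf
      have k5 := le_of_mul_le_mul_right k4 hs0
      rw [mul_comm d.ν, Real.exp_mul] at k5
      exact (Real.rpow_le_rpow_iff (Real.exp_pos _).le (by positivity) hν).1 k5
    rcases min_choice 1 (Real.exp (-(d.lam s).re)) with h | h
    · rw [h, mul_one]; linarith
    · rw [h, Real.exp_neg, ← div_eq_mul_inv, le_div_iff₀ (Real.exp_pos _)]
      calc 1 / ‖s‖ * Real.exp (d.lam s).re ≤ 1 / ‖s‖ * (M * ‖s‖) := by gcongr
        _ = M := by field_simp
        _ ≤ _ := by have := one_div_pos.2 hε; linarith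
  calc _ ≤ (C * R + C') * (1 + x + y) * (1 / ‖s‖) := h3
    _ ≤ (C * R + C') * (1 + x + y) * ((1 / ε + M) * min 1 (Real.exp (-(d.lam s).re))) := by
        gcongr
    _ = _ := by ring

/-- Decay of the logarithm on the inner domain. -/
lemma exists_norm_logRatio_sub_le_in {s₁ s₂ : ℝ} (h2 : 0 < s₂) (h12 : s₂ < s₁) : ∃ C > 0,
    ∀ s : ℂ, 0 < s.im → (d.lam s).im < 0 → (d.lam s).re ≠ d.rlam s₁ → (d.lam s).re ≠ d.rlam s₂ →
    ‖logRatio s₁ s₂ s - Real.log (s₁ / s₂)‖ ≤ C * min 1 (Real.exp (-(d.ν * (d.lam s).re))) *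
      (1 + |(d.lam s).re - d.rlam s₁| ^ (-1 / 4 : ℝ) +
        |(d.lam s).re - d.rlam s₂| ^ (-1 / 4 : ℝ)) := by
  obtain ⟨C, hC, hb⟩ := d.exists_norm_logRatio_le h2 h12
  obtain ⟨r, hr, C', hC', hnear⟩ := exists_norm_logRatio_sub_le_near h2 h12
  obtain ⟨R, hR, hfar⟩ := d.exists_im_lam_pos_near_infty
  have hν := d.ν_pos
  have hc1 := d.c₁_pos
  have hc0 := d.c₀_pos
  set A := |Real.log (s₁ / s₂)| with hA
  have hA0 : 0 ≤ A := abs_nonneg _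
  set M := (d.c₁ * R + d.c₀) ^ d.ν * (R + 1) with hM
  have hM0 : 0 < M := by positivity
  refine ⟨((C + A) / r + C') * (R + M), by positivity, fun s hs him hn1 hn2 => ?_⟩
  have hs0 : 0 < ‖s‖ := norm_pos_iff.2 (ne_zero_of_im_pos hs)
  have hsR : ‖s‖ ≤ R := by
    by_contra! h
    exact absurd (hfar s hs h) (not_lt.2 him.le)
  have p1 : 0 ≤ |(d.lam s).re - d.rlam s₁| ^ (-1 / 4 : ℝ) := by positivity
  have p2 : 0 ≤ |(d.lam s).re - d.rlam s₂| ^ (-1 / 4 : ℝ) := by positivity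
  have hb' := hb s hs hn1 hn2
  generalize |(d.lam s).re - d.rlam s₁| ^ (-1 / 4 : ℝ) = x at *
  generalize |(d.lam s).re - d.rlam s₂| ^ (-1 / 4 : ℝ) = y at *
  have hxy : 1 ≤ 1 + x + y := by linarith
  have h3 : ‖logRatio s₁ s₂ s - Real.log (s₁ / s₂)‖ ≤ ((C + A) / r + C') * (1 + x + y) * ‖s‖ := by
    rcases le_total ‖s‖ r with h | h
    · refine (hnear s hs h).trans ?_
      refine mul_le_mul_of_nonneg_right ?_ hs0.le
      have h5 : 0 ≤ (C + A) / r := by positivity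
      nlinarith [mul_nonneg hC'.le (add_nonneg p1 p2), mul_nonneg h5 (add_nonneg p1 p2)]
    · have h6 : ‖logRatio s₁ s₂ s - Real.log (s₁ / s₂)‖ ≤ (C + A) * (1 + x + y) := by
        refine (norm_sub_le _ _).trans ?_
        rw [Complex.norm_real, Real.norm_eq_abs]
        nlinarith
      have h7 : (C + A) ≤ (C + A) / r * ‖s‖ := by
        rw [div_mul_eq_mul_div, le_div_iff₀ hr]; gcongr
      calc _ ≤ (C + A) * (1 + x + y) := h6
        _ ≤ (C + A) / r * ‖s‖ * (1 + x + y) := by gcongr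
        _ ≤ _ := by nlinarith [mul_nonneg (mul_nonneg hC'.le (by linarith : 0 ≤ 1 + x + y)) hs0.le]
  have h4 : ‖s‖ ≤ (R + M) * min 1 (Real.exp (-(d.ν * (d.lam s).re))) := by
    have e2 : Real.exp (d.ν * (d.lam s).re) * ‖s‖ ≤ M := by
      rw [d.exp_re_lam_mul (d.reg_of_im_pos hs), hM]
      have k1 : ‖(d.c₁ : ℂ) * s + d.c₀‖ ≤ d.c₁ * R + d.c₀ := by
        have := norm_add_le ((d.c₁ : ℂ) * s) d.c₀
        rw [norm_mul, Complex.norm_of_nonneg hc1.le, Complex.norm_of_nonneg hc0.le] at this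
        nlinarith
      have k2 : ‖s + 1‖ ≤ R + 1 := by
        have := norm_add_le s 1
        rw [norm_one] at this
        linarith
      gcongr
    rcases min_choice 1 (Real.exp (-(d.ν * (d.lam s).re))) with h | h
    · rw [h, mul_one]; linarith
    · rw [h, Real.exp_neg, ← div_eq_mul_inv, le_div_iff₀ (Real.exp_pos _)]
      linarith
  calc _ ≤ ((C + A) / r + C') * (1 + x + y) * ‖s‖ := h3
    _ ≤ ((C + A) / r + C') * (1 + x + y) *
        ((R + M) * min 1 (Real.exp (-(d.ν * (d.lam s).re)))) := by gcongr
    _ = _ := by ring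

end ConfMap

/-! ### Boundary values of the inverse map -/

namespace ConfMap

variable (d : ConfMap)

/-- The boundary value at `τ` of the inverse of `lam`, taken from the upper half plane. -/
def outPt (τ : ℝ) : ℂ :=
  if h : d.b ≤ Real.exp τ then ((d.exists_ge_sb h).choose : ℝ)
  else if h' : Real.exp τ ≤ d.a then ((d.exists_le_sa h').choose : ℝ) else d.inv τ

/-- The boundary value at `τ` of the inverse of `lam`, taken from the lower half plane. -/
def inPt (τ : ℝ) : ℂ :=
  if h : d.b ≤ Real.exp τ then ((d.exists_le_sb h).choose : ℝ)
  else if h' : Real.exp τ ≤ d.a then ((d.exists_ge_sa h').choose : ℝ) else d.inv τ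

lemma outPt_right {τ : ℝ} (h : d.b ≤ Real.exp τ) :
    ∃ t : ℝ, d.sb ≤ t ∧ d.rlam t = τ ∧ d.outPt τ = t := by
  have := (d.exists_ge_sb h).choose_spec
  exact ⟨_, this.1, this.2, by rw [outPt, dif_pos h]⟩

lemma outPt_left {τ : ℝ} (h : Real.exp τ ≤ d.a) :
    ∃ t : ℝ, d.s0 < t ∧ t ≤ d.sa ∧ t < -1 ∧ d.rlam t = τ ∧ d.outPt τ = t := by
  have := (d.exists_le_sa h).choose_spec
  have h2 := d.sa_lt_neg_one (d.c₁_lt_of_a_pos ((Real.exp_pos _).trans_le h))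
  exact ⟨_, this.1, this.2.1, this.2.1.trans_lt h2, this.2.2,
    by rw [outPt, dif_neg (by linarith [d.a_lt_b]), dif_pos h]⟩

lemma inPt_right {τ : ℝ} (h : d.b ≤ Real.exp τ) :
    ∃ t : ℝ, 0 < t ∧ t ≤ d.sb ∧ d.rlam t = τ ∧ d.inPt τ = t := by
  have := (d.exists_le_sb h).choose_spec
  exact ⟨_, this.1, this.2.1, this.2.2, by rw [inPt, dif_pos h]⟩

lemma inPt_left {τ : ℝ} (h : Real.exp τ ≤ d.a) :
    ∃ t : ℝ, d.s0 < t ∧ d.sa ≤ t ∧ t < -1 ∧ d.rlam t = τ ∧ d.inPt τ = t := by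
  have := (d.exists_ge_sa h).choose_spec
  have h2 := d.s0_lt_sa (d.c₁_lt_of_a_pos ((Real.exp_pos _).trans_le h))
  exact ⟨_, h2.trans_le this.1, this.1, this.2.1, this.2.2,
    by rw [inPt, dif_neg (by linarith [d.a_lt_b]), dif_pos h]⟩

lemma outPt_band {τ : ℝ} (h1 : d.a < Real.exp τ) (h2 : Real.exp τ < d.b) :
    d.outPt τ = d.inv τ := by
  rw [outPt, dif_neg h2.not_ge, dif_neg h1.not_ge]

lemma inPt_band {τ : ℝ} (h1 : d.a < Real.exp τ) (h2 : Real.exp τ < d.b) :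
    d.inPt τ = d.inv τ := by
  rw [inPt, dif_neg h2.not_ge, dif_neg h1.not_ge]

lemma ofReal_mem_slit {τ : ℝ} (h1 : d.a < Real.exp τ) (h2 : Real.exp τ < d.b) :
    (τ : ℂ) ∈ d.slit := by
  have := d.ν_pos
  have hπ := Real.pi_pos
  refine ⟨?_, ?_, fun _ => by simpa using ⟨h1, h2⟩⟩
  · simp; positivity
  · simpa using hπ

lemma mem_slit_of_pos {τ η : ℝ} (h0 : 0 < η) (h1 : η < Real.pi) :
    (τ : ℂ) + η * Complex.I ∈ d.slit := by
  have := d.ν_pos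
  have hπ := Real.pi_pos
  refine ⟨?_, ?_, fun h => ?_⟩
  · simp only [Complex.add_im, Complex.ofReal_im, Complex.mul_im, Complex.ofReal_re, Complex.I_im,
      mul_one, Complex.I_re, mul_zero, add_zero, zero_add]
    have : 0 < Real.pi / d.ν := by positivity
    linarith
  · simpa using h1
  · simp at h; exact absurd h h0.ne'

lemma mem_slit_of_neg {τ η : ℝ} (h0 : 0 < η) (h1 : η < Real.pi / d.ν) :
    (τ : ℂ) + (-η : ℝ) * Complex.I ∈ d.slit := by
  have := d.ν_pos
  have hπ := Real.pi_pos
  refine ⟨?_, ?_, fun h => ?_⟩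
  · simpa using h1
  · simp only [Complex.add_im, Complex.ofReal_im, Complex.mul_im, Complex.ofReal_re, Complex.I_im,
      mul_one, Complex.I_re, mul_zero, add_zero, zero_add]
    linarith
  · simp at h; exact absurd h h0.ne'

/-- If every limit point of `inv ∘ w` is `s`, then `inv ∘ w` converges to `s`. -/
lemma tendsto_inv {F : Filter ℝ} {w : ℝ → ℂ} {w₀ s : ℂ} (hw : ∀ᶠ η in F, w η ∈ d.slit)
    (hlim : Tendsto w F (𝓝 w₀))
    (huniq : ∀ z : ℂ, 0 ≤ z.im → d.Reg z → d.lam z = w₀ →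
      (∀ p : ℂ → Prop, (∀ᶠ x in 𝓝 z, p x) → ∃ᶠ η in F, p (d.inv (w η))) → z = s) :
    Tendsto (fun η => d.inv (w η)) F (𝓝 s) := by
  rw [tendsto_iff_ultrafilter]
  intro V hV
  have hmem : {s : ℂ | 0 < s.im} ∈ V.map fun η => d.inv (w η) := by
    change ∀ᶠ η in (V : Filter ℝ), 0 < (d.inv (w η)).im
    filter_upwards [hV hw] with η hη using d.inv_im_pos hη
  have hT0 : Tendsto d.lam (V.map fun η => d.inv (w η)) (𝓝 w₀) := by
    rw [Ultrafilter.coe_map, tendsto_map'_iff]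
    refine (hlim.mono_left hV).congr' ?_
    filter_upwards [hV hw] with η hη using (d.lam_inv hη).symm
  obtain ⟨z, h1, h2, h3, h4⟩ := d.exists_tendsto_of_tendsto_lam hmem hT0
  have hT : Tendsto (fun η => d.inv (w η)) V (𝓝 z) := h3
  have : z = s := huniq z h1 h2 h4 fun p hp =>
    ((hT.eventually hp).frequently).filter_mono hV
  rwa [← this]

lemma im_eq_zero_of_lam_eq {z w : ℂ} (hz : 0 ≤ z.im) (h : d.lam z = w) (hw : w ∉ d.slit) :
    ∃ t : ℝ, z = t := by
  rcases hz.lt_or_eq with h1 | h1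
  · exact absurd (h ▸ d.lam_mem_slit h1) hw
  · exact ⟨z.re, Complex.ext (by simp) (by simp [← h1])⟩

lemma real_cases {t τ : ℝ} (hr : d.Reg (t : ℂ)) (h : d.lam t = τ) :
    d.rlam t = τ ∧ (0 < t ∨ d.s0 < t ∧ t < -1) := by
  have hre : d.rlam t = τ := by rw [← d.re_lam_ofReal, h, Complex.ofReal_re]
  have him : (d.lam t).im = 0 := by rw [h, Complex.ofReal_im]
  have hπ := Real.pi_pos
  have hν := d.ν_pos
  obtain ⟨h1, h2, h3⟩ := d.reg_ofReal.1 hr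
  refine ⟨hre, ?_⟩
  by_contra! hc
  rcases lt_or_ge (-1) t with h4 | h4
  · rw [d.im_lam_of_mem_cut h4 (lt_of_le_of_ne hc.1 h1)] at him
    have : 0 < Real.pi / d.ν := by positivity
    linarith
  · have h5 : t < -1 := lt_of_le_of_ne h4 fun h => h2 (by linarith)
    have h6 : t < d.s0 := by
      refine lt_of_le_of_ne (not_lt.1 fun h => absurd (hc.2 h) (not_le.2 h5)) ?_
      rintro rfl
      exact h3 d.affine_s0
    rw [d.im_lam_of_lt h6] at him
    linarith

lemma eventually_im_lam_ofReal {t : ℝ} (h : 0 < t ∨ d.s0 < t ∧ t < -1) :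
    ∀ᶠ x in 𝓝 t, (d.lam (x : ℝ)).im = 0 := by
  rcases h with h | h
  · filter_upwards [lt_mem_nhds h] with x hx using d.im_lam_of_pos hx
  · filter_upwards [Ioo_mem_nhds h.1 h.2] with x hx using d.im_lam_of_mem_left hx.1 hx.2

lemma not_mem_slit_ofReal {τ : ℝ} (h : Real.exp τ < d.a ∨ d.b < Real.exp τ) :
    (τ : ℂ) ∉ d.slit := fun hs => by
  have := hs.2.2 (by simp)
  simp only [Complex.ofReal_re] at this
  rcases h with h | h
  · linarith [this.1]
  · linarith [this.2]

lemma b_le_exp_rlam {t : ℝ} (h : 0 < t) : d.b ≤ Real.exp (d.rlam t) :=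
  Real.exp_le_exp.2 (d.rlam_sb_le h)

lemma tendsto_inv_outPt {τ : ℝ} (ha : Real.exp τ ≠ d.a) (hb : Real.exp τ ≠ d.b) :
    Tendsto (fun η : ℝ => d.inv (τ + η * Complex.I)) (𝓝[>] 0) (𝓝 (d.outPt τ)) := by
  have hlim : Tendsto (fun η : ℝ => (τ : ℂ) + η * Complex.I) (𝓝[>] 0) (𝓝 τ) := by
    have : Continuous fun η : ℝ => (τ : ℂ) + η * Complex.I := by fun_prop
    simpa using (this.tendsto 0).mono_left nhdsWithin_le_nhds
  have hmem : ∀ᶠ η : ℝ in 𝓝[>] 0, 0 < η ∧ (τ : ℂ) + η * Complex.I ∈ d.slit := by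
    filter_upwards [Ioo_mem_nhdsGT Real.pi_pos] with η hη
    exact ⟨hη.1, d.mem_slit_of_pos hη.1 hη.2⟩
  by_cases hband : d.a < Real.exp τ ∧ Real.exp τ < d.b
  · rw [d.outPt_band hband.1 hband.2]
    exact (d.continuousAt_inv (d.ofReal_mem_slit hband.1 hband.2)).tendsto.comp hlim
  have hcase : Real.exp τ < d.a ∨ d.b < Real.exp τ := by
    rcases lt_or_gt_of_ne ha with h | h
    · exact Or.inl h
    · exact Or.inr (lt_of_le_of_ne (not_lt.1 fun h' => hband ⟨h, h'⟩) hb.symm)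
  refine d.tendsto_inv (hmem.mono fun _ h => h.2) hlim fun z h0 hr hz hfreq => ?_
  obtain ⟨t, rfl⟩ := d.im_eq_zero_of_lam_eq h0 hz (d.not_mem_slit_ofReal hcase)
  obtain ⟨hrt, ht⟩ := d.real_cases hr hz
  have hnot : ¬ d.drlam t < 0 := fun hneg => by
    obtain ⟨η, h1, h2, h3⟩ :=
      ((hfreq _ (d.eventually_im_lam_neg hr hneg (d.eventually_im_lam_ofReal ht))).and_eventually
        hmem).exists
    have := h1 (d.inv_im_pos h3)
    rw [d.lam_inv h3] at this
    simp at this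
    linarith
  rcases hcase with h | h
  · obtain ⟨t', h1, h2, h3, h4, h5⟩ := d.outPt_left h.le
    have ht' : d.s0 < t ∧ t < -1 := by
      refine ht.resolve_left fun h6 => ?_
      have := d.b_le_exp_rlam h6
      rw [hrt] at this
      linarith [d.a_lt_b]
    have h6 : t ≤ d.sa := not_lt.1 fun h6 => hnot (d.drlam_neg_of_mem_left h6 ht'.2)
    rw [h5, d.strictMonoOn_rlam_left.injOn ⟨⟨ht'.1, ht'.2⟩, h6⟩ ⟨⟨h1, h3⟩, h2⟩ (hrt.trans h4.symm)]
  · obtain ⟨t', h1, h4, h5⟩ := d.outPt_right h.le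
    have ht' : 0 < t := by
      refine ht.resolve_right fun h6 => ?_
      have := d.exp_rlam_le_a h6.1 h6.2
      rw [hrt] at this
      linarith [d.a_lt_b]
    have h6 : d.sb ≤ t := not_lt.1 fun h6 => hnot (d.drlam_neg_of_pos ht' h6)
    rw [h5, d.strictMonoOn_rlam.injOn h6 h1 (hrt.trans h4.symm)]

lemma tendsto_inv_inPt {τ : ℝ} (ha : Real.exp τ ≠ d.a) (hb : Real.exp τ ≠ d.b) :
    Tendsto (fun η : ℝ => d.inv (τ + (-η : ℝ) * Complex.I)) (𝓝[>] 0) (𝓝 (d.inPt τ)) := by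
  have hlim : Tendsto (fun η : ℝ => (τ : ℂ) + (-η : ℝ) * Complex.I) (𝓝[>] 0) (𝓝 τ) := by
    have : Continuous fun η : ℝ => (τ : ℂ) + (-η : ℝ) * Complex.I := by fun_prop
    simpa using (this.tendsto 0).mono_left nhdsWithin_le_nhds
  have hmem : ∀ᶠ η : ℝ in 𝓝[>] 0, 0 < η ∧ (τ : ℂ) + (-η : ℝ) * Complex.I ∈ d.slit := by
    filter_upwards [Ioo_mem_nhdsGT (div_pos Real.pi_pos d.ν_pos)] with η hη
    exact ⟨hη.1, d.mem_slit_of_neg hη.1 hη.2⟩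
  by_cases hband : d.a < Real.exp τ ∧ Real.exp τ < d.b
  · rw [d.inPt_band hband.1 hband.2]
    exact (d.continuousAt_inv (d.ofReal_mem_slit hband.1 hband.2)).tendsto.comp hlim
  have hcase : Real.exp τ < d.a ∨ d.b < Real.exp τ := by
    rcases lt_or_gt_of_ne ha with h | h
    · exact Or.inl h
    · exact Or.inr (lt_of_le_of_ne (not_lt.1 fun h' => hband ⟨h, h'⟩) hb.symm)
  refine d.tendsto_inv (hmem.mono fun _ h => h.2) hlim fun z h0 hr hz hfreq => ?_
  obtain ⟨t, rfl⟩ := d.im_eq_zero_of_lam_eq h0 hz (d.not_mem_slit_ofReal hcase)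
  obtain ⟨hrt, ht⟩ := d.real_cases hr hz
  have hnot : ¬ 0 < d.drlam t := fun hneg => by
    obtain ⟨η, h1, h2, h3⟩ :=
      ((hfreq _ (d.eventually_im_lam_pos hr hneg (d.eventually_im_lam_ofReal ht))).and_eventually
        hmem).exists
    have := h1 (d.inv_im_pos h3)
    rw [d.lam_inv h3] at this
    simp at this
    linarith
  rcases hcase with h | h
  · obtain ⟨t', h1, h2, h3, h4, h5⟩ := d.inPt_left h.le
    have ht' : d.s0 < t ∧ t < -1 := by
      refine ht.resolve_left fun h6 => ?_
      have := d.b_le_exp_rlam h6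
      rw [hrt] at this
      linarith [d.a_lt_b]
    have h6 : d.sa ≤ t := not_lt.1 fun h6 => hnot (d.drlam_pos_of_mem_left ht'.1 h6)
    rw [h5, d.strictAntiOn_rlam_left.injOn ⟨⟨ht'.1, ht'.2⟩, h6⟩ ⟨⟨h1, h3⟩, h2⟩ (hrt.trans h4.symm)]
  · obtain ⟨t', h1, h2, h4, h5⟩ := d.inPt_right h.le
    have ht' : 0 < t := by
      refine ht.resolve_right fun h6 => ?_
      have := d.exp_rlam_le_a h6.1 h6.2
      rw [hrt] at this
      linarith [d.a_lt_b]
    have h6 : t ≤ d.sb := not_lt.1 fun h6 => hnot (d.drlam_pos_of_gt h6)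
    rw [h5, d.strictAntiOn_rlam.injOn ⟨ht', h6⟩ ⟨h1, h2⟩ (hrt.trans h4.symm)]

lemma rlam_of_outPt_eq {τ t : ℝ} (h : d.outPt τ = t) : d.rlam t = τ := by
  by_cases h1 : d.b ≤ Real.exp τ
  · obtain ⟨t', -, h2, h3⟩ := d.outPt_right h1
    rwa [← Complex.ofReal_injective (h3.symm.trans h)]
  by_cases h2 : Real.exp τ ≤ d.a
  · obtain ⟨t', -, -, -, h2, h3⟩ := d.outPt_left h2
    rwa [← Complex.ofReal_injective (h3.symm.trans h)]
  rw [d.outPt_band (not_le.1 h2) (not_le.1 h1)] at h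
  have := d.inv_im_pos (d.ofReal_mem_slit (not_le.1 h2) (not_le.1 h1))
  simp [h] at this

lemma rlam_of_inPt_eq {τ t : ℝ} (h : d.inPt τ = t) : d.rlam t = τ := by
  by_cases h1 : d.b ≤ Real.exp τ
  · obtain ⟨t', -, -, h2, h3⟩ := d.inPt_right h1
    rwa [← Complex.ofReal_injective (h3.symm.trans h)]
  by_cases h2 : Real.exp τ ≤ d.a
  · obtain ⟨t', -, -, -, h2, h3⟩ := d.inPt_left h2
    rwa [← Complex.ofReal_injective (h3.symm.trans h)]
  rw [d.inPt_band (not_le.1 h2) (not_le.1 h1)] at h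
  have := d.inv_im_pos (d.ofReal_mem_slit (not_le.1 h2) (not_le.1 h1))
  simp [h] at this

lemma im_outPt_nonneg (τ : ℝ) : 0 ≤ (d.outPt τ).im := by
  by_cases h1 : d.b ≤ Real.exp τ
  · obtain ⟨t', -, h2, h3⟩ := d.outPt_right h1
    simp [h3]
  by_cases h2 : Real.exp τ ≤ d.a
  · obtain ⟨t', -, -, -, h2, h3⟩ := d.outPt_left h2
    simp [h3]
  rw [d.outPt_band (not_le.1 h2) (not_le.1 h1)]
  exact (d.inv_im_pos (d.ofReal_mem_slit (not_le.1 h2) (not_le.1 h1))).le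

/-- A boundary limit at which all limit points are negative real numbers, so that `logRatio` has a
real limit there. -/
lemma tendsto_im_logRatio_inv {s₁ s₂ : ℝ} (h2 : 0 < s₂) (h12 : s₂ < s₁) {F : Filter ℝ} {w : ℝ → ℂ}
    {w₀ : ℂ} (hw : ∀ᶠ η in F, w η ∈ d.slit) (hlim : Tendsto w F (𝓝 w₀))
    (hw₀ : w₀ ∉ d.slit) (him : w₀.im ≠ 0) :
    Tendsto (fun η => (logRatio s₁ s₂ (d.inv (w η))).im) F (𝓝 0) := by
  rw [tendsto_iff_ultrafilter]
  intro V hV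
  have hmem : {s : ℂ | 0 < s.im} ∈ V.map fun η => d.inv (w η) := by
    change ∀ᶠ η in (V : Filter ℝ), 0 < (d.inv (w η)).im
    filter_upwards [hV hw] with η hη using d.inv_im_pos hη
  have hT0 : Tendsto d.lam (V.map fun η => d.inv (w η)) (𝓝 w₀) := by
    rw [Ultrafilter.coe_map, tendsto_map'_iff]
    refine (hlim.mono_left hV).congr' ?_
    filter_upwards [hV hw] with η hη using (d.lam_inv hη).symm
  obtain ⟨z, h1, h2, h3, h4⟩ := d.exists_tendsto_of_tendsto_lam hmem hT0
  have hT : Tendsto (fun η => d.inv (w η)) V (𝓝 z) := h3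
  obtain ⟨t, rfl⟩ := d.im_eq_zero_of_lam_eq h1 h4 hw₀
  have ht : t < 0 := by
    by_contra! ht
    rcases ht.lt_or_eq with ht | rfl
    · exact him (by rw [← h4, d.im_lam_of_pos ht])
    · exact h2.1 (by simp)
  have hc := continuousWithinAt_logRatio (s₁ := s₁) (s₂ := s₂) (s := t)
    (by norm_cast; linarith) (by norm_cast; linarith)
  have hT' : Tendsto (fun η => d.inv (w η)) V (𝓝[{z | 0 ≤ z.im}] (t : ℂ)) := by
    refine tendsto_nhdsWithin_iff.2 ⟨hT, ?_⟩
    filter_upwards [hV hw] with η hη using (d.inv_im_pos hη).le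
  have := (Complex.continuous_im.tendsto _).comp (hc.tendsto.comp hT')
  rwa [im_logRatio_of_lt h12 (by linarith)] at this

end ConfMap

lemma ae_exp_ne (c : ℝ) : ∀ᵐ τ : ℝ, Real.exp τ ≠ c := by
  by_cases hc : 0 < c
  · filter_upwards [StripFun.ae_ne (Real.log c)] with τ h1 h2
    exact h1 (by rw [← h2, Real.log_exp])
  · exact Eventually.of_forall fun τ h => hc (h ▸ Real.exp_pos τ)

namespace ConfMap

variable (d : ConfMap) {s₁ s₂ : ℝ}

lemma tendsto_logRatio_of_tendsto {F : Filter ℝ} {w : ℝ → ℂ} {z : ℂ}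
    (hw : ∀ᶠ η in F, w η ∈ d.slit) (hlim : Tendsto (fun η => d.inv (w η)) F (𝓝 z))
    (h1 : z ≠ s₁) (h2 : z ≠ s₂) :
    Tendsto (fun η => logRatio s₁ s₂ (d.inv (w η))) F (𝓝 (logRatio s₁ s₂ z)) := by
  refine (continuousWithinAt_logRatio h1 h2).tendsto.comp (tendsto_nhdsWithin_iff.2 ⟨hlim, ?_⟩)
  filter_upwards [hw] with η hη using (d.inv_im_pos hη).le

lemma strip_subset_slit : strip ⊆ d.slit := fun w hw => by
  have := d.mem_slit_of_pos (τ := w.re) hw.1 hw.2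
  rwa [Complex.re_add_im] at this

lemma conj_div_mem_slit {w : ℂ} (hw : w ∈ strip) : conj w / (d.ν : ℂ) ∈ d.slit := by
  have hν := d.ν_pos
  have := d.mem_slit_of_neg (τ := w.re / d.ν) (η := w.im / d.ν) (div_pos hw.1 hν)
    (div_lt_div_of_pos_right hw.2 hν)
  convert this using 1
  apply Complex.ext
  · simp [Complex.div_ofReal_re]
  · simp [Complex.div_ofReal_im, neg_div]

/-- The function `logRatio` on the upper part of the slit strip. -/
theorem stripFun_out (h2 : 0 < s₂) (h12 : s₂ < s₁) : ∃ C > 0,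
    StripFun (fun w => logRatio s₁ s₂ (d.inv w)) (fun τ => logRatio s₁ s₂ (d.outPt τ)) C
      (d.rlam s₁) (d.rlam s₂) := by
  obtain ⟨C, hC, hb⟩ := d.exists_norm_logRatio_le_out h2 h12
  refine ⟨C, hC, ⟨fun w hw => ?_, fun w hw hp hq => ?_, ?_, ?_⟩⟩
  · have hs := d.strip_subset_slit hw
    exact ((differentiableAt_logRatio (d.inv_im_pos hs)).comp w
      (d.differentiableAt_inv hs)).differentiableWithinAt
  · have hs := d.strip_subset_slit hw
    have := hb (d.inv w) (d.inv_im_pos hs)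
    rw [d.lam_inv hs] at this
    exact this hw.1 hp hq
  · filter_upwards [ae_exp_ne d.a, ae_exp_ne d.b, StripFun.ae_ne (d.rlam s₁), StripFun.ae_ne (d.rlam s₂)]
      with τ ha hb h1 h2
    refine d.tendsto_logRatio_of_tendsto ?_ (d.tendsto_inv_outPt ha hb)
      (fun h => h1 (d.rlam_of_outPt_eq h).symm) (fun h => h2 (d.rlam_of_outPt_eq h).symm)
    filter_upwards [Ioo_mem_nhdsGT Real.pi_pos] with η hη using d.mem_slit_of_pos hη.1 hη.2
  · refine Eventually.of_forall fun τ => ?_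
    refine d.tendsto_im_logRatio_inv h2 h12 (w₀ := τ + Real.pi * Complex.I) ?_ ?_ ?_ ?_
    · filter_upwards [Ioo_mem_nhdsGT Real.pi_pos] with η hη
      exact d.mem_slit_of_pos (by linarith [hη.2]) (by linarith [hη.1])
    · have : Continuous fun η : ℝ => (τ : ℂ) + (Real.pi - η : ℝ) * Complex.I := by fun_prop
      simpa using (this.tendsto 0).mono_left nhdsWithin_le_nhds
    · intro h
      have := h.2.1
      simp at this
    · simp [Real.pi_ne_zero]

/-- The reflection of `logRatio` on the lower part of the slit strip, stretched to the strip of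
width `π`. -/
theorem stripFun_in (h2 : 0 < s₂) (h12 : s₂ < s₁) : ∃ C > 0,
    StripFun (fun w => conj (logRatio s₁ s₂ (d.inv (conj w / (d.ν : ℂ))) - Real.log (s₁ / s₂)))
      (fun τ => conj (logRatio s₁ s₂ (d.inPt (τ / d.ν)) - Real.log (s₁ / s₂))) C
      (d.ν * d.rlam s₁) (d.ν * d.rlam s₂) := by
  have hν := d.ν_pos
  obtain ⟨C, hC, hb⟩ := d.exists_norm_logRatio_sub_le_in h2 h12
  have hscale : ∀ x t : ℝ, |x / d.ν - t| ^ (-1 / 4 : ℝ) =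
      d.ν ^ (1 / 4 : ℝ) * |x - d.ν * t| ^ (-1 / 4 : ℝ) := by
    intro x t
    have e : |x / d.ν - t| = |x - d.ν * t| / d.ν := by
      rw [← abs_of_pos hν, ← abs_div, abs_of_pos hν]
      congr 1
      field_simp
    rw [e, Real.div_rpow (abs_nonneg _) hν.le, show (-1 / 4 : ℝ) = -(1 / 4) by norm_num,
      Real.rpow_neg hν.le, div_inv_eq_mul, mul_comm]
  have hone : 1 ≤ d.ν ^ (1 / 4 : ℝ) := Real.one_le_rpow d.one_lt.le (by norm_num)
  refine ⟨C * d.ν ^ (1 / 4 : ℝ), by positivity, ⟨fun w hw => ?_, fun w hw hp hq => ?_, ?_, ?_⟩⟩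
  · have hs := d.conj_div_mem_slit hw
    have h1 : DifferentiableAt ℂ
        (fun z => logRatio s₁ s₂ (d.inv (z / (d.ν : ℂ))) - Real.log (s₁ / s₂)) (conj w) := by
      refine DifferentiableAt.sub_const ?_ _
      have e1 : DifferentiableAt ℂ (fun z : ℂ => z / (d.ν : ℂ)) (conj w) := by fun_prop
      exact (differentiableAt_logRatio (d.inv_im_pos hs)).comp (conj w)
        ((d.differentiableAt_inv hs).comp (conj w) e1)
    have h3 := h1.conj_conj
    rw [Complex.conj_conj] at h3
    exact h3.differentiableWithinAt
  · have hs := d.conj_div_mem_slit hw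
    have := hb _ (d.inv_im_pos hs)
    rw [d.lam_inv hs] at this
    have e1 : (conj w / (d.ν : ℂ)).re = w.re / d.ν := by simp [Complex.div_ofReal_re]
    have e2 : (conj w / (d.ν : ℂ)).im = -(w.im / d.ν) := by
      simp [Complex.div_ofReal_im, neg_div]
    rw [e1, e2, mul_div_cancel₀ _ hν.ne'] at this
    have h3 := this (neg_lt_zero.2 (div_pos hw.1 hν)) (fun h => hp (by rw [← h]; field_simp))
      (fun h => hq (by rw [← h]; field_simp))
    rw [hscale, hscale] at h3
    rw [RCLike.norm_conj]
    refine h3.trans ?_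
    rw [mul_right_comm C (d.ν ^ (1 / 4 : ℝ)), mul_assoc (C * _)]
    refine mul_le_mul_of_nonneg_left ?_ (by positivity)
    nlinarith
  · have hq : Measure.QuasiMeasurePreserving (fun τ : ℝ => τ / d.ν) volume volume := by
      refine ⟨by fun_prop, ?_⟩
      have := Real.map_volume_mul_right (a := d.ν⁻¹) (inv_ne_zero hν.ne')
      simp only [div_eq_mul_inv]
      rw [this]
      exact Measure.smul_absolutelyContinuous
    filter_upwards [hq.ae (ae_exp_ne d.a), hq.ae (ae_exp_ne d.b), hq.ae (StripFun.ae_ne (d.rlam s₁)),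
      hq.ae (StripFun.ae_ne (d.rlam s₂))] with τ ha hb h1 h2
    have key : Tendsto (fun η : ℝ => logRatio s₁ s₂ (d.inv ((τ / d.ν : ℝ) + (-η : ℝ) * Complex.I)))
        (𝓝[>] 0) (𝓝 (logRatio s₁ s₂ (d.inPt (τ / d.ν)))) := by
      refine d.tendsto_logRatio_of_tendsto ?_ (d.tendsto_inv_inPt ha hb)
        (fun h => h1 (d.rlam_of_inPt_eq h).symm) (fun h => h2 (d.rlam_of_inPt_eq h).symm)
      filter_upwards [Ioo_mem_nhdsGT (div_pos Real.pi_pos hν)] with η hη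
      exact d.mem_slit_of_neg hη.1 hη.2
    have hdiv : Tendsto (fun η : ℝ => η / d.ν) (𝓝[>] 0) (𝓝[>] 0) := by
      refine tendsto_nhdsWithin_iff.2 ⟨?_, ?_⟩
      · have : Continuous fun η : ℝ => η / d.ν := by fun_prop
        simpa using (this.tendsto 0).mono_left nhdsWithin_le_nhds
      · filter_upwards [self_mem_nhdsWithin] with η hη using div_pos hη hν
    have h3 := ((Complex.continuous_conj.tendsto _).comp
      ((key.comp hdiv).sub_const (Real.log (s₁ / s₂) : ℂ)))
    refine h3.congr fun η => ?_
    simp only [Function.comp]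
    congr 5
    simp
    ring
  · refine Eventually.of_forall fun τ => ?_
    have key := d.tendsto_im_logRatio_inv h2 h12 (F := 𝓝[>] 0)
      (w := fun η : ℝ => conj (τ + (Real.pi - η : ℝ) * Complex.I) / (d.ν : ℂ))
      (w₀ := conj (τ + Real.pi * Complex.I) / (d.ν : ℂ)) ?_ ?_ ?_ ?_
    · have := key.neg
      rw [neg_zero] at this
      refine this.congr fun η => ?_
      rw [Complex.conj_im, Complex.sub_im, Complex.ofReal_im, sub_zero]
    · filter_upwards [Ioo_mem_nhdsGT Real.pi_pos] with η hη
      exact d.conj_div_mem_slit (mem_strip (by linarith [hη.2]) (by linarith [hη.1]))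
    · have : Continuous fun η : ℝ => conj ((τ : ℂ) + (Real.pi - η : ℝ) * Complex.I) / (d.ν : ℂ) := by
        have := Complex.continuous_conj
        fun_prop
      simpa using (this.tendsto 0).mono_left nhdsWithin_le_nhds
    · intro h
      have := h.1
      simp [Complex.div_ofReal_im, neg_div] at this
    · simp [Complex.div_ofReal_im, Real.pi_ne_zero, hν.ne']

lemma im_logRatio_nonneg (h12 : s₂ < s₁) {z : ℂ} (h : 0 ≤ z.im) : 0 ≤ (logRatio s₁ s₂ z).im := by
  rcases h.lt_or_eq with h | h
  · exact (im_logRatio_pos h12 h).le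
  · obtain ⟨t, rfl⟩ : ∃ t : ℝ, z = t := ⟨z.re, Complex.ext (by simp) (by simp [← h])⟩
    rcases lt_or_ge t s₂ with h1 | h1
    · rw [im_logRatio_of_lt h12 h1]
    · rcases lt_or_ge t s₁ with h2 | h2
      · rw [im_logRatio_of_mem h1 h2]; exact Real.pi_pos.le
      · rw [im_logRatio_of_gt h12 h2]

/-- Where the map is small with positive imaginary part of its logarithm, the point is close to the
zero `s0`. -/
lemma exists_norm_sub_s0_lt {δ : ℝ} (hδ : 0 < δ) : ∃ T : ℝ, ∀ s : ℂ, 0 < s.im →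
    0 < (d.lam s).im → (d.lam s).re < T → ‖s - d.s0‖ < δ := by
  have hν := d.ν_pos
  have hc := d.c₁_pos
  obtain ⟨ε, hε, hεs⟩ : ∃ ε > 0, ∀ s : ℂ, 0 < s.im → 0 < (d.lam s).im → δ ≤ ‖s - d.s0‖ →
      ε ≤ ‖s + 1‖ := by
    rcases d.c₁_le.lt_or_eq with h | h
    · obtain ⟨ε, hε, h1⟩ := d.exists_im_lam_neg_near_neg_one h
      refine ⟨ε, hε, fun s hs him _ => ?_⟩
      by_contra! hlt
      linarith [h1 s hs hlt]
    · refine ⟨δ, hδ, fun s _ _ hs => ?_⟩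
      have : d.s0 = -1 := by rw [s0, ← h, neg_div, div_self hc.ne']
      simpa [this] using hs
  have hM : 0 < (d.c₁ * δ) ^ d.ν * (ε / (1 + ε)) := by positivity
  refine ⟨Real.log ((d.c₁ * δ) ^ d.ν * (ε / (1 + ε))) / d.ν, fun s hs him hre => ?_⟩
  by_contra! hge
  have h1 := d.exp_re_lam_mul (d.reg_of_im_pos hs)
  have hn : 0 < ‖s‖ := norm_pos_iff.2 (ne_zero_of_im_pos hs)
  have h2 : Real.exp (d.ν * (d.lam s).re) < (d.c₁ * δ) ^ d.ν * (ε / (1 + ε)) := by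
    rw [← Real.lt_log_iff_exp_lt hM]
    rw [lt_div_iff₀ hν] at hre
    linarith
  have h3 : (d.c₁ * δ) ^ d.ν ≤ ‖(d.c₁ : ℂ) * s + d.c₀‖ ^ d.ν := by
    refine Real.rpow_le_rpow (by positivity) ?_ hν.le
    have : (d.c₁ : ℂ) * s + d.c₀ = d.c₁ * (s - d.s0) := by
      have hc' : (d.c₁ : ℂ) ≠ 0 := by exact_mod_cast hc.ne'
      rw [s0]
      push_cast
      field_simp
      ring
    rw [this, norm_mul, Complex.norm_of_nonneg hc.le]
    gcongr
  have h4 : ε / (1 + ε) * ‖s‖ ≤ ‖s + 1‖ := by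
    have h5 := hεs s hs him hge
    have h6 : ‖s‖ ≤ ‖s + 1‖ + 1 := by
      have := norm_sub_le (s + 1) 1
      simpa using this
    rw [div_mul_eq_mul_div, div_le_iff₀ (by positivity)]
    nlinarith
  have h5 : (d.c₁ * δ) ^ d.ν * (ε / (1 + ε) * ‖s‖) ≤ ‖(d.c₁ : ℂ) * s + d.c₀‖ ^ d.ν * ‖s + 1‖ := by
    gcongr
  rw [← h1, ← mul_assoc] at h5
  have := mul_lt_mul_of_pos_right h2 hn
  linarith

lemma logRatio_s0 (h2 : 0 < s₂) (h12 : s₂ < s₁) :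
    logRatio s₁ s₂ (d.s0 : ℂ) = (Real.log ((s₁ - d.s0) / (s₂ - d.s0)) : ℝ) := by
  have h0 := d.s0_le_neg_one
  apply Complex.ext
  · rw [re_logRatio_ofReal, Complex.ofReal_re, Real.log_div (by linarith) (by linarith),
      ← Real.log_neg_eq_log, ← Real.log_neg_eq_log (d.s0 - s₂), neg_sub, neg_sub]
  · rw [im_logRatio_of_lt h12 (by linarith), Complex.ofReal_im]

/-- The total mass of the outer boundary values. -/
theorem integral_im_logRatio_outPt (h2 : 0 < s₂) (h12 : s₂ < s₁) :
    Integrable (fun τ => (logRatio s₁ s₂ (d.outPt τ)).im) ∧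
    ∫ τ, (logRatio s₁ s₂ (d.outPt τ)).im = Real.pi * Real.log ((s₁ - d.s0) / (s₂ - d.s0)) := by
  obtain ⟨C, hC, h⟩ := d.stripFun_out h2 h12
  have h0 := d.s0_le_neg_one
  refine h.integral_im hC.le (fun ε hε => ?_)
    (fun τ => im_logRatio_nonneg h12 (d.im_outPt_nonneg τ))
  have hc := continuousWithinAt_logRatio (s₁ := s₁) (s₂ := s₂) (s := d.s0)
    (by norm_cast; linarith) (by norm_cast; linarith)
  rw [Metric.continuousWithinAt_iff] at hc
  obtain ⟨δ, hδ, hs⟩ := hc ε hε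
  obtain ⟨T, hT⟩ := d.exists_norm_sub_s0_lt hδ
  refine ⟨T, fun w hw hre => ?_⟩
  have hsl := d.strip_subset_slit hw
  have h1 := d.inv_im_pos hsl
  have := hs (x := d.inv w) h1.le (by
    rw [dist_eq_norm]
    exact hT _ h1 (by rw [d.lam_inv hsl]; exact hw.1) (by rwa [d.lam_inv hsl]))
  rwa [dist_eq_norm, d.logRatio_s0 h2 h12] at this

theorem integral_log_outPt (h2 : 0 < s₂) (h12 : s₂ < s₁) (u : ℝ) :
    IntegrableOn (fun τ => (logRatio s₁ s₂ (d.outPt τ)).re) (Ioi u) ∧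
    Integrable (fun τ => (logRatio s₁ s₂ (d.outPt τ)).im * Real.log |1 - Real.exp (τ - u)|) ∧
    ∫ τ, (logRatio s₁ s₂ (d.outPt τ)).im * Real.log |1 - Real.exp (τ - u)| =
      Real.pi * ∫ τ in Ioi u, (logRatio s₁ s₂ (d.outPt τ)).re := by
  obtain ⟨C, hC, h⟩ := d.stripFun_out h2 h12
  exact ⟨(h.integrableOn_boundary hC.le u).re, h.integral_log hC.le u⟩

theorem integral_log_inPt (h2 : 0 < s₂) (h12 : s₂ < s₁) (u : ℝ) :
    IntegrableOn (fun τ => (logRatio s₁ s₂ (d.inPt τ)).re - Real.log (s₁ / s₂)) (Ioi u) ∧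
    Integrable (fun τ => (logRatio s₁ s₂ (d.inPt τ)).im *
      Real.log |1 - Real.exp (d.ν * (τ - u))|) ∧
    ∫ τ, (logRatio s₁ s₂ (d.inPt τ)).im * Real.log |1 - Real.exp (d.ν * (τ - u))| =
      -Real.pi * ∫ τ in Ioi u, ((logRatio s₁ s₂ (d.inPt τ)).re - Real.log (s₁ / s₂)) := by
  obtain ⟨C, hC, h⟩ := d.stripFun_in h2 h12
  have hν := d.ν_pos
  obtain ⟨h3, h4⟩ := h.integral_log hC.le (d.ν * u)
  have h5 := (h.integrableOn_boundary hC.le (d.ν * u)).re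
  simp only [Complex.conj_im, Complex.sub_im, Complex.ofReal_im, sub_zero, Complex.conj_re,
    Complex.sub_re, Complex.ofReal_re] at h3 h4 h5
  have h5' : IntegrableOn (fun τ => (logRatio s₁ s₂ (d.inPt (τ / d.ν))).re - Real.log (s₁ / s₂))
    (Ioi (d.ν * u)) := h5
  refine ⟨?_, ?_, ?_⟩
  · have := (integrableOn_Ioi_comp_mul_left_iff
      (fun τ => (logRatio s₁ s₂ (d.inPt (τ / d.ν))).re - Real.log (s₁ / s₂)) u hν).2 h5'
    simpa only [mul_div_cancel_left₀ _ hν.ne'] using this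
  · have := (h3.comp_mul_left' hν.ne').neg
    refine this.congr (Eventually.of_forall fun τ => ?_)
    simp only [Pi.neg_apply, mul_div_cancel_left₀ _ hν.ne', mul_sub]
    ring
  · have e1 := Measure.integral_comp_mul_left (fun τ => -(logRatio s₁ s₂ (d.inPt (τ / d.ν))).im *
      Real.log |1 - Real.exp (τ - d.ν * u)|) d.ν
    have e2 := integral_comp_mul_left_Ioi
      (fun τ => (logRatio s₁ s₂ (d.inPt (τ / d.ν))).re - Real.log (s₁ / s₂)) u hν
    simp only [mul_div_cancel_left₀ _ hν.ne'] at e1 e2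
    rw [h4, abs_of_pos (inv_pos.2 hν)] at e1
    rw [e2]
    simp only [smul_eq_mul, neg_mul, integral_neg, ← mul_sub] at e1 ⊢
    rw [← mul_assoc, mul_comm (d.ν⁻¹) Real.pi, mul_assoc] at e1
    linarith

end ConfMap

namespace Params

/-- The logarithm of `J s₁`. -/
def l₁ (p : Params) : ModelProblem → ℝ
  | .nu => p.ρ * p.β * p.n₁
  | .one => p.ρ * p.β * p.n₂

/-- The logarithm of `J s₂`. -/
def l₂ (p : Params) : ModelProblem → ℝ
  | .nu => p.ρ * p.β * p.n₂
  | .one => p.ρ * p.β * p.n₁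

/-- The mass of the charges in the outer equation, up to the factor `β ρ κ`. -/
def chargeMass (p : Params) : ModelProblem → ℝ
  | .nu => 0
  | .one => p.ρ * p.β * p.n₂ - p.ρ * p.β * p.n₁

namespace Admissible

variable {p : Params} {M : ModelProblem} (hp : p.Admissible M)
include hp

lemma ν_pos : 0 < p.ν := zero_lt_one.trans hp.one_lt_ν

lemma δ_pos : 0 < p.β * p.ρ * p.κ := mul_pos (mul_pos hp.β_pos hp.ρ_pos) hp.κ_pos

lemma potExp_pos : 0 < p.potExp M := by
  cases M
  · exact hp.ν_pos
  · exact one_pos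

lemma log_A : Real.log (p.A M) = p.β * p.ρ * p.κ * (p.ν + 1 + p.m₁) +
    p.potExp M * (p.ρ * p.β * p.n₂ - p.ρ * p.β * p.n₁) := by
  have hν := hp.ν_pos
  have hκ := hp.κ_pos
  have hα := hp.α_eq
  cases M
  · simp only [Params.potExp] at hα
    simp only [Params.A, Params.potExp, Real.log_exp, hα]
    field_simp
  · simp only [Params.potExp] at hα
    simp only [Params.A, Params.potExp, Real.log_exp, hα]
    field_simp

lemma one_lt_B : 1 < p.B M := by
  have hν := hp.ν_pos
  have hκ := hp.κ_pos
  have hβ := hp.β_pos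
  have hρ := hp.ρ_pos
  have hα := hp.α_eq
  have hm := hp.m₁_nonneg
  have hn : 0 ≤ p.n₂ - p.n₁ := sub_nonneg.2 hp.n₁_le_n₂
  cases M
  · simp only [Params.potExp] at hα
    simp only [Params.B, hα]
    exact Real.one_lt_exp_iff.2 (by positivity)
  · simp only [Params.potExp] at hα
    simp only [Params.B, hα]
    exact Real.one_lt_exp_iff.2 (by positivity)

lemma B_lt_A : p.B M < p.A M := by
  have hν := hp.ν_pos
  have hκ := hp.κ_pos
  have hβ := hp.β_pos
  have hρ := hp.ρ_pos
  have hα := hp.α_eq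
  have hn : 0 ≤ p.n₂ - p.n₁ := sub_nonneg.2 hp.n₁_le_n₂
  cases M
  · simp only [Params.potExp] at hα
    simp only [Params.A, Params.B, hα]
    refine Real.exp_lt_exp.2 (mul_lt_mul_of_pos_left ?_ (by positivity))
    have : 0 ≤ p.ν / p.κ * (p.n₂ - p.n₁) := by positivity
    linarith
  · simp only [Params.potExp] at hα
    simp only [Params.A, Params.B, hα]
    refine Real.exp_lt_exp.2 (mul_lt_mul_of_pos_left ?_ (by positivity))
    have : 1 / p.κ * (p.n₂ - p.n₁) = (p.n₂ - p.n₁) / p.κ := by ring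
    linarith

lemma s₂_pos : 0 < p.s₂ M := div_pos (by linarith [hp.one_lt_B]) (by linarith [hp.B_lt_A])

omit hp in
lemma s₁_eq : p.s₁ M = p.A M * p.s₂ M := rfl

lemma s₂_lt_s₁ : p.s₂ M < p.s₁ M := by
  rw [s₁_eq]
  have h1 := hp.one_lt_B
  have h2 := hp.B_lt_A
  have h3 := hp.s₂_pos
  nlinarith

lemma s₁_pos : 0 < p.s₁ M := hp.s₂_pos.trans hp.s₂_lt_s₁

lemma s₁_div_s₂ : p.s₁ M / p.s₂ M = p.A M := by
  rw [s₁_eq, mul_div_cancel_right₀ _ hp.s₂_pos.ne']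

lemma s₁_quot : (p.s₁ M + 1) / p.s₁ M = (p.A M * (p.B M - 1) / (p.B M * (p.A M - 1)))⁻¹ := by
  have h1 := hp.one_lt_B
  have h2 := hp.B_lt_A
  have e1 : p.A M - p.B M ≠ 0 := by linarith
  have e2 : p.B M - 1 ≠ 0 := by linarith
  have e3 : p.A M - 1 ≠ 0 := by linarith
  have e4 : p.A M ≠ 0 := by linarith
  have e5 : p.B M ≠ 0 := by linarith
  rw [Params.s₁]
  field_simp
  ring

lemma s₂_quot : (p.s₂ M + 1) / p.s₂ M = ((p.B M - 1) / (p.A M - 1))⁻¹ := by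
  have h1 := hp.one_lt_B
  have h2 := hp.B_lt_A
  have e1 : p.A M - p.B M ≠ 0 := by linarith
  have e2 : p.B M - 1 ≠ 0 := by linarith
  have e3 : p.A M - 1 ≠ 0 := by linarith
  rw [Params.s₂]
  field_simp
  ring

lemma K₁_factor_pos : 0 < p.A M * (p.B M - 1) / (p.B M * (p.A M - 1)) := by
  have h1 := hp.one_lt_B
  have h2 := hp.B_lt_A
  refine div_pos (mul_pos ?_ ?_) (mul_pos ?_ ?_) <;> linarith

lemma K₂_factor_pos : 0 < (p.B M - 1) / (p.A M - 1) := by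
  have h1 := hp.one_lt_B
  have h2 := hp.B_lt_A
  refine div_pos ?_ ?_ <;> linarith

lemma K₁_pos : 0 < p.K₁ M := by
  have := hp.K₁_factor_pos
  cases M <;> simp only [Params.K₁] <;> positivity

lemma K₂_pos : 0 < p.K₂ M := by
  have := hp.K₂_factor_pos
  cases M <;> simp only [Params.K₂] <;> positivity

lemma log_K₁ : Real.log (p.K₁ M) =
    p.l₁ M + 1 / p.ν * Real.log (p.A M * (p.B M - 1) / (p.B M * (p.A M - 1))) := by
  have hν := hp.ν_pos
  have h := hp.K₁_factor_pos
  have hα := hp.α_eq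
  cases M
  · simp only [Params.K₁, Params.l₁]
    rw [Real.log_rpow (by positivity), Real.log_mul (Real.exp_pos _).ne' h.ne', Real.log_exp, hα]
    simp only [Params.potExp]
    field_simp
  · simp only [Params.K₁, Params.l₁]
    rw [Real.log_mul (Real.exp_pos _).ne' (by positivity), Real.log_rpow h, Real.log_exp, hα]
    simp only [Params.potExp]
    ring

lemma log_K₂ : Real.log (p.K₂ M) =
    p.l₂ M + 1 / p.ν * Real.log ((p.B M - 1) / (p.A M - 1)) := by
  have hν := hp.ν_pos
  have h := hp.K₂_factor_pos
  have hα := hp.α_eq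
  cases M
  · simp only [Params.K₂, Params.l₂]
    rw [Real.log_rpow (by positivity), Real.log_mul (Real.exp_pos _).ne' h.ne', Real.log_exp, hα]
    simp only [Params.potExp]
    field_simp
  · simp only [Params.K₂, Params.l₂]
    rw [Real.log_mul (Real.exp_pos _).ne' (by positivity), Real.log_rpow h, Real.log_exp, hα]
    simp only [Params.potExp]
    ring

lemma log_A_sub_log_B : Real.log (p.A M) - Real.log (p.B M) =
    p.ν * (p.β * p.ρ * p.κ) + (p.potExp M - 1) * p.ν / (p.ν - 1) *
      (p.ρ * p.β * p.n₂ - p.ρ * p.β * p.n₁) := by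
  have hν := hp.ν_pos
  have hν1 : p.ν - 1 ≠ 0 := by linarith [hp.one_lt_ν]
  have hκ := hp.κ_pos
  have hα := hp.α_eq
  rw [hp.log_A]
  cases M
  · simp only [Params.potExp] at hα
    simp only [Params.B, Params.potExp, Real.log_exp, hα]
    field_simp
    ring
  · simp only [Params.potExp] at hα
    simp only [Params.B, Params.potExp, Real.log_exp, hα]
    field_simp
    ring

/-- The logarithm of `K₁ / K₂`: the total mass `1`, plus that of the charges `λ`
in the second model problem. -/
lemma log_K₁_sub_log_K₂ : Real.log (p.K₁ M) - Real.log (p.K₂ M) =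
    p.β * p.ρ * p.κ + p.chargeMass M := by
  have hν := hp.ν_pos
  have h1 := hp.one_lt_B
  have h2 := hp.B_lt_A
  have hAB := hp.log_A_sub_log_B
  have hν1 : p.ν - 1 ≠ 0 := by linarith [hp.one_lt_ν]
  rw [hp.log_K₁, hp.log_K₂]
  have e : Real.log (p.A M * (p.B M - 1) / (p.B M * (p.A M - 1))) =
      Real.log (p.A M) - Real.log (p.B M) + Real.log ((p.B M - 1) / (p.A M - 1)) := by
    rw [Real.log_div (by apply ne_of_gt; apply mul_pos <;> linarith)
      (by apply ne_of_gt; apply mul_pos <;> linarith), Real.log_div (by linarith) (by linarith),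
      Real.log_mul (by linarith) (by linarith), Real.log_mul (by linarith) (by linarith)]
    ring
  rw [e, hAB]
  cases M
  · simp only [Params.l₁, Params.l₂, Params.potExp, Params.chargeMass]
    field_simp
    ring
  · simp only [Params.l₁, Params.l₂, Params.potExp, Params.chargeMass]
    field_simp
    ring

lemma K₂_lt_K₁ : p.K₂ M < p.K₁ M := by
  rw [← Real.log_lt_log_iff hp.K₂_pos hp.K₁_pos, ← sub_pos, hp.log_K₁_sub_log_K₂]
  have hδ := hp.δ_pos
  have hβ := hp.β_pos
  have hρ := hp.ρ_pos
  have hn : p.ρ * p.β * p.n₁ ≤ p.ρ * p.β * p.n₂ := by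
    have := hp.n₁_le_n₂
    gcongr
  cases M
  · simpa [Params.chargeMass] using hδ
  · simp only [Params.chargeMass]
    linarith

lemma K₁_le : p.K₁ M ≤ p.B M * p.K₂ M := by
  have hB : 0 < p.B M := by linarith [hp.one_lt_B]
  rw [← Real.log_le_log_iff hp.K₁_pos (mul_pos hB hp.K₂_pos), Real.log_mul hB.ne' hp.K₂_pos.ne',
    ← sub_le_iff_le_add, hp.log_K₁_sub_log_K₂]
  have hν := hp.ν_pos
  have hδ := hp.δ_pos
  have hκ := hp.κ_pos
  have hα := hp.α_eq
  have hm := hp.m₁_nonneg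
  have : 0 ≤ p.β * p.ρ * p.κ * p.m₁ := by positivity
  cases M
  · simp only [Params.potExp] at hα
    simp only [Params.B, Real.log_exp, hα, Params.chargeMass]
    have : p.ν * p.ρ * p.β * p.κ / p.ν * (1 + p.m₁) =
      p.β * p.ρ * p.κ + p.β * p.ρ * p.κ * p.m₁ := by field_simp
    linarith
  · simp only [Params.potExp] at hα
    simp only [Params.B, Real.log_exp, hα, Params.chargeMass]
    have : 1 * p.ρ * p.β * p.κ * (1 + p.m₁ + (p.n₂ - p.n₁) / p.κ) =
      p.β * p.ρ * p.κ + p.β * p.ρ * p.κ * p.m₁ + p.ρ * p.β * (p.n₂ - p.n₁) := by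
        field_simp
    linarith

lemma c₁_pos : 0 < p.c₁ M :=
  div_pos (sub_pos.2 hp.K₂_lt_K₁) (sub_pos.2 hp.s₂_lt_s₁)

lemma c₁_le_c₀ : p.c₁ M ≤ p.c₀ M := by
  have h1 := hp.one_lt_B
  have h2 := hp.B_lt_A
  have h3 := hp.s₂_lt_s₁
  have e1 : p.A M - p.B M ≠ 0 := by linarith
  refine div_le_div_of_nonneg_right ?_ (by linarith)
  have e2 : p.s₁ M + 1 = p.B M * (p.s₂ M + 1) := by
    rw [Params.s₁, Params.s₂]
    field_simp
    ring
  have := mul_le_mul_of_nonneg_right hp.K₁_le (by linarith [hp.s₂_pos] : 0 ≤ p.s₂ M + 1)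
  have e3 : p.K₂ M * (p.s₁ M + 1) = p.K₂ M * (p.B M * (p.s₂ M + 1)) := by rw [e2]
  linarith

lemma affine_s₁ : p.c₁ M * p.s₁ M + p.c₀ M = p.K₁ M := by
  have e : p.s₁ M - p.s₂ M ≠ 0 := by linarith [hp.s₂_lt_s₁]
  rw [Params.c₁, Params.c₀]
  field_simp
  ring

lemma affine_s₂ : p.c₁ M * p.s₂ M + p.c₀ M = p.K₂ M := by
  have e : p.s₁ M - p.s₂ M ≠ 0 := by linarith [hp.s₂_lt_s₁]
  rw [Params.c₁, Params.c₀]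
  field_simp
  ring

/-- The map `J` of the model problem. -/
def confMap : ConfMap where
  ν := p.ν
  c₀ := p.c₀ M
  c₁ := p.c₁ M
  one_lt := hp.one_lt_ν
  c₁_pos := hp.c₁_pos
  c₁_le := hp.c₁_le_c₀

lemma confMap_sa : hp.confMap.sa = p.sa M := rfl

lemma confMap_sb : hp.confMap.sb = p.sb M := rfl

lemma rlam_s₁ : hp.confMap.rlam (p.s₁ M) = p.l₁ M := by
  have h := hp.s₁_pos
  change Real.log (p.c₁ M * p.s₁ M + p.c₀ M) +
    1 / p.ν * (Real.log (p.s₁ M + 1) - Real.log (p.s₁ M)) = _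
  rw [hp.affine_s₁, hp.log_K₁, ← Real.log_div (by linarith) h.ne', hp.s₁_quot, Real.log_inv]
  ring

lemma rlam_s₂ : hp.confMap.rlam (p.s₂ M) = p.l₂ M := by
  have h := hp.s₂_pos
  change Real.log (p.c₁ M * p.s₂ M + p.c₀ M) +
    1 / p.ν * (Real.log (p.s₂ M + 1) - Real.log (p.s₂ M)) = _
  rw [hp.affine_s₂, hp.log_K₂, ← Real.log_div (by linarith) h.ne', hp.s₂_quot, Real.log_inv]
  ring

lemma log_s0_quot : Real.log ((p.s₁ M - hp.confMap.s0) / (p.s₂ M - hp.confMap.s0)) =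
    Real.log (p.K₁ M) - Real.log (p.K₂ M) := by
  have hc := hp.c₁_pos
  rw [← Real.log_div hp.K₁_pos.ne' hp.K₂_pos.ne', ← hp.affine_s₁, ← hp.affine_s₂]
  have h1 := hp.confMap.affine_eq (p.s₁ M)
  have h2 := hp.confMap.affine_eq (p.s₂ M)
  change p.c₁ M * p.s₁ M + p.c₀ M = p.c₁ M * _ at h1
  change p.c₁ M * p.s₂ M + p.c₀ M = p.c₁ M * _ at h2
  rw [h1, h2, mul_div_mul_left _ _ hc.ne']

lemma J_eq_exp {s : ℂ} (hs : 0 < s.im) : p.J M s = Complex.exp (hp.confMap.lam s) := by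
  have h1 := hp.confMap.reg_of_im_pos hs
  have h2 := log_div_of_im_nonneg (z := s + 1) (w := s) h1.2.1 h1.1 (by simpa using hs.le) hs.le
    (fun h => (arg_lt_pi_of_im_pos hs).ne h.2)
  rw [Params.J, Complex.cpow_def_of_ne_zero (div_ne_zero h1.2.1 h1.1), h2, ConfMap.lam,
    Complex.exp_add, Complex.exp_log h1.2.2, mul_comm (((1 / _ : ℝ)) : ℂ)]
  rfl

omit hp in
lemma J_ofReal {t : ℝ} (h : 0 ≤ (t + 1) / t) :
    p.J M t = (((p.c₁ M * t + p.c₀ M) * ((t + 1) / t) ^ (1 / p.ν) : ℝ) : ℂ) := by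
  rw [Params.J]
  push_cast
  rw [Complex.ofReal_cpow h]
  push_cast
  rfl

lemma a_eq : p.a M = hp.confMap.a := by
  have h := hp.confMap.sa_le_neg_one
  rw [Params.a, ← hp.confMap_sa, J_ofReal
    (div_nonneg_of_nonpos (by linarith) (by linarith)), Complex.ofReal_re]
  rfl

lemma b_eq : p.b M = hp.confMap.b := by
  have h := hp.confMap.sb_pos
  have h1 : 0 < hp.confMap.sb + 1 := by linarith
  have h2 : 0 < p.c₁ M * hp.confMap.sb + p.c₀ M :=
    add_pos (mul_pos hp.c₁_pos h) (hp.c₁_pos.trans_le hp.c₁_le_c₀)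
  rw [Params.b, ← hp.confMap_sb, J_ofReal (by positivity), Complex.ofReal_re, ConfMap.b]
  change _ = Real.exp (Real.log (p.c₁ M * _ + p.c₀ M) +
    1 / p.ν * (Real.log (_ + 1) - Real.log _))
  rw [Real.exp_add, Real.exp_log h2, ← Real.log_div h1.ne' h.ne', Real.rpow_def_of_pos
    (by positivity), mul_comm (1 / p.ν)]

lemma im_lam_eq_zero {s : ℂ} (hs : s ∈ p.sigmaPlus M) : (hp.confMap.lam s).im = 0 := by
  obtain ⟨h1, h2⟩ := hs
  rw [hp.J_eq_exp h1, Complex.exp_im] at h2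
  have h3 := (mul_eq_zero.1 h2).resolve_left (Real.exp_pos _).ne'
  have h4 := hp.confMap.im_lam_lt h1
  have h5 := hp.confMap.lt_im_lam h1
  have h6 : Real.pi / hp.confMap.ν < Real.pi :=
    div_lt_self Real.pi_pos hp.confMap.one_lt
  exact (Real.sin_eq_zero_iff_of_lt_of_lt (by linarith) h4).1 h3

lemma J_sigmaPlus {s : ℂ} (hs : s ∈ p.sigmaPlus M) :
    p.J M s = (Real.exp (hp.confMap.lam s).re : ℝ) := by
  rw [hp.J_eq_exp hs.1, Complex.ofReal_exp]
  congr 1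
  exact Complex.ext (by simp) (by simp [hp.im_lam_eq_zero hs])

lemma inv_log_mem {x : ℝ} (hx : x ∈ Ioo (p.a M) (p.b M)) :
    ((Real.log x : ℝ) : ℂ) ∈ hp.confMap.slit := by
  have h0 : 0 < x := by
    have := hp.confMap.a_nonneg
    rw [← hp.a_eq] at this
    exact this.trans_lt hx.1
  refine hp.confMap.ofReal_mem_slit ?_ ?_ <;> rw [Real.exp_log h0]
  · rw [← hp.a_eq]; exact hx.1
  · rw [← hp.b_eq]; exact hx.2

lemma J_inv_log {x : ℝ} (hx : x ∈ Ioo (p.a M) (p.b M)) :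
    hp.confMap.inv (Real.log x : ℝ) ∈ p.sigmaPlus M ∧
      p.J M (hp.confMap.inv (Real.log x : ℝ)) = x := by
  have h0 : 0 < x := by
    have := hp.confMap.a_nonneg
    rw [← hp.a_eq] at this
    exact this.trans_lt hx.1
  have h1 := hp.inv_log_mem hx
  have h2 := hp.confMap.inv_im_pos h1
  have h3 : p.J M (hp.confMap.inv (Real.log x : ℝ)) = x := by
    rw [hp.J_eq_exp h2, hp.confMap.lam_inv h1, ← Complex.ofReal_exp, Real.exp_log h0]
  exact ⟨⟨h2, by rw [h3, Complex.ofReal_im]⟩, h3⟩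

theorem bijOn_J : BijOn (p.J M) (p.sigmaPlus M) ((fun x : ℝ => (x : ℂ)) '' Ioo (p.a M) (p.b M)) := by
  refine ⟨fun s hs => ?_, fun s hs t ht h => ?_, ?_⟩
  · rw [hp.J_sigmaPlus hs, hp.a_eq, hp.b_eq]
    exact ⟨_, (hp.confMap.lam_mem_slit hs.1).2.2 (hp.im_lam_eq_zero hs), rfl⟩
  · rw [hp.J_sigmaPlus hs, hp.J_sigmaPlus ht] at h
    refine hp.confMap.lam_injOn hs.1 ht.1 (Complex.ext ?_ ?_)
    · exact Real.exp_injective (Complex.ofReal_injective h)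
    · rw [hp.im_lam_eq_zero hs, hp.im_lam_eq_zero ht]
  · rintro _ ⟨x, hx, rfl⟩
    exact ⟨_, (hp.J_inv_log hx).1, (hp.J_inv_log hx).2⟩

lemma Iplus_eq {x : ℝ} (hx : x ∈ Ioo (p.a M) (p.b M)) :
    p.Iplus M x = hp.confMap.inv (Real.log x : ℝ) := by
  have h : (x : ℂ) ∈ p.J M '' p.sigmaPlus M := ⟨_, (hp.J_inv_log hx).1, (hp.J_inv_log hx).2⟩
  exact hp.bijOn_J.injOn (Function.invFunOn_mem h) (hp.J_inv_log hx).1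
    ((Function.invFunOn_eq h).trans (hp.J_inv_log hx).2.symm)

lemma bandDensity_eq {x : ℝ} (hx : x ∈ Ioo (p.a M) (p.b M)) : p.bandDensity M x =
    1 / (Real.pi * p.β * p.ρ * p.κ * x) *
      (logRatio (p.s₁ M) (p.s₂ M) (hp.confMap.inv (Real.log x : ℝ))).im := by
  rw [Params.bandDensity, hp.Iplus_eq hx, im_logRatio (hp.confMap.inv_im_pos (hp.inv_log_mem hx))]

theorem bandDensity_mem {x : ℝ} (hx : x ∈ Ioo (p.a M) (p.b M)) :
    0 < p.bandDensity M x ∧ p.bandDensity M x < p.upper x := by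
  have h0 : 0 < x := by
    have := hp.confMap.a_nonneg
    rw [← hp.a_eq] at this
    exact this.trans_lt hx.1
  have hs := hp.confMap.inv_im_pos (hp.inv_log_mem hx)
  have h1 := im_logRatio_pos hp.s₂_lt_s₁ hs
  have h2 := im_logRatio_lt_pi (s₁ := p.s₁ M) (s₂ := p.s₂ M) hs
  have hβ := hp.β_pos
  have hρ := hp.ρ_pos
  have hκ := hp.κ_pos
  have hπ := Real.pi_pos
  rw [hp.bandDensity_eq hx]
  refine ⟨by positivity, ?_⟩
  have : p.upper x = 1 / (Real.pi * p.β * p.ρ * p.κ * x) * Real.pi := by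
    rw [Params.upper]
    field_simp
  rw [this]
  exact mul_lt_mul_of_pos_left h2 (by positivity)

end Admissible

end Params

/-! ### Comparison of the boundary values -/

section

variable {s₁ s₂ t t' : ℝ}

lemma re_logRatio_le_of_lt (h12 : s₂ < s₁) (h : t ≤ t') (h' : t' < s₂) :
    (logRatio s₁ s₂ t).re ≤ (logRatio s₁ s₂ t').re := by
  rw [re_logRatio_ofReal, re_logRatio_ofReal, ← Real.log_neg_eq_log (t - s₁),
    ← Real.log_neg_eq_log (t - s₂), ← Real.log_neg_eq_log (t' - s₁),
    ← Real.log_neg_eq_log (t' - s₂), sub_le_iff_le_add, sub_add_eq_add_sub, le_sub_iff_add_le,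
    ← Real.log_mul (by linarith) (by linarith), ← Real.log_mul (by linarith) (by linarith)]
  refine Real.log_le_log (mul_pos (by linarith) (by linarith)) ?_
  nlinarith

lemma re_logRatio_le_of_gt (h12 : s₂ < s₁) (h : t ≤ t') (h' : s₁ < t) :
    (logRatio s₁ s₂ t).re ≤ (logRatio s₁ s₂ t').re := by
  rw [re_logRatio_ofReal, re_logRatio_ofReal, sub_le_iff_le_add, sub_add_eq_add_sub,
    le_sub_iff_add_le,
    ← Real.log_mul (by linarith) (by linarith), ← Real.log_mul (by linarith) (by linarith)]
  refine Real.log_le_log (mul_pos (by linarith) (by linarith)) ?_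
  nlinarith

lemma re_logRatio_le_of_mem (h2 : s₂ < t) (h : t ≤ t') (h1 : t' < s₁) :
    (logRatio s₁ s₂ t').re ≤ (logRatio s₁ s₂ t).re := by
  rw [re_logRatio_ofReal, re_logRatio_ofReal, ← Real.log_neg_eq_log (t - s₁),
    ← Real.log_neg_eq_log (t' - s₁)]
  exact sub_le_sub (Real.log_le_log (by linarith) (by linarith))
    (Real.log_le_log (by linarith) (by linarith))

end

namespace ConfMap

variable (d : ConfMap) {s₁ s₂ : ℝ}

lemma lt_of_rlam_lt {t s : ℝ} (ht : d.sb ≤ t) (hs : d.sb ≤ s) (h : d.rlam t < d.rlam s) : t < s :=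
  (d.strictMonoOn_rlam.lt_iff_lt ht hs).1 h

lemma lt_of_rlam_lt_left {t s : ℝ} (ht0 : 0 < t) (ht : t ≤ d.sb) (hs0 : 0 < s) (hs : s ≤ d.sb)
    (h : d.rlam t < d.rlam s) : s < t :=
  (d.strictAntiOn_rlam.lt_iff_gt ⟨ht0, ht⟩ ⟨hs0, hs⟩).1 h

variable (s₁ s₂) in
/-- The potential of the boundary values, without the constant. -/
def pot (u : ℝ) : ℝ :=
  -(Real.pi * Real.log (s₁ / s₂) * u)
    - (∫ τ, (logRatio s₁ s₂ (d.outPt τ)).im * Real.log |1 - Real.exp (τ - u)|)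
    - ∫ τ, (logRatio s₁ s₂ (d.inPt τ)).im * Real.log |1 - Real.exp (d.ν * (τ - u))|

lemma pot_sub_pot (h2 : 0 < s₂) (h12 : s₂ < s₁) {u v : ℝ} (huv : u ≤ v) :
    d.pot s₁ s₂ v - d.pot s₁ s₂ u = Real.pi * ∫ τ in Ioc u v,
      ((logRatio s₁ s₂ (d.outPt τ)).re - (logRatio s₁ s₂ (d.inPt τ)).re) := by
  obtain ⟨o1, -, o2⟩ := d.integral_log_outPt h2 h12 u
  obtain ⟨-, -, o3⟩ := d.integral_log_outPt h2 h12 v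
  obtain ⟨i1, -, i2⟩ := d.integral_log_inPt h2 h12 u
  obtain ⟨-, -, i3⟩ := d.integral_log_inPt h2 h12 v
  have hsplit : ∀ f : ℝ → ℝ, IntegrableOn f (Ioi u) →
      ∫ τ in Ioi u, f τ = (∫ τ in Ioc u v, f τ) + ∫ τ in Ioi v, f τ := fun f hf => by
    rw [← Ioc_union_Ioi_eq_Ioi huv, setIntegral_union Ioc_disjoint_Ioi_same measurableSet_Ioi
      (hf.mono_set Ioc_subset_Ioi_self) (hf.mono_set (Ioi_subset_Ioi huv))]
  have hk : IntegrableOn (fun _ : ℝ => Real.log (s₁ / s₂)) (Ioc u v) :=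
    integrableOn_const (by simp)
  have e1 : ∫ τ in Ioc u v, ((logRatio s₁ s₂ (d.outPt τ)).re - (logRatio s₁ s₂ (d.inPt τ)).re) =
      (∫ τ in Ioc u v, (logRatio s₁ s₂ (d.outPt τ)).re) -
      (∫ τ in Ioc u v, ((logRatio s₁ s₂ (d.inPt τ)).re - Real.log (s₁ / s₂))) -
      Real.log (s₁ / s₂) * (v - u) := by
    have e2 : ∫ _ in Ioc u v, Real.log (s₁ / s₂) = Real.log (s₁ / s₂) * (v - u) := by
      simp [huv, mul_comm]
    rw [← e2, ← integral_sub (o1.mono_set Ioc_subset_Ioi_self) (i1.mono_set Ioc_subset_Ioi_self),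
      ← integral_sub (f := fun τ => (logRatio s₁ s₂ (d.outPt τ)).re -
        ((logRatio s₁ s₂ (d.inPt τ)).re - Real.log (s₁ / s₂)))
        ((o1.mono_set Ioc_subset_Ioi_self).sub (i1.mono_set Ioc_subset_Ioi_self)) hk]
    congr 1
    funext τ
    ring
  rw [e1, pot, pot, o2, o3, i2, i3, hsplit _ o1, hsplit _ i1]
  ring

lemma pot_le_pot (h2 : 0 < s₂) (h12 : s₂ < s₁) {u v : ℝ} (huv : u ≤ v)
    (h : ∀ᵐ τ, τ ∈ Ioo u v →
      (logRatio s₁ s₂ (d.outPt τ)).re ≤ (logRatio s₁ s₂ (d.inPt τ)).re) :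
    d.pot s₁ s₂ v ≤ d.pot s₁ s₂ u := by
  rw [← sub_nonpos, d.pot_sub_pot h2 h12 huv, integral_Ioc_eq_integral_Ioo]
  refine mul_nonpos_of_nonneg_of_nonpos Real.pi_pos.le
    (setIntegral_nonpos_ae measurableSet_Ioo ?_)
  filter_upwards [h] with τ hτ hm using sub_nonpos.2 (hτ hm)

lemma pot_ge_pot (h2 : 0 < s₂) (h12 : s₂ < s₁) {u v : ℝ} (huv : u ≤ v)
    (h : ∀ᵐ τ, τ ∈ Ioo u v →
      (logRatio s₁ s₂ (d.inPt τ)).re ≤ (logRatio s₁ s₂ (d.outPt τ)).re) :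
    d.pot s₁ s₂ u ≤ d.pot s₁ s₂ v := by
  rw [← sub_nonneg, d.pot_sub_pot h2 h12 huv, integral_Ioc_eq_integral_Ioo]
  refine mul_nonneg Real.pi_pos.le (setIntegral_nonneg_ae measurableSet_Ioo ?_)
  filter_upwards [h] with τ hτ hm using sub_nonneg.2 (hτ hm)

lemma re_outPt_le_left (h2 : 0 < s₂) (h12 : s₂ < s₁) {τ : ℝ} (h : Real.exp τ < d.b) :
    (logRatio s₁ s₂ (d.outPt τ)).re ≤ (logRatio s₁ s₂ (d.inPt τ)).re := by
  by_cases ha : d.a < Real.exp τ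
  · rw [d.outPt_band ha h, d.inPt_band ha h]
  · obtain ⟨t, -, h3, -, -, h4⟩ := d.outPt_left (not_lt.1 ha)
    obtain ⟨t', -, h5, h6, -, h7⟩ := d.inPt_left (not_lt.1 ha)
    rw [h4, h7]
    exact re_logRatio_le_of_lt h12 (h3.trans h5) (by linarith)

end ConfMap

namespace Params

/-- The density of the limit shape that is saturated on the set `S`. -/
def shapeDensity (p : Params) (M : ModelProblem) (S : Set ℝ) (x : ℝ) : ℝ :=
  (Ioo (p.a M) (p.b M)).indicator (p.bandDensity M) x + S.indicator p.upper x

/-- `S` is the saturated region of the limit shape. -/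
def IsSaturated (p : Params) (M : ModelProblem) (S : Set ℝ) : Prop :=
  p.Subcritical M ∧ S = ∅ ∨ p.Supercritical M ∧ S = Ioo (p.b M) p.xmax

/-- The charges that come from the potential, in the outer equation. -/
def chargeOut (p : Params) : ModelProblem → ℝ → ℝ
  | .nu => 0
  | .one => (Ioo (p.ρ * p.β * p.n₁) (p.ρ * p.β * p.n₂)).indicator 1

/-- The charges that come from the potential, in the inner equation. -/
def chargeIn (p : Params) : ModelProblem → ℝ → ℝ
  | .nu => (Ioo (p.ρ * p.β * p.n₁) (p.ρ * p.β * p.n₂)).indicator 1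
  | .one => 0

namespace Admissible

variable {p : Params} {M : ModelProblem} (hp : p.Admissible M)
include hp

lemma xmax_eq_exp : p.xmax = Real.exp (p.ρ * p.β * p.n₁) := by
  rw [Params.xmax, hp.n₁_eq]
  congr 1
  ring

lemma l_le : p.ρ * p.β * p.n₁ ≤ p.ρ * p.β * p.n₂ := by
  have hβ := hp.β_pos
  have hρ := hp.ρ_pos
  have := hp.n₁_le_n₂
  gcongr

lemma l_nonpos : p.ρ * p.β * p.n₁ ≤ 0 := by
  have hβ := hp.β_pos
  have hρ := hp.ρ_pos
  refine mul_nonpos_of_nonneg_of_nonpos (by positivity) ?_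
  rw [hp.n₁_eq]
  linarith [hp.κ_le]

lemma b_le_xmax : p.b M ≤ p.xmax := by
  rw [hp.b_eq, hp.xmax_eq_exp]
  cases M
  · have := hp.confMap.b_le_exp_rlam hp.s₁_pos
    rwa [hp.rlam_s₁] at this
  · have := hp.confMap.b_le_exp_rlam hp.s₂_pos
    rwa [hp.rlam_s₂] at this

lemma a_lt_b : p.a M < p.b M := by
  rw [hp.a_eq, hp.b_eq]
  exact hp.confMap.a_lt_b

lemma a_nonneg : 0 ≤ p.a M := by
  rw [hp.a_eq]
  exact hp.confMap.a_nonneg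

lemma b_pos : 0 < p.b M := hp.a_nonneg.trans_lt hp.a_lt_b

lemma supercritical_mem (h : p.Supercritical M) : p.s₂ M < p.sb M ∧ p.sb M < p.s₁ M := by
  have hl := hp.l_le
  have h12 := hp.s₂_lt_s₁
  have h1 := hp.rlam_s₁
  have h2 := hp.rlam_s₂
  cases M
  · refine ⟨?_, h⟩
    by_contra! hc
    have := hp.confMap.strictMonoOn_rlam hc (hc.trans h12.le) h12
    rw [h1, h2] at this
    exact absurd hl (not_le.2 this)
  · refine ⟨h, ?_⟩
    by_contra! hc
    have := hp.confMap.strictAntiOn_rlam ⟨hp.s₂_pos, h12.le.trans hc⟩ ⟨hp.s₁_pos, hc⟩ h12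
    rw [h1, h2] at this
    exact absurd hl (not_le.2 this)

lemma b_lt_xmax (h : p.Supercritical M) : p.b M < p.xmax := by
  obtain ⟨h2, h1⟩ := hp.supercritical_mem h
  have e1 := hp.rlam_s₁
  have e2 := hp.rlam_s₂
  rw [hp.b_eq, hp.xmax_eq_exp]
  cases M
  · have := hp.confMap.strictMonoOn_rlam (mem_Ici.2 le_rfl) h1.le h1
    rw [e1] at this
    exact Real.exp_lt_exp.2 this
  · have := hp.confMap.strictAntiOn_rlam ⟨hp.s₂_pos, h2.le⟩ ⟨hp.confMap.sb_pos, le_rfl⟩ h2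
    rw [e2] at this
    exact Real.exp_lt_exp.2 this

omit hp in
lemma subset_of_isSaturated {S : Set ℝ} (hS : p.IsSaturated M S) : S ⊆ Ioo (p.b M) p.xmax := by
  rcases hS with ⟨-, rfl⟩ | ⟨-, rfl⟩
  · exact empty_subset _
  · exact subset_rfl

omit hp in
lemma measurableSet_of_isSaturated {S : Set ℝ} (hS : p.IsSaturated M S) : MeasurableSet S := by
  rcases hS with ⟨-, rfl⟩ | ⟨-, rfl⟩
  · exact MeasurableSet.empty
  · exact measurableSet_Ioo

lemma exp_mul_upper (τ : ℝ) : Real.exp τ * p.upper (Real.exp τ) = 1 / (p.β * p.ρ * p.κ) := by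
  have := hp.δ_pos
  rw [Params.upper]
  field_simp

lemma exp_mul_shapeDensity_band {S : Set ℝ} (hS : p.IsSaturated M S) {τ : ℝ}
    (h : Real.exp τ ∈ Ioo (p.a M) (p.b M)) :
    Real.pi * (p.β * p.ρ * p.κ * (Real.exp τ * p.shapeDensity M S (Real.exp τ))) =
      (logRatio (p.s₁ M) (p.s₂ M) (hp.confMap.inv τ)).im := by
  have hβ := hp.β_pos
  have hρ := hp.ρ_pos
  have hκ := hp.κ_pos
  have hπ := Real.pi_pos
  have h1 : Real.exp τ ∉ S := fun h' => by
    have := (subset_of_isSaturated hS h').1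
    linarith [h.2]
  rw [shapeDensity, indicator_of_mem h, indicator_of_notMem h1, hp.bandDensity_eq h,
    Real.log_exp]
  field_simp
  simp

lemma shapeDensity_left {S : Set ℝ} (hS : p.IsSaturated M S) {x : ℝ} (h : x ≤ p.a M) :
    p.shapeDensity M S x = 0 := by
  have h1 : x ∉ S := fun h' => by
    have := (subset_of_isSaturated hS h').1
    linarith [hp.a_lt_b]
  rw [shapeDensity, indicator_of_notMem (fun h' => by linarith [h'.1]), indicator_of_notMem h1,
    add_zero]

omit hp in
lemma shapeDensity_right {S : Set ℝ} {x : ℝ} (h : p.b M ≤ x) (h1 : x ∉ S) :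
    p.shapeDensity M S x = 0 := by
  rw [shapeDensity, indicator_of_notMem (fun h' => by linarith [h'.2]), indicator_of_notMem h1,
    add_zero]

lemma exp_mul_shapeDensity_sat {S : Set ℝ} {τ : ℝ} (h : p.b M ≤ Real.exp τ)
    (h1 : Real.exp τ ∈ S) :
    p.β * p.ρ * p.κ * (Real.exp τ * p.shapeDensity M S (Real.exp τ)) = 1 := by
  have := hp.δ_pos
  rw [shapeDensity, indicator_of_notMem (fun h' => by linarith [h'.2]), indicator_of_mem h1,
    zero_add, hp.exp_mul_upper, mul_one_div_cancel this.ne']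

lemma charge_eq_zero {τ : ℝ} (h : Real.exp τ < p.xmax) :
    p.chargeOut M τ = 0 ∧ p.chargeIn M τ = 0 := by
  rw [hp.xmax_eq_exp, Real.exp_lt_exp] at h
  have : τ ∉ Ioo (p.ρ * p.β * p.n₁) (p.ρ * p.β * p.n₂) := fun h' => by linarith [h'.1]
  cases M <;> simp [chargeOut, chargeIn, this]

lemma exp_mem_sat {τ : ℝ} (h : p.b M ≤ Real.exp τ) (hb : Real.exp τ ≠ p.b M) :
    Real.exp τ ∈ Ioo (p.b M) p.xmax ↔ τ < p.ρ * p.β * p.n₁ := by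
  rw [hp.xmax_eq_exp, mem_Ioo, Real.exp_lt_exp]
  exact ⟨fun h => h.2, fun h' => ⟨lt_of_le_of_ne h hb.symm, h'⟩⟩

theorem im_outPt_eq {S : Set ℝ} (hS : p.IsSaturated M S) : ∀ᵐ τ : ℝ,
    (logRatio (p.s₁ M) (p.s₂ M) (hp.confMap.outPt τ)).im = Real.pi *
      (p.β * p.ρ * p.κ * (Real.exp τ * p.shapeDensity M S (Real.exp τ)) + p.chargeOut M τ) := by
  have h12 := hp.s₂_lt_s₁
  have hs2 := hp.s₂_pos
  have hl := hp.l_le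
  have e1 := hp.rlam_s₁
  have e2 := hp.rlam_s₂
  filter_upwards [ae_exp_ne (p.b M), StripFun.ae_ne (p.ρ * p.β * p.n₁),
    StripFun.ae_ne (p.ρ * p.β * p.n₂)] with τ hb hlx hly
  by_cases h1 : p.b M ≤ Real.exp τ
  · obtain ⟨t, ht, hr, ho⟩ := hp.confMap.outPt_right (τ := τ) (by rwa [← hp.b_eq])
    have ht' : p.sb M ≤ t := ht
    rw [ho]
    rcases hS with ⟨hs, rfl⟩ | ⟨hs, rfl⟩
    · rw [shapeDensity_right h1 (notMem_empty _), mul_zero, mul_zero, zero_add]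
      cases M
      · rw [im_logRatio_of_gt h12 (le_trans hs ht), chargeOut]
        simp
      · have hs1 : hp.confMap.sb ≤ p.s₂ .one := hs
        rcases lt_or_gt_of_ne hlx with h3 | h3
        · have := hp.confMap.lt_of_rlam_lt ht hs1 (by rw [hr, e2]; exact h3)
          rw [im_logRatio_of_lt h12 this, chargeOut, indicator_of_notMem, mul_zero]
          exact fun h => by linarith [h.1]
        · have h4 := hp.confMap.lt_of_rlam_lt hs1 ht (by rw [hr, e2]; exact h3)
          rcases lt_or_gt_of_ne hly with h5 | h5
          · have := hp.confMap.lt_of_rlam_lt ht (hs1.trans h12.le) (by rw [hr, e1]; exact h5)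
            rw [im_logRatio_of_mem h4.le this, chargeOut, indicator_of_mem (mem_Ioo.2 ⟨h3, h5⟩)]
            simp
          · have := hp.confMap.lt_of_rlam_lt (hs1.trans h12.le) ht (by rw [hr, e1]; exact h5)
            rw [im_logRatio_of_gt h12 this.le, chargeOut, indicator_of_notMem, mul_zero]
            exact fun h => by linarith [h.2]
    · obtain ⟨h2, h3⟩ := hp.supercritical_mem hs
      rcases lt_or_gt_of_ne hlx with h4 | h4
      · have hmem := (hp.exp_mem_sat h1 hb).2 h4
        rw [hp.exp_mul_shapeDensity_sat h1 hmem, (hp.charge_eq_zero hmem.2).1, add_zero, mul_one]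
        refine im_logRatio_of_mem (h2.le.trans ht) (hp.confMap.lt_of_rlam_lt ht h3.le ?_)
        rw [hr, e1]
        cases M
        · exact h4
        · exact h4.trans_le hl
      · have hmem := mt (hp.exp_mem_sat h1 hb).1 h4.not_gt
        rw [shapeDensity_right h1 hmem, mul_zero, mul_zero, zero_add]
        cases M
        · have := hp.confMap.lt_of_rlam_lt h3.le ht (by rw [hr, e1]; exact h4)
          rw [im_logRatio_of_gt h12 this.le, chargeOut]
          simp
        · rcases lt_or_gt_of_ne hly with h5 | h5
          · have := hp.confMap.lt_of_rlam_lt ht h3.le (by rw [hr, e1]; exact h5)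
            rw [im_logRatio_of_mem (h2.le.trans ht) this, chargeOut, indicator_of_mem (mem_Ioo.2 ⟨h4, h5⟩)]
            simp
          · have := hp.confMap.lt_of_rlam_lt h3.le ht (by rw [hr, e1]; exact h5)
            rw [im_logRatio_of_gt h12 this.le, chargeOut, indicator_of_notMem, mul_zero]
            exact fun h => by linarith [h.2]
  · rw [not_le] at h1
    rw [(hp.charge_eq_zero (h1.trans_le hp.b_le_xmax)).1, add_zero]
    by_cases h2 : p.a M < Real.exp τ
    · rw [hp.exp_mul_shapeDensity_band hS ⟨h2, h1⟩, hp.confMap.outPt_band]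
      · rwa [← hp.a_eq]
      · rwa [← hp.b_eq]
    · rw [not_lt] at h2
      obtain ⟨t, -, -, h3, -, h4⟩ := hp.confMap.outPt_left (τ := τ) (by rwa [← hp.a_eq])
      rw [h4, im_logRatio_of_lt h12 (by linarith), hp.shapeDensity_left hS h2]
      simp

theorem im_inPt_eq {S : Set ℝ} (hS : p.IsSaturated M S) : ∀ᵐ τ : ℝ,
    (logRatio (p.s₁ M) (p.s₂ M) (hp.confMap.inPt τ)).im = Real.pi *
      (p.β * p.ρ * p.κ * (Real.exp τ * p.shapeDensity M S (Real.exp τ)) + p.chargeIn M τ) := by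
  have h12 := hp.s₂_lt_s₁
  have hs2 := hp.s₂_pos
  have hs1 := hp.s₁_pos
  have hl := hp.l_le
  have e1 := hp.rlam_s₁
  have e2 := hp.rlam_s₂
  filter_upwards [ae_exp_ne (p.b M), StripFun.ae_ne (p.ρ * p.β * p.n₁),
    StripFun.ae_ne (p.ρ * p.β * p.n₂)] with τ hb hlx hly
  by_cases h1 : p.b M ≤ Real.exp τ
  · obtain ⟨t, ht0, ht, hr, ho⟩ := hp.confMap.inPt_right (τ := τ) (by rwa [← hp.b_eq])
    rw [ho]
    rcases hS with ⟨hs, rfl⟩ | ⟨hs, rfl⟩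
    · rw [shapeDensity_right h1 (notMem_empty _), mul_zero, mul_zero, zero_add]
      cases M
      · have hs' : p.s₁ .nu ≤ hp.confMap.sb := hs
        have hs2' := h12.le.trans hs'
        rcases lt_or_gt_of_ne hlx with h3 | h3
        · have := hp.confMap.lt_of_rlam_lt_left ht0 ht hs1 hs' (by rw [hr, e1]; exact h3)
          rw [im_logRatio_of_gt h12 this.le, chargeIn, indicator_of_notMem, mul_zero]
          exact fun h => by linarith [h.1]
        · have h4 := hp.confMap.lt_of_rlam_lt_left hs1 hs' ht0 ht (by rw [hr, e1]; exact h3)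
          rcases lt_or_gt_of_ne hly with h5 | h5
          · have := hp.confMap.lt_of_rlam_lt_left ht0 ht hs2 hs2' (by rw [hr, e2]; exact h5)
            rw [im_logRatio_of_mem this.le h4, chargeIn, indicator_of_mem (mem_Ioo.2 ⟨h3, h5⟩)]
            simp
          · have := hp.confMap.lt_of_rlam_lt_left hs2 hs2' ht0 ht (by rw [hr, e2]; exact h5)
            rw [im_logRatio_of_lt h12 this, chargeIn, indicator_of_notMem, mul_zero]
            exact fun h => by linarith [h.2]
      · have hs' : hp.confMap.sb ≤ p.s₂ .one := hs
        have hne : t ≠ p.s₂ .one := by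
          rintro rfl
          exact hlx (hr.symm.trans e2)
        rw [im_logRatio_of_lt h12 (lt_of_le_of_ne (ht.trans hs') hne), chargeIn]
        simp
    · obtain ⟨h2, h3⟩ := hp.supercritical_mem hs
      have h2' : p.s₂ M ≤ hp.confMap.sb := h2.le
      have h3' : t < p.s₁ M := lt_of_le_of_lt ht h3
      rcases lt_or_gt_of_ne hlx with h4 | h4
      · have hmem := (hp.exp_mem_sat h1 hb).2 h4
        rw [hp.exp_mul_shapeDensity_sat h1 hmem, (hp.charge_eq_zero hmem.2).2, add_zero, mul_one]
        refine im_logRatio_of_mem (hp.confMap.lt_of_rlam_lt_left ht0 ht hs2 h2' ?_).le h3'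
        rw [hr, e2]
        cases M
        · exact h4.trans_le hl
        · exact h4
      · have hmem := mt (hp.exp_mem_sat h1 hb).1 h4.not_gt
        rw [shapeDensity_right h1 hmem, mul_zero, mul_zero, zero_add]
        cases M
        · rcases lt_or_gt_of_ne hly with h5 | h5
          · have := hp.confMap.lt_of_rlam_lt_left ht0 ht hs2 h2' (by rw [hr, e2]; exact h5)
            rw [im_logRatio_of_mem this.le h3', chargeIn, indicator_of_mem (mem_Ioo.2 ⟨h4, h5⟩)]
            simp
          · have := hp.confMap.lt_of_rlam_lt_left hs2 h2' ht0 ht (by rw [hr, e2]; exact h5)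
            rw [im_logRatio_of_lt h12 this, chargeIn, indicator_of_notMem, mul_zero]
            exact fun h => by linarith [h.2]
        · have := hp.confMap.lt_of_rlam_lt_left hs2 h2' ht0 ht (by rw [hr, e2]; exact h4)
          rw [im_logRatio_of_lt h12 this, chargeIn]
          simp
  · rw [not_le] at h1
    rw [(hp.charge_eq_zero (h1.trans_le hp.b_le_xmax)).2, add_zero]
    by_cases h2 : p.a M < Real.exp τ
    · rw [hp.exp_mul_shapeDensity_band hS ⟨h2, h1⟩, hp.confMap.inPt_band]
      · rwa [← hp.a_eq]
      · rwa [← hp.b_eq]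
    · rw [not_lt] at h2
      obtain ⟨t, -, -, h3, -, h4⟩ := hp.confMap.inPt_left (τ := τ) (by rwa [← hp.a_eq])
      rw [h4, im_logRatio_of_lt h12 (by linarith), hp.shapeDensity_left hS h2]
      simp

/-- On the right of the band, in the subcritical regime. -/
lemma re_inPt_le_right (hs : p.Subcritical M) {τ : ℝ} (h : p.b M ≤ Real.exp τ)
    (hl : τ < p.ρ * p.β * p.n₁) :
    (logRatio (p.s₁ M) (p.s₂ M) (hp.confMap.inPt τ)).re ≤
      (logRatio (p.s₁ M) (p.s₂ M) (hp.confMap.outPt τ)).re := by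
  have h12 := hp.s₂_lt_s₁
  have hs2 := hp.s₂_pos
  have hs1 := hp.s₁_pos
  have e1 := hp.rlam_s₁
  have e2 := hp.rlam_s₂
  obtain ⟨t, ht0, ht, hr, ho⟩ := hp.confMap.inPt_right (τ := τ) (by rwa [← hp.b_eq])
  obtain ⟨t', ht', hr', ho'⟩ := hp.confMap.outPt_right (τ := τ) (by rwa [← hp.b_eq])
  rw [ho, ho']
  cases M
  · exact re_logRatio_le_of_gt h12 (ht.trans ht')
      (hp.confMap.lt_of_rlam_lt_left ht0 ht hs1 hs (by rw [hr, e1]; exact hl))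
  · exact re_logRatio_le_of_lt h12 (ht.trans ht')
      (hp.confMap.lt_of_rlam_lt ht' hs (by rw [hr', e2]; exact hl))

/-- On the right of the band, in the supercritical regime. -/
lemma re_outPt_le_right (hs : p.Supercritical M) {τ : ℝ} (h : p.b M ≤ Real.exp τ)
    (hl : τ < p.ρ * p.β * p.n₁) :
    (logRatio (p.s₁ M) (p.s₂ M) (hp.confMap.outPt τ)).re ≤
      (logRatio (p.s₁ M) (p.s₂ M) (hp.confMap.inPt τ)).re := by
  have hle := hp.l_le
  have e1 := hp.rlam_s₁
  have e2 := hp.rlam_s₂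
  obtain ⟨h2, h1⟩ := hp.supercritical_mem hs
  obtain ⟨t, ht0, ht, hr, ho⟩ := hp.confMap.inPt_right (τ := τ) (by rwa [← hp.b_eq])
  obtain ⟨t', ht', hr', ho'⟩ := hp.confMap.outPt_right (τ := τ) (by rwa [← hp.b_eq])
  rw [ho, ho']
  refine re_logRatio_le_of_mem
    (hp.confMap.lt_of_rlam_lt_left ht0 ht hp.s₂_pos h2.le ?_) (ht.trans ht')
    (hp.confMap.lt_of_rlam_lt ht' h1.le ?_)
  · rw [hr, e2]
    cases M
    · exact hl.trans_le hle
    · exact hl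
  · rw [hr', e1]
    cases M
    · exact hl
    · exact hl.trans_le hle

/-- The variational inequalities for the potential. -/
theorem exists_pot_const {S : Set ℝ} (hS : p.IsSaturated M S) : ∃ c : ℝ,
    ∀ u < p.ρ * p.β * p.n₁,
      (Real.exp u ∈ Ioo (p.a M) (p.b M) → hp.confMap.pot (p.s₁ M) (p.s₂ M) u = c) ∧
      (Real.exp u ∈ S → hp.confMap.pot (p.s₁ M) (p.s₂ M) u ≤ c) ∧
      (Real.exp u ∉ S → c ≤ hp.confMap.pot (p.s₁ M) (p.s₂ M) u) := by
  have hs2 := hp.s₂_pos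
  have h12 := hp.s₂_lt_s₁
  have ha := hp.a_nonneg
  have hab := hp.a_lt_b
  obtain ⟨x₀, hx1, hx2⟩ := exists_between hab
  have hx0 : 0 < x₀ := ha.trans_lt hx1
  obtain ⟨τ₀, rfl⟩ : ∃ τ, x₀ = Real.exp τ := ⟨Real.log x₀, (Real.exp_log hx0).symm⟩
  have hlt : ∀ u v : ℝ, u ≤ v → Real.exp v ≤ p.b M →
      hp.confMap.pot (p.s₁ M) (p.s₂ M) v ≤ hp.confMap.pot (p.s₁ M) (p.s₂ M) u :=
    fun u v huv hv => by
      refine hp.confMap.pot_le_pot hs2 h12 huv (Eventually.of_forall fun τ hτ => ?_)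
      exact hp.confMap.re_outPt_le_left hs2 h12
        (by rw [← hp.b_eq]; exact (Real.exp_lt_exp.2 hτ.2).trans_le hv)
  have hband : ∀ u v : ℝ, u ≤ v → p.a M ≤ Real.exp u → Real.exp v ≤ p.b M →
      hp.confMap.pot (p.s₁ M) (p.s₂ M) v = hp.confMap.pot (p.s₁ M) (p.s₂ M) u :=
    fun u v huv hu hv => by
      refine le_antisymm (hlt u v huv hv) ?_
      refine hp.confMap.pot_ge_pot hs2 h12 huv (Eventually.of_forall fun τ hτ => ?_)
      have h3 : hp.confMap.a < Real.exp τ := by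
        rw [← hp.a_eq]; exact hu.trans_lt (Real.exp_lt_exp.2 hτ.1)
      have h4 : Real.exp τ < hp.confMap.b := by
        rw [← hp.b_eq]; exact (Real.exp_lt_exp.2 hτ.2).trans_le hv
      rw [hp.confMap.outPt_band h3 h4, hp.confMap.inPt_band h3 h4]
  refine ⟨hp.confMap.pot (p.s₁ M) (p.s₂ M) τ₀, fun u hu => ⟨fun h => ?_, fun h => ?_, fun h => ?_⟩⟩
  · rcases le_total u τ₀ with h3 | h3
    · exact (hband u τ₀ h3 h.1.le hx2.le).symm
    · exact hband τ₀ u h3 hx1.le h.2.le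
  · rcases hS with ⟨-, rfl⟩ | ⟨hs, rfl⟩
    · exact absurd h (notMem_empty _)
    · refine hp.confMap.pot_le_pot hs2 h12 (Real.exp_le_exp.1 (hx2.trans h.1).le)
        (Eventually.of_forall fun τ hτ => ?_)
      rcases lt_or_ge (Real.exp τ) (p.b M) with h3 | h3
      · exact hp.confMap.re_outPt_le_left hs2 h12 (by rwa [← hp.b_eq])
      · exact hp.re_outPt_le_right hs h3 (hτ.2.trans hu)
  · rcases le_or_gt (Real.exp u) (p.b M) with h3 | h3
    · rcases le_total u τ₀ with h4 | h4
      · exact hlt u τ₀ h4 hx2.le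
      · exact (hband τ₀ u h4 hx1.le h3).ge
    · rcases hS with ⟨hs, rfl⟩ | ⟨hs, rfl⟩
      · refine hp.confMap.pot_ge_pot hs2 h12 (Real.exp_le_exp.1 (hx2.trans h3).le)
          (Eventually.of_forall fun τ hτ => ?_)
        rcases lt_or_ge (Real.exp τ) (p.b M) with h5 | h5
        · have h4 : hp.confMap.a < Real.exp τ := by
            rw [← hp.a_eq]; exact hx1.trans (Real.exp_lt_exp.2 hτ.1)
          rw [hp.b_eq] at h5
          rw [hp.confMap.outPt_band h4 h5, hp.confMap.inPt_band h4 h5]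
        · exact hp.re_inPt_le_right hs h5 (hτ.2.trans hu)
      · exact absurd ((hp.exp_mem_sat h3.le h3.ne').2 hu) h

end Admissible

end Params

/-! ### The potential of the limit shape -/

lemma negLog_of_pos {t : ℝ} (h : 0 < t) : negLog t = ENNReal.ofReal (-Real.log t) := by
  rw [negLog, if_neg h.not_ge]

lemma measurable_negLog : Measurable negLog := by
  unfold negLog
  exact Measurable.ite measurableSet_Iic measurable_const (by fun_prop)

lemma log_abs_exp_sub (c u τ : ℝ) (h : c * τ ≠ c * u) :
    Real.log |Real.exp (c * u) - Real.exp (c * τ)| =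
      c * u + Real.log |1 - Real.exp (c * (τ - u))| := by
  have e : Real.exp (c * u) - Real.exp (c * τ) =
      Real.exp (c * u) * (1 - Real.exp (c * (τ - u))) := by
    rw [mul_sub, mul_one, ← Real.exp_add]
    ring_nf
  have h1 : 1 - Real.exp (c * (τ - u)) ≠ 0 := by
    rw [sub_ne_zero, ne_comm, Ne, Real.exp_eq_one_iff, mul_sub, sub_eq_zero]
    exact h
  rw [e, abs_mul, Real.log_mul (by positivity) (abs_ne_zero.2 h1), abs_of_pos (Real.exp_pos _),
    Real.log_exp]

lemma abs_exp_sub_exp_le_one {x y : ℝ} (hx : x ≤ 0) (hy : y ≤ 0) :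
    |Real.exp x - Real.exp y| ≤ 1 := by
  have h1 := Real.exp_pos x
  have h2 := Real.exp_pos y
  have h3 := Real.exp_le_one_iff.2 hx
  have h4 := Real.exp_le_one_iff.2 hy
  rw [abs_le]
  constructor <;> linarith

lemma negLog_abs_exp_sub {c u τ : ℝ} (hc : 0 < c) (hu : u ≤ 0) (hτ : τ ≤ 0) (h : τ ≠ u) :
    negLog |Real.exp (c * u) - Real.exp (c * τ)| =
      ENNReal.ofReal (-(c * u) - Real.log |1 - Real.exp (c * (τ - u))|) ∧
      0 ≤ -(c * u) - Real.log |1 - Real.exp (c * (τ - u))| := by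
  have h1 : c * τ ≠ c * u := fun h' => h (mul_left_cancel₀ hc.ne' h')
  have h2 : Real.exp (c * u) - Real.exp (c * τ) ≠ 0 :=
    sub_ne_zero.2 fun h' => h1 (Real.exp_injective h').symm
  have h3 := log_abs_exp_sub c u τ h1
  have h4 := Real.log_nonpos (abs_nonneg _) (abs_exp_sub_exp_le_one
    (mul_nonpos_of_nonneg_of_nonpos hc.le hu) (mul_nonpos_of_nonneg_of_nonpos hc.le hτ))
  rw [negLog_of_pos (abs_pos.2 h2)]
  constructor
  · rw [h3]
    congr 1
    ring
  · linarith

lemma continuousOn_log_one_sub_exp {c u l r : ℝ} (hc : 0 < c) (hu : u < l) :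
    ContinuousOn (fun τ => Real.log |1 - Real.exp (c * (τ - u))|) (Icc l r) := by
  refine ContinuousOn.log (by fun_prop) fun τ hτ => abs_ne_zero.2 ?_
  have : 0 < c * (τ - u) := mul_pos hc (by linarith [hτ.1])
  have := Real.one_lt_exp_iff.2 this
  linarith

lemma integrableOn_log_one_sub_exp {c u l r : ℝ} (hc : 0 < c) (hu : u < l) :
    IntegrableOn (fun τ => Real.log |1 - Real.exp (c * (τ - u))|) (Ioo l r) :=
  ((continuousOn_log_one_sub_exp hc hu).integrableOn_Icc).mono_set Ioo_subset_Icc_self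

/-- Integrals against a measure on the positive half line, in the logarithmic variable. -/
lemma lintegral_withDensity_exp {f : ℝ → ℝ} (hf : AEMeasurable f) (h0 : ∀ x ≤ 0, f x = 0)
    (g : ℝ → ℝ≥0∞) :
    ∫⁻ x, g x ∂(volume.withDensity fun x => ENNReal.ofReal (f x)) =
      ∫⁻ τ, ENNReal.ofReal (Real.exp τ * f (Real.exp τ)) * g (Real.exp τ) := by
  rw [lintegral_withDensity_eq_lintegral_mul_non_measurable₀ _ hf.ennreal_ofReal (by simp)]
  have h1 : ∫⁻ x, ((fun x => ENNReal.ofReal (f x)) * g) x =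
      ∫⁻ x in Real.exp '' univ, ENNReal.ofReal (f x) * g x := by
    rw [image_univ, Real.range_exp, ← lintegral_indicator measurableSet_Ioi]
    refine lintegral_congr fun x => ?_
    by_cases hx : 0 < x
    · rw [indicator_of_mem (mem_Ioi.2 hx), Pi.mul_apply]
    · rw [indicator_of_notMem (by simpa using hx), Pi.mul_apply, h0 x (not_lt.1 hx)]
      simp
  rw [h1, lintegral_image_eq_lintegral_abs_deriv_mul MeasurableSet.univ
    (fun x _ => (Real.hasDerivAt_exp x).hasDerivWithinAt) Real.exp_injective.injOn,
    Measure.restrict_univ]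
  refine lintegral_congr fun τ => ?_
  rw [abs_of_pos (Real.exp_pos τ), ← mul_assoc, ← ENNReal.ofReal_mul (Real.exp_pos τ).le]

namespace Params

/-- The limit shape that is saturated on the set `S`. -/
def shape (p : Params) (M : ModelProblem) (S : Set ℝ) : Measure ℝ :=
  volume.withDensity fun x => ENNReal.ofReal (p.shapeDensity M S x)

/-- The density of the limit shape in the logarithmic variable. -/
def logDensity (p : Params) (M : ModelProblem) (S : Set ℝ) (τ : ℝ) : ℝ :=
  Real.exp τ * p.shapeDensity M S (Real.exp τ)

/-- The interaction kernel of the energy. -/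
def kernel (p : Params) (x y : ℝ) : ℝ≥0∞ := negLog |x ^ p.ν - y ^ p.ν| + negLog |x - y|

/-- The external potential. -/
def extPot (p : Params) (M : ModelProblem) (x : ℝ) : ℝ≥0∞ :=
  ENNReal.ofReal (1 / p.κ) * (∫⁻ u in Ioc p.n₁ p.n₂,
    negLog (1 - x ^ p.potExp M * Real.exp (-p.β * p.α * u))) + ENNReal.ofReal p.m₁ * negLog x

namespace Admissible

variable {p : Params} {M : ModelProblem} (hp : p.Admissible M) {S : Set ℝ}
include hp

lemma continuousOn_bandDensity : ContinuousOn (p.bandDensity M) (Ioo (p.a M) (p.b M)) := by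
  refine ContinuousOn.congr (f := fun x => 1 / (Real.pi * p.β * p.ρ * p.κ * x) *
      (logRatio (p.s₁ M) (p.s₂ M) (hp.confMap.inv (Real.log x : ℝ))).im) ?_
    fun x hx => hp.bandDensity_eq hx
  intro x hx
  have hβ := hp.β_pos
  have hρ := hp.ρ_pos
  have hκ := hp.κ_pos
  have hπ := Real.pi_pos
  have h0 : 0 < x := hp.a_nonneg.trans_lt hx.1
  have h1 := hp.inv_log_mem hx
  refine (ContinuousAt.mul ?_ ?_).continuousWithinAt
  · exact continuousAt_const.div (by fun_prop) (by positivity)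
  · refine Complex.continuous_im.continuousAt.comp ?_
    refine ContinuousAt.comp (g := logRatio (p.s₁ M) (p.s₂ M))
      (differentiableAt_logRatio (hp.confMap.inv_im_pos h1)).continuousAt ?_
    refine ContinuousAt.comp (g := hp.confMap.inv) (hp.confMap.continuousAt_inv h1) ?_
    exact Complex.continuous_ofReal.continuousAt.comp (Real.continuousAt_log h0.ne')

lemma aemeasurable_shapeDensity (hS : p.IsSaturated M S) :
    AEMeasurable (p.shapeDensity M S) := by
  have h1 : AEMeasurable ((Ioo (p.a M) (p.b M)).indicator (p.bandDensity M)) :=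
    (aemeasurable_indicator_iff measurableSet_Ioo).2
      (hp.continuousOn_bandDensity.aemeasurable measurableSet_Ioo)
  have h2 : Measurable (S.indicator p.upper) := by
    refine Measurable.indicator ?_ (measurableSet_of_isSaturated hS)
    unfold Params.upper
    fun_prop
  exact h1.add h2.aemeasurable

lemma shapeDensity_nonneg (hS : p.IsSaturated M S) (x : ℝ) : 0 ≤ p.shapeDensity M S x := by
  refine add_nonneg (indicator_nonneg (fun x hx => (hp.bandDensity_mem hx).1.le) x)
    (indicator_nonneg (fun x hx => ?_) x)
  have h1 := hp.b_pos.trans (subset_of_isSaturated hS hx).1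
  have := hp.δ_pos
  rw [Params.upper]
  positivity

lemma shapeDensity_of_ge (hS : p.IsSaturated M S) {x : ℝ} (h : p.xmax ≤ x) :
    p.shapeDensity M S x = 0 :=
  shapeDensity_right (hp.b_le_xmax.trans h) fun h' => by
    linarith [(subset_of_isSaturated hS h').2]

lemma logDensity_nonneg (hS : p.IsSaturated M S) (τ : ℝ) : 0 ≤ p.logDensity M S τ :=
  mul_nonneg (Real.exp_pos _).le (hp.shapeDensity_nonneg hS _)

lemma logDensity_of_ge (hS : p.IsSaturated M S) {τ : ℝ} (h : p.ρ * p.β * p.n₁ ≤ τ) :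
    p.logDensity M S τ = 0 := by
  rw [logDensity, hp.shapeDensity_of_ge hS, mul_zero]
  rw [hp.xmax_eq_exp]
  exact Real.exp_le_exp.2 h

lemma lintegral_shape (hS : p.IsSaturated M S) (g : ℝ → ℝ≥0∞) :
    ∫⁻ x, g x ∂(p.shape M S) =
      ∫⁻ τ, ENNReal.ofReal (p.logDensity M S τ) * g (Real.exp τ) :=
  lintegral_withDensity_exp (hp.aemeasurable_shapeDensity hS)
    (fun _ hx => hp.shapeDensity_left hS (hx.trans hp.a_nonneg)) g

omit hp in
lemma integrable_charge (f : ℝ → ℝ)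
    (hf : IntegrableOn f (Ioo (p.ρ * p.β * p.n₁) (p.ρ * p.β * p.n₂))) :
    Integrable (fun τ => p.chargeOut M τ * f τ) ∧ Integrable (fun τ => p.chargeIn M τ * f τ) := by
  have h1 : Integrable (fun τ =>
      (Ioo (p.ρ * p.β * p.n₁) (p.ρ * p.β * p.n₂)).indicator (1 : ℝ → ℝ) τ * f τ) := by
    refine (hf.integrable_indicator measurableSet_Ioo).congr (Eventually.of_forall fun τ => ?_)
    by_cases h : τ ∈ Ioo (p.ρ * p.β * p.n₁) (p.ρ * p.β * p.n₂) <;> simp [h]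
  cases M
  · exact ⟨by simp [chargeOut], h1⟩
  · exact ⟨h1, by simp [chargeIn]⟩

omit hp in
lemma integral_indicator_one_mul (l r : ℝ) (f : ℝ → ℝ) :
    ∫ τ, (Ioo l r).indicator (1 : ℝ → ℝ) τ * f τ = ∫ τ in Ioo l r, f τ := by
  rw [← integral_indicator measurableSet_Ioo]
  congr 1
  funext τ
  by_cases h : τ ∈ Ioo l r <;> simp [h]

/-- Products with the logarithmic density, from products with the boundary values. -/
lemma integral_logDensity_mul {im ch : ℝ → ℝ} {f : ℝ → ℝ}
    (h : ∀ᵐ τ, im τ = Real.pi * (p.β * p.ρ * p.κ * p.logDensity M S τ + ch τ))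
    (h1 : Integrable fun τ => im τ * f τ) (h2 : Integrable fun τ => ch τ * f τ) :
    Integrable (fun τ => p.logDensity M S τ * f τ) ∧
    ∫ τ, im τ * f τ =
      Real.pi * (p.β * p.ρ * p.κ * (∫ τ, p.logDensity M S τ * f τ) + ∫ τ, ch τ * f τ) := by
  have hδ := hp.δ_pos
  have hπ := Real.pi_pos
  generalize p.β * p.ρ * p.κ = δ at *
  have h3 : Integrable (fun τ => p.logDensity M S τ * f τ) := by
    refine (((h1.const_mul Real.pi⁻¹).sub h2).const_mul δ⁻¹).congr ?_
    filter_upwards [h] with τ hτ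
    simp only [Pi.sub_apply, hτ]
    field_simp
    ring
  refine ⟨h3, ?_⟩
  rw [← integral_const_mul δ, ← integral_add (h3.const_mul _) h2,
    ← integral_const_mul]
  refine integral_congr_ae ?_
  filter_upwards [h] with τ hτ
  simp only [hτ]
  ring

/-- The limit shape has total mass one. -/
theorem integral_logDensity (hS : p.IsSaturated M S) :
    Integrable (p.logDensity M S) ∧ ∫ τ, p.logDensity M S τ = 1 := by
  have hδ := hp.δ_pos
  have hπ := Real.pi_pos
  have hl := hp.l_le
  obtain ⟨h1, h2⟩ := hp.confMap.integral_im_logRatio_outPt hp.s₂_pos hp.s₂_lt_s₁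
  rw [hp.log_s0_quot, hp.log_K₁_sub_log_K₂] at h2
  have hc := (integrable_charge (p := p) (M := M) (fun _ => 1) (integrableOn_const (by simp))).1
  obtain ⟨h3, h4⟩ := hp.integral_logDensity_mul (S := S) (f := fun _ => 1) (hp.im_outPt_eq hS)
    (by simpa using h1) hc
  simp only [mul_one] at h3 h4 hc
  refine ⟨h3, ?_⟩
  rw [h2] at h4
  have h5 := mul_left_cancel₀ hπ.ne' h4
  have h6 : ∫ τ, p.chargeOut M τ = p.chargeMass M := by
    cases M
    · simp [chargeOut, chargeMass]
    · have := integral_indicator_one_mul (p.ρ * p.β * p.n₁) (p.ρ * p.β * p.n₂) (fun _ => 1)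
      simp only [mul_one] at this
      simp only [chargeOut, chargeMass]
      rw [this]
      simp [hl]
  rw [h6] at h5
  have h7 := add_right_cancel h5
  exact mul_left_cancel₀ hδ.ne' (by linarith)

lemma isProbabilityMeasure_shape (hS : p.IsSaturated M S) : IsProbabilityMeasure (p.shape M S) := by
  obtain ⟨h1, h2⟩ := hp.integral_logDensity hS
  constructor
  have := hp.lintegral_shape hS 1
  simp only [Pi.one_apply, mul_one, lintegral_one] at this
  rw [this, ← ofReal_integral_eq_lintegral_ofReal h1
    (Eventually.of_forall (hp.logDensity_nonneg hS)), h2, ENNReal.ofReal_one]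

/-- The logarithmic integrals against the limit shape, in terms of `pot`. -/
lemma integral_logDensity_log (hS : p.IsSaturated M S) {u : ℝ} (hu : u < p.ρ * p.β * p.n₁) :
    Integrable (fun τ => p.logDensity M S τ * Real.log |1 - Real.exp (1 * (τ - u))|) ∧
    Integrable (fun τ => p.logDensity M S τ * Real.log |1 - Real.exp (p.ν * (τ - u))|) ∧
    hp.confMap.pot (p.s₁ M) (p.s₂ M) u = Real.pi * (-(Real.log (p.A M) * u) -
      p.β * p.ρ * p.κ * (∫ τ, p.logDensity M S τ * Real.log |1 - Real.exp (1 * (τ - u))|) -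
      p.β * p.ρ * p.κ * (∫ τ, p.logDensity M S τ * Real.log |1 - Real.exp (p.ν * (τ - u))|) -
      ∫ τ in Ioo (p.ρ * p.β * p.n₁) (p.ρ * p.β * p.n₂),
        Real.log |1 - Real.exp (p.potExp M * (τ - u))|) := by
  have hν := hp.ν_pos
  obtain ⟨-, o1, -⟩ := hp.confMap.integral_log_outPt hp.s₂_pos hp.s₂_lt_s₁ u
  obtain ⟨-, i1, -⟩ := hp.confMap.integral_log_inPt hp.s₂_pos hp.s₂_lt_s₁ u
  obtain ⟨o2, o3⟩ := hp.integral_logDensity_mul (S := S)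
    (f := fun τ => Real.log |1 - Real.exp (1 * (τ - u))|) (hp.im_outPt_eq hS)
    (by simpa only [one_mul] using o1)
    (integrable_charge _ (integrableOn_log_one_sub_exp one_pos hu)).1
  obtain ⟨i2, i3⟩ := hp.integral_logDensity_mul (S := S)
    (f := fun τ => Real.log |1 - Real.exp (p.ν * (τ - u))|) (hp.im_inPt_eq hS) i1
    (integrable_charge _ (integrableOn_log_one_sub_exp hν hu)).2
  refine ⟨o2, i2, ?_⟩
  have hc : (∫ τ, p.chargeOut M τ * Real.log |1 - Real.exp (1 * (τ - u))|) +
      (∫ τ, p.chargeIn M τ * Real.log |1 - Real.exp (p.ν * (τ - u))|) =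
      ∫ τ in Ioo (p.ρ * p.β * p.n₁) (p.ρ * p.β * p.n₂),
        Real.log |1 - Real.exp (p.potExp M * (τ - u))| := by
    cases M
    · simp only [chargeOut, chargeIn, potExp, integral_indicator_one_mul]
      simp
    · simp only [chargeOut, chargeIn, potExp, integral_indicator_one_mul]
      simp
  rw [ConfMap.pot, hp.s₁_div_s₂, ← hc]
  have e2 : ∫ τ, (logRatio (p.s₁ M) (p.s₂ M) (hp.confMap.inPt τ)).im *
      Real.log |1 - Real.exp (hp.confMap.ν * (τ - u))| =
      Real.pi * (p.β * p.ρ * p.κ *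
        (∫ τ, p.logDensity M S τ * Real.log |1 - Real.exp (p.ν * (τ - u))|) +
        ∫ τ, p.chargeIn M τ * Real.log |1 - Real.exp (p.ν * (τ - u))|) := i3
  simp only [one_mul] at o3 ⊢
  rw [o3, e2]
  ring

lemma lintegral_kernel_shape (hS : p.IsSaturated M S) {u : ℝ} (hu : u < p.ρ * p.β * p.n₁) :
    ∫⁻ y, p.kernel (Real.exp u) y ∂(p.shape M S) = ENNReal.ofReal (-((p.ν + 1) * u) -
      (∫ τ, p.logDensity M S τ * Real.log |1 - Real.exp (1 * (τ - u))|) -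
      ∫ τ, p.logDensity M S τ * Real.log |1 - Real.exp (p.ν * (τ - u))|) ∧
    0 ≤ -((p.ν + 1) * u) -
      (∫ τ, p.logDensity M S τ * Real.log |1 - Real.exp (1 * (τ - u))|) -
      ∫ τ, p.logDensity M S τ * Real.log |1 - Real.exp (p.ν * (τ - u))| := by
  have hν := hp.ν_pos
  have hl := hp.l_nonpos
  obtain ⟨h1, h2⟩ := hp.integral_logDensity hS
  obtain ⟨o, i, -⟩ := hp.integral_logDensity_log hS hu
  set G : ℝ → ℝ := fun τ => p.logDensity M S τ * (-((p.ν + 1) * u)) -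
    p.logDensity M S τ * Real.log |1 - Real.exp (1 * (τ - u))| -
    p.logDensity M S τ * Real.log |1 - Real.exp (p.ν * (τ - u))| with hG
  have hGi : Integrable G := ((h1.mul_const _).sub o).sub i
  have hpt : ∀ τ, τ ≠ u → ENNReal.ofReal (p.logDensity M S τ) *
      p.kernel (Real.exp u) (Real.exp τ) = ENNReal.ofReal (G τ) ∧ 0 ≤ G τ := by
    intro τ hτu
    rcases lt_or_ge τ (p.ρ * p.β * p.n₁) with hτ | hτ
    · obtain ⟨k1, k2⟩ := negLog_abs_exp_sub one_pos (by linarith : u ≤ 0) (by linarith : τ ≤ 0) hτu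
      obtain ⟨k3, k4⟩ := negLog_abs_exp_sub hν (by linarith : u ≤ 0) (by linarith : τ ≤ 0) hτu
      have hq := hp.logDensity_nonneg hS τ
      have e : G τ = p.logDensity M S τ *
          ((-(p.ν * u) - Real.log |1 - Real.exp (p.ν * (τ - u))|) +
            (-(1 * u) - Real.log |1 - Real.exp (1 * (τ - u))|)) := by
        rw [hG]
        ring
      rw [e]
      refine ⟨?_, by positivity⟩
      rw [ENNReal.ofReal_mul hq, ENNReal.ofReal_add k4 k2, ← k1, ← k3, kernel]
      simp only [one_mul, mul_comm p.ν, Real.exp_mul]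
    · simp [hG, hp.logDensity_of_ge hS hτ]
  have hae : ∀ᵐ τ : ℝ, τ ≠ u := StripFun.ae_ne u
  have hG0 : 0 ≤ᵐ[volume] G := hae.mono fun τ hτ => (hpt τ hτ).2
  have hGe : ∫ τ, G τ = -((p.ν + 1) * u) -
      (∫ τ, p.logDensity M S τ * Real.log |1 - Real.exp (1 * (τ - u))|) -
      ∫ τ, p.logDensity M S τ * Real.log |1 - Real.exp (p.ν * (τ - u))| := by
    rw [hG, integral_sub (f := fun τ => p.logDensity M S τ * (-((p.ν + 1) * u)) -
      p.logDensity M S τ * Real.log |1 - Real.exp (1 * (τ - u))|) ((h1.mul_const _).sub o) i,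
      integral_sub (h1.mul_const _) o,
      integral_mul_const, h2, one_mul]
  rw [← hGe]
  refine ⟨?_, integral_nonneg_of_ae hG0⟩
  rw [hp.lintegral_shape hS, ofReal_integral_eq_lintegral_ofReal hGi hG0]
  exact lintegral_congr_ae (hae.mono fun τ hτ => (hpt τ hτ).1)

lemma extPot_exp {u : ℝ} (hu : u < p.ρ * p.β * p.n₁) :
    p.extPot M (Real.exp u) = ENNReal.ofReal (1 / (p.β * p.ρ * p.κ) *
      (p.potExp M * (((p.ρ * p.β * p.n₂) ^ 2 - (p.ρ * p.β * p.n₁) ^ 2) / 2 -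
        u * (p.ρ * p.β * p.n₂ - p.ρ * p.β * p.n₁)) -
      ∫ τ in Ioo (p.ρ * p.β * p.n₁) (p.ρ * p.β * p.n₂),
        Real.log |1 - Real.exp (p.potExp M * (τ - u))|) - p.m₁ * u) ∧
    0 ≤ 1 / (p.β * p.ρ * p.κ) *
      (p.potExp M * (((p.ρ * p.β * p.n₂) ^ 2 - (p.ρ * p.β * p.n₁) ^ 2) / 2 -
        u * (p.ρ * p.β * p.n₂ - p.ρ * p.β * p.n₁)) -
      ∫ τ in Ioo (p.ρ * p.β * p.n₁) (p.ρ * p.β * p.n₂),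
        Real.log |1 - Real.exp (p.potExp M * (τ - u))|) - p.m₁ * u := by
  have hβ := hp.β_pos
  have hρ := hp.ρ_pos
  have hκ := hp.κ_pos
  have hr := hp.potExp_pos
  have hl := hp.l_nonpos
  have hle := hp.l_le
  have hm := hp.m₁_nonneg
  set r := p.potExp M with hr_def
  set lx := p.ρ * p.β * p.n₁ with hlx
  set ly := p.ρ * p.β * p.n₂ with hly
  set h : ℝ → ℝ := fun τ => r * (τ - u) - Real.log |1 - Real.exp (r * (τ - u))| with hh
  have hcont : ContinuousOn h (Icc lx ly) :=
    ContinuousOn.sub (by fun_prop) (continuousOn_log_one_sub_exp hr hu)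
  have hval : ∀ τ, lx ≤ τ → negLog (1 - Real.exp (r * (u - τ))) = ENNReal.ofReal (h τ) ∧
      0 ≤ h τ := by
    intro τ hτ
    have h1 : 0 < r * (τ - u) := mul_pos hr (by linarith)
    have h2 : Real.exp (r * (u - τ)) < 1 := Real.exp_lt_one_iff.2 (by linarith)
    have h3 : 0 < Real.exp (r * (u - τ)) := Real.exp_pos _
    have h4 : h τ = -Real.log (1 - Real.exp (r * (u - τ))) := by
      have := log_abs_exp_sub r τ u (fun h' => by linarith)
      have e := log_abs_exp_sub r u τ (fun h' => by linarith)
      rw [abs_sub_comm] at this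
      rw [e, abs_of_pos (by linarith : 0 < 1 - Real.exp (r * (u - τ)))] at this
      rw [hh]
      linarith
    rw [negLog_of_pos (by linarith), h4]
    refine ⟨rfl, ?_⟩
    have := Real.log_nonpos (by linarith : 0 ≤ 1 - Real.exp (r * (u - τ))) (by linarith)
    linarith
  have hmap : ∀ v ∈ Icc p.n₁ p.n₂, p.ρ * p.β * v ∈ Icc lx ly := fun v hv =>
    ⟨mul_le_mul_of_nonneg_left hv.1 (by positivity), mul_le_mul_of_nonneg_left hv.2 (by positivity)⟩
  have hint : IntegrableOn (fun v => h (p.ρ * p.β * v)) (Ioc p.n₁ p.n₂) :=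
    (ContinuousOn.integrableOn_Icc
      (hcont.comp (by fun_prop) hmap)).mono_set Ioc_subset_Icc_self
  have hnn : ∀ v ∈ Ioc p.n₁ p.n₂, 0 ≤ h (p.ρ * p.β * v) := fun v hv =>
    (hval _ (hmap v (Ioc_subset_Icc_self hv)).1).2
  have hl1 : ∫⁻ v in Ioc p.n₁ p.n₂, negLog (1 - Real.exp u ^ r * Real.exp (-p.β * p.α * v)) =
      ENNReal.ofReal (∫ v in Ioc p.n₁ p.n₂, h (p.ρ * p.β * v)) := by
    rw [ofReal_integral_eq_lintegral_ofReal hint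
      ((ae_restrict_iff' measurableSet_Ioc).2 (Eventually.of_forall hnn))]
    refine setLIntegral_congr_fun measurableSet_Ioc fun v hv => ?_
    rw [← (hval _ (hmap v (Ioc_subset_Icc_self hv)).1).1]
    simp only [← Real.exp_mul, ← Real.exp_add]
    congr 3
    rw [hp.α_eq]
    ring
  have hl2 : ∫ v in Ioc p.n₁ p.n₂, h (p.ρ * p.β * v) = (p.ρ * p.β)⁻¹ * ∫ τ in Ioo lx ly, h τ := by
    rw [← intervalIntegral.integral_of_le hp.n₁_le_n₂,
      intervalIntegral.integral_comp_mul_left h (by positivity), smul_eq_mul,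
      intervalIntegral.integral_of_le hle, integral_Ioc_eq_integral_Ioo]
  have hl3 : ∫ τ in Ioo lx ly, h τ = r * ((ly ^ 2 - lx ^ 2) / 2 - u * (ly - lx)) -
      ∫ τ in Ioo lx ly, Real.log |1 - Real.exp (r * (τ - u))| := by
    have h1 : IntegrableOn (fun τ => r * (τ - u)) (Ioo lx ly) :=
      (Continuous.integrableOn_Icc (by fun_prop)).mono_set Ioo_subset_Icc_self
    rw [hh, integral_sub h1 (integrableOn_log_one_sub_exp hr hu), ← integral_Ioc_eq_integral_Ioo,
      ← intervalIntegral.integral_of_le hle]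
    simp only [intervalIntegral.integral_const_mul]
    rw [intervalIntegral.integral_sub (by simp) (by simp), integral_id,
      intervalIntegral.integral_const, smul_eq_mul]
    ring
  have hl4 : 0 ≤ ∫ v in Ioc p.n₁ p.n₂, h (p.ρ * p.β * v) :=
    setIntegral_nonneg measurableSet_Ioc hnn
  have hm' : 0 ≤ -(p.m₁ * u) := by
    have := mul_nonneg hm (by linarith : 0 ≤ -u)
    linarith
  have e : 1 / (p.β * p.ρ * p.κ) * (r * ((ly ^ 2 - lx ^ 2) / 2 - u * (ly - lx)) -
      ∫ τ in Ioo lx ly, Real.log |1 - Real.exp (r * (τ - u))|) - p.m₁ * u =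
      1 / p.κ * (∫ v in Ioc p.n₁ p.n₂, h (p.ρ * p.β * v)) + -(p.m₁ * u) := by
    rw [hl2, ← hl3]
    field_simp
    ring
  rw [e]
  refine ⟨?_, by positivity⟩
  rw [ENNReal.ofReal_add (by positivity) hm', ENNReal.ofReal_mul (by positivity), extPot, hl1,
    negLog_of_pos (Real.exp_pos u), Real.log_exp, ← mul_neg, ENNReal.ofReal_mul hm]

/-- The total potential of the limit shape. -/
theorem potential_exp (hS : p.IsSaturated M S) : ∃ C : ℝ, ∀ u < p.ρ * p.β * p.n₁,
    (∫⁻ y, p.kernel (Real.exp u) y ∂(p.shape M S)) + p.extPot M (Real.exp u) =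
      ENNReal.ofReal (1 / (Real.pi * (p.β * p.ρ * p.κ)) *
        hp.confMap.pot (p.s₁ M) (p.s₂ M) u + C) ∧
    0 ≤ 1 / (Real.pi * (p.β * p.ρ * p.κ)) * hp.confMap.pot (p.s₁ M) (p.s₂ M) u + C := by
  refine ⟨1 / (p.β * p.ρ * p.κ) * (p.potExp M *
    (((p.ρ * p.β * p.n₂) ^ 2 - (p.ρ * p.β * p.n₁) ^ 2) / 2)), fun u hu => ?_⟩
  have hδ := hp.δ_pos
  have hπ := Real.pi_pos
  obtain ⟨k1, k2⟩ := hp.lintegral_kernel_shape hS hu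
  obtain ⟨v1, v2⟩ := hp.extPot_exp hu
  obtain ⟨-, -, h3⟩ := hp.integral_logDensity_log hS hu
  rw [k1, v1, ← ENNReal.ofReal_add k2 v2, h3, hp.log_A]
  have e := add_nonneg k2 v2
  generalize (∫ τ, p.logDensity M S τ * Real.log |1 - Real.exp (1 * (τ - u))|) = I1 at *
  generalize (∫ τ, p.logDensity M S τ * Real.log |1 - Real.exp (p.ν * (τ - u))|) = I2 at *
  generalize (∫ τ in Ioo (p.ρ * p.β * p.n₁) (p.ρ * p.β * p.n₂),
    Real.log |1 - Real.exp (p.potExp M * (τ - u))|) = I3 at *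
  generalize p.ρ * p.β * p.n₁ = lx at *
  generalize p.ρ * p.β * p.n₂ = ly at *
  generalize p.β * p.ρ * p.κ = δ at *
  have key : ∀ x y : ℝ, x = y → 0 ≤ x → ENNReal.ofReal x = ENNReal.ofReal y ∧ 0 ≤ y := by
    rintro x _ rfl h
    exact ⟨rfl, h⟩
  refine key _ _ ?_ e
  field_simp
  ring

end Admissible

end Params

/-! ### The logarithmic kernel as a Gram kernel -/

lemma two_mul_le_sq_add_sq (a b : ℝ≥0∞) : 2 * (a * b) ≤ a * a + b * b := by
  wlog h : a ≤ b generalizing a b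
  · rw [mul_comm a b, add_comm]
    exact this b a (le_of_not_ge h)
  obtain ⟨c, rfl⟩ := exists_add_of_le h
  calc 2 * (a * (a + c)) ≤ 2 * (a * (a + c)) + c * c := le_self_add
    _ = a * a + (a + c) * (a + c) := by ring

lemma eq_of_two_mul_eq {a b : ℝ≥0∞} (h : 2 * (a * b) = a * a + b * b)
    (hfin : a * a + b * b ≠ ⊤) : a = b := by
  wlog hab : a ≤ b generalizing a b
  · exact (this (by rw [mul_comm b a, h, add_comm]) (by rwa [add_comm]) (le_of_not_ge hab)).symm
  obtain ⟨c, rfl⟩ := exists_add_of_le hab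
  have e : a * a + (a + c) * (a + c) = 2 * (a * (a + c)) + c * c := by ring
  rw [e] at h hfin
  have h1 : 2 * (a * (a + c)) ≠ ⊤ := ne_top_of_le_ne_top hfin le_self_add
  have h2 : c * c = 0 := by
    have : 2 * (a * (a + c)) + 0 = 2 * (a * (a + c)) + c * c := by rw [add_zero]; exact h
    exact ((ENNReal.add_right_inj h1).1 this).symm
  have h3 : c = 0 := by simpa using h2
  simp [h3]

section Gram

variable {Θ : Type*} [MeasurableSpace Θ] (θ : Measure Θ) [SFinite θ] {ψ : Θ → ℝ → ℝ≥0∞}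
  (hψ : Measurable (Function.uncurry ψ))
include hψ

omit [SFinite θ] in
lemma measurable_lintegral_feature (μ : Measure ℝ) [SFinite μ] :
    Measurable fun ϑ => ∫⁻ x, ψ ϑ x ∂μ :=
  hψ.lintegral_prod_right'

lemma lintegral_gram (μ ω : Measure ℝ) [SFinite μ] [SFinite ω] :
    ∫⁻ x, ∫⁻ y, (∫⁻ ϑ, ψ ϑ x * ψ ϑ y ∂θ) ∂ω ∂μ =
      ∫⁻ ϑ, (∫⁻ x, ψ ϑ x ∂μ) * (∫⁻ x, ψ ϑ x ∂ω) ∂θ := by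
  have h1 : ∀ x, ∫⁻ y, (∫⁻ ϑ, ψ ϑ x * ψ ϑ y ∂θ) ∂ω = ∫⁻ ϑ, ψ ϑ x * ∫⁻ y, ψ ϑ y ∂ω ∂θ := by
    intro x
    have hx : Measurable fun ϑ => ψ ϑ x := hψ.comp (measurable_id.prodMk measurable_const)
    rw [lintegral_lintegral_swap]
    · refine lintegral_congr fun ϑ => lintegral_const_mul _ ?_
      exact hψ.comp (measurable_const.prodMk measurable_id)
    · exact ((hx.comp measurable_snd).mul (hψ.comp measurable_swap)).aemeasurable
  simp_rw [h1]
  rw [lintegral_lintegral_swap]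
  · refine lintegral_congr fun ϑ => lintegral_mul_const _ ?_
    exact hψ.comp (measurable_const.prodMk measurable_id)
  · exact ((hψ.comp measurable_swap).mul
      ((measurable_lintegral_feature hψ ω).comp measurable_snd)).aemeasurable

omit [SFinite θ] in
lemma two_mul_gram_le (μ ω : Measure ℝ) [SFinite μ] [SFinite ω] :
    2 * ∫⁻ ϑ, (∫⁻ x, ψ ϑ x ∂μ) * (∫⁻ x, ψ ϑ x ∂ω) ∂θ ≤
      (∫⁻ ϑ, (∫⁻ x, ψ ϑ x ∂μ) * (∫⁻ x, ψ ϑ x ∂μ) ∂θ) +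
        ∫⁻ ϑ, (∫⁻ x, ψ ϑ x ∂ω) * (∫⁻ x, ψ ϑ x ∂ω) ∂θ := by
  have h1 := measurable_lintegral_feature hψ μ
  have h2 := measurable_lintegral_feature hψ ω
  have h11 : Measurable fun ϑ => (∫⁻ x, ψ ϑ x ∂μ) * (∫⁻ x, ψ ϑ x ∂μ) := h1.mul h1
  have h12 : Measurable fun ϑ => (∫⁻ x, ψ ϑ x ∂μ) * (∫⁻ x, ψ ϑ x ∂ω) := h1.mul h2
  rw [← lintegral_const_mul _ h12, ← lintegral_add_left h11]
  exact lintegral_mono fun ϑ => two_mul_le_sq_add_sq _ _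

omit [SFinite θ] in
lemma gram_eq (μ ω : Measure ℝ) [SFinite μ] [SFinite ω]
    (h : (∫⁻ ϑ, (∫⁻ x, ψ ϑ x ∂μ) * (∫⁻ x, ψ ϑ x ∂μ) ∂θ) +
        ∫⁻ ϑ, (∫⁻ x, ψ ϑ x ∂ω) * (∫⁻ x, ψ ϑ x ∂ω) ∂θ ≤
      2 * ∫⁻ ϑ, (∫⁻ x, ψ ϑ x ∂μ) * (∫⁻ x, ψ ϑ x ∂ω) ∂θ)
    (hfin : ∫⁻ ϑ, (∫⁻ x, ψ ϑ x ∂μ) * (∫⁻ x, ψ ϑ x ∂ω) ∂θ ≠ ⊤) :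
    ∀ᵐ ϑ ∂θ, ∫⁻ x, ψ ϑ x ∂μ = ∫⁻ x, ψ ϑ x ∂ω := by
  have h1 := measurable_lintegral_feature hψ μ
  have h2 := measurable_lintegral_feature hψ ω
  have h11 : Measurable fun ϑ => (∫⁻ x, ψ ϑ x ∂μ) * (∫⁻ x, ψ ϑ x ∂μ) := h1.mul h1
  have h12 : Measurable fun ϑ => (∫⁻ x, ψ ϑ x ∂μ) * (∫⁻ x, ψ ϑ x ∂ω) := h1.mul h2
  have hfin2 : 2 * ∫⁻ ϑ, (∫⁻ x, ψ ϑ x ∂μ) * (∫⁻ x, ψ ϑ x ∂ω) ∂θ ≠ ⊤ :=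
    ENNReal.mul_ne_top (by simp) hfin
  rw [← lintegral_const_mul _ h12, ← lintegral_add_left h11] at h
  rw [← lintegral_const_mul _ h12] at hfin2
  have h3 := ae_eq_of_ae_le_of_lintegral_le
    (Eventually.of_forall fun ϑ => two_mul_le_sq_add_sq _ _) hfin2
    (h11.add (h2.mul h2)).aemeasurable h
  have h4 := ae_lt_top (h12.const_mul 2) hfin2
  filter_upwards [h3, h4] with ϑ h5 h6
  refine eq_of_two_mul_eq h5 ?_
  rw [← h5]
  exact h6.ne

end Gram

/-- The weights of the Gram representation of the logarithmic kernel. -/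
def logWeight (ϑ : ℕ × ℝ) : ℝ≥0∞ :=
  if ϑ.1 = 0 then (if ϑ.2 < 1 then ENNReal.ofReal (1 / ϑ.2) else 0)
  else ENNReal.ofReal (2 * ϑ.2 ^ (-(2 * ϑ.1 + 1) : ℝ))

/-- The features of the Gram representation of the logarithmic kernel. -/
def logFeature (ϑ : ℕ × ℝ) (x : ℝ) : ℝ≥0∞ :=
  if x < ϑ.2 then ENNReal.ofReal (x ^ ϑ.1) else 0

/-- The measure on the feature space. -/
def logGram : Measure (ℕ × ℝ) := (Measure.count.prod volume).withDensity logWeight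

instance : SFinite logGram := by unfold logGram; infer_instance

lemma measurable_logWeight : Measurable logWeight := by
  refine measurable_from_prod_countable_right fun n => ?_
  by_cases hn : n = 0
  · simp only [logWeight, hn, if_true]
    exact Measurable.ite measurableSet_Iio (by fun_prop) measurable_const
  · simp only [logWeight, hn, if_false]
    fun_prop

lemma measurable_logFeature : Measurable (Function.uncurry logFeature) := by
  unfold logFeature Function.uncurry
  refine Measurable.ite ?_ ?_ measurable_const
  · exact measurableSet_lt measurable_snd (measurable_snd.comp measurable_fst)
  · have h : Measurable fun z : ℕ × ℝ => z.2 ^ z.1 :=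
      measurable_from_prod_countable_right fun n => by fun_prop
    have h2 : Measurable fun z : (ℕ × ℝ) × ℝ => (z.1.1, z.2) := by fun_prop
    exact (h.comp h2).ennreal_ofReal

lemma lintegral_one_div {M : ℝ} (h0 : 0 < M) (h1 : M ≤ 1) :
    ∫⁻ t in Ioo M 1, ENNReal.ofReal (1 / t) = ENNReal.ofReal (-Real.log M) := by
  have hc : ContinuousOn (fun t : ℝ => 1 / t) (Icc M 1) :=
    continuousOn_const.div continuousOn_id fun t ht => (h0.trans_le ht.1).ne'
  have hi : IntegrableOn (fun t : ℝ => 1 / t) (Ioo M 1) :=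
    hc.integrableOn_Icc.mono_set Ioo_subset_Icc_self
  rw [← ofReal_integral_eq_lintegral_ofReal hi ((ae_restrict_iff' measurableSet_Ioo).2
    (Eventually.of_forall fun t ht => one_div_nonneg.2 (h0.trans ht.1).le)),
    ← integral_Ioc_eq_integral_Ioo, ← intervalIntegral.integral_of_le h1,
    integral_one_div_of_pos h0 one_pos, one_div, Real.log_inv]

lemma lintegral_rpow_tail {M : ℝ} (h0 : 0 < M) {n : ℕ} (hn : n ≠ 0) :
    ∫⁻ t in Ioi M, ENNReal.ofReal (2 * t ^ (-(2 * n + 1) : ℝ)) =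
      ENNReal.ofReal ((M ^ 2)⁻¹ ^ n / n) := by
  have hn' : (0 : ℝ) < n := by exact_mod_cast Nat.pos_of_ne_zero hn
  have ha : (-(2 * n + 1) : ℝ) < -1 := by linarith
  have hi := (integrableOn_Ioi_rpow_of_lt ha h0).const_mul 2
  rw [← ofReal_integral_eq_lintegral_ofReal hi ((ae_restrict_iff' measurableSet_Ioi).2
    (Eventually.of_forall fun t ht => mul_nonneg zero_le_two
      (Real.rpow_nonneg (h0.trans ht).le _))), integral_const_mul,
    integral_Ioi_rpow_of_lt ha h0]
  congr 1
  have e : (-(2 * n + 1) + 1 : ℝ) = -(2 * n : ℕ) := by push_cast; ring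
  rw [e, Real.rpow_neg h0.le, Real.rpow_natCast, inv_pow, ← pow_mul]
  push_cast
  field_simp

lemma tsum_pow_div {q : ℝ} (h0 : 0 < q) (h1 : q ≤ 1) :
    ∑' n : ℕ, ENNReal.ofReal (q ^ (n + 1) / (n + 1 : ℕ)) = negLog (1 - q) := by
  rcases h1.lt_or_eq with h | rfl
  · have hs := Real.hasSum_pow_div_log_of_abs_lt_one (x := q) (by rwa [abs_of_pos h0])
    rw [negLog_of_pos (by linarith), ← hs.tsum_eq, ENNReal.ofReal_tsum_of_nonneg
      (fun n => by positivity) hs.summable]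
    push_cast
    rfl
  · rw [negLog, if_pos (by simp)]
    by_contra htop
    have hs := ENNReal.summable_toReal htop
    have hs' : Summable fun n : ℕ => 1 / ((n + 1 : ℕ) : ℝ) := by
      refine hs.congr fun n => ?_
      rw [ENNReal.toReal_ofReal (by positivity), one_pow]
    exact Real.not_summable_one_div_natCast ((summable_nat_add_iff 1).1 hs')

lemma lintegral_logGram (x y : ℝ) (hx : x ∈ Ioc (0 : ℝ) 1) (hy : y ∈ Ioc (0 : ℝ) 1) :
    ∫⁻ ϑ, logFeature ϑ x * logFeature ϑ y ∂logGram = negLog |x - y| := by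
  wlog hxy : x ≤ y generalizing x y
  · rw [abs_sub_comm, ← this y x hy hx (le_of_not_ge hxy)]
    simp only [mul_comm]
  have hy0 : 0 < y := hy.1
  have hq0 : 0 < x / y := div_pos hx.1 hy0
  have hq1 : x / y ≤ 1 := (div_le_one hy0).2 hxy
  have hmx : Measurable fun ϑ => logFeature ϑ x :=
    measurable_logFeature.comp (measurable_id.prodMk measurable_const)
  have hmy : Measurable fun ϑ => logFeature ϑ y :=
    measurable_logFeature.comp (measurable_id.prodMk measurable_const)
  have hm : Measurable fun ϑ => logFeature ϑ x * logFeature ϑ y := hmx.mul hmy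
  rw [logGram, lintegral_withDensity_eq_lintegral_mul _ measurable_logWeight hm,
    lintegral_prod _ (measurable_logWeight.mul hm).aemeasurable, lintegral_count,
    tsum_eq_zero_add' ENNReal.summable]
  have hzero : ∫⁻ t, (logWeight * fun ϑ => logFeature ϑ x * logFeature ϑ y) ((0 : ℕ), t) =
      ENNReal.ofReal (-Real.log y) := by
    rw [← lintegral_one_div hy0 hy.2, ← lintegral_indicator measurableSet_Ioo]
    refine lintegral_congr fun t => ?_
    simp only [Pi.mul_apply, logWeight, logFeature, if_true, pow_zero, ENNReal.ofReal_one]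
    by_cases h1 : t < 1 <;> by_cases h2 : y < t
    · simp [h1, h2, hxy.trans_lt h2]
    · rw [indicator_of_notMem (fun h => h2 h.1)]; simp [h2]
    · rw [indicator_of_notMem (fun h => h1 h.2)]; simp [h1]
    · rw [indicator_of_notMem (fun h => h1 h.2)]; simp [h1]
  have hsucc : ∀ n : ℕ,
      ∫⁻ t, (logWeight * fun ϑ => logFeature ϑ x * logFeature ϑ y) (n + 1, t) =
      ENNReal.ofReal ((x / y) ^ (n + 1) / (n + 1 : ℕ)) := by
    intro n
    have e : ENNReal.ofReal ((x / y) ^ (n + 1) / (n + 1 : ℕ)) =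
        ENNReal.ofReal ((x * y) ^ (n + 1)) *
          ENNReal.ofReal ((y ^ 2)⁻¹ ^ (n + 1) / (n + 1 : ℕ)) := by
      rw [← ENNReal.ofReal_mul (pow_nonneg (mul_pos hx.1 hy0).le _), ← mul_div_assoc, ← mul_pow]
      congr 3
      field_simp
    rw [e, ← lintegral_rpow_tail hy0 n.succ_ne_zero, ← lintegral_const_mul _ (by fun_prop),
      ← lintegral_indicator measurableSet_Ioi]
    refine lintegral_congr fun t => ?_
    simp only [Pi.mul_apply, logWeight, logFeature]
    rw [if_neg n.succ_ne_zero]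
    by_cases h2 : y < t
    · rw [if_pos (hxy.trans_lt h2), if_pos h2, indicator_of_mem (mem_Ioi.2 h2),
        ← ENNReal.ofReal_mul (pow_nonneg hx.1.le _), ← mul_pow, mul_comm]
    · rw [if_neg h2, indicator_of_notMem (by simpa using h2)]
      simp
  rw [hzero, tsum_congr hsucc, tsum_pow_div hq0 hq1]
  rcases hxy.lt_or_eq with h | rfl
  · have h1 : 0 < 1 - x / y := by
      rw [sub_pos, div_lt_one hy0]
      exact h
    have h2 : |x - y| = y * (1 - x / y) := by
      rw [abs_sub_comm, abs_of_pos (sub_pos.2 h)]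
      field_simp
    rw [negLog_of_pos h1, h2, negLog_of_pos (mul_pos hy0 h1), Real.log_mul hy0.ne' h1.ne', neg_add,
      ENNReal.ofReal_add]
    · linarith [Real.log_nonpos hy0.le hy.2]
    · linarith [Real.log_nonpos h1.le (by linarith)]
  · simp [negLog, div_self hy0.ne']

lemma frequently_of_ae {P : ℝ → Prop} {l r a : ℝ} (h : ∀ᵐ t : ℝ, t ∈ Ioo l r → P t)
    (hl : l ≤ a) (hr : a < r) : ∃ᶠ t in 𝓝[>] a, P t := by
  intro hn
  obtain ⟨u, hu, hsub⟩ := mem_nhdsGT_iff_exists_Ioo_subset.1 hn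
  have h0 : volume (Ioo a (min u r)) = 0 := by
    refine measure_mono_null (fun t ht => ?_) (ae_iff.1 h)
    have h1 : ¬ P t := hsub ⟨ht.1, ht.2.trans_le (min_le_left _ _)⟩
    exact fun h => h1 (h ⟨hl.trans_lt ht.1, ht.2.trans_le (min_le_right _ _)⟩)
  rw [Real.volume_Ioo, ENNReal.ofReal_eq_zero, sub_nonpos] at h0
  exact absurd h0 (not_le.2 (lt_min hu hr))

lemma eq_of_ae_measure_Iio_eq {μ ω : Measure ℝ} [IsProbabilityMeasure μ] [IsProbabilityMeasure ω]
    (hμ : μ (Ioc 0 1)ᶜ = 0) (hω : ω (Ioc 0 1)ᶜ = 0)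
    (h : ∀ᵐ t : ℝ, t ∈ Ioo 0 1 → μ (Iio t) = ω (Iio t)) : μ = ω := by
  have key : ∀ μ ω : Measure ℝ, IsProbabilityMeasure μ → IsProbabilityMeasure ω →
      (∀ᵐ t : ℝ, t ∈ Ioo 0 1 → μ (Iio t) = ω (Iio t)) → ∀ a, 0 ≤ a → a < 1 →
      ProbabilityTheory.cdf μ a ≤ ProbabilityTheory.cdf ω a := by
    intro μ ω _ _ h a h0 h1
    have hT : Tendsto (ProbabilityTheory.cdf ω) (𝓝[>] a) (𝓝 (ProbabilityTheory.cdf ω a)) :=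
      ((ProbabilityTheory.cdf ω).right_continuous a).mono_left (nhdsWithin_mono _ Ioi_subset_Ici_self)
    refine ge_of_tendsto_of_frequently hT ?_
    refine ((frequently_of_ae h h0 h1).and_eventually self_mem_nhdsWithin).mono fun t ht => ?_
    rw [ProbabilityTheory.cdf_eq_real, ProbabilityTheory.cdf_eq_real]
    refine ENNReal.toReal_mono (measure_ne_top _ _) ?_
    calc μ (Iic a) ≤ μ (Iio t) := measure_mono fun x hx => lt_of_le_of_lt hx ht.2
      _ = ω (Iio t) := ht.1
      _ ≤ ω (Iic t) := measure_mono Iio_subset_Iic_self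
  have hout : ∀ μ : Measure ℝ, IsProbabilityMeasure μ → μ (Ioc 0 1)ᶜ = 0 →
      (∀ a < 0, ProbabilityTheory.cdf μ a = 0) ∧ ∀ a, 1 ≤ a → ProbabilityTheory.cdf μ a = 1 := by
    intro μ _ hμ
    refine ⟨fun a ha => ?_, fun a ha => ?_⟩
    · rw [ProbabilityTheory.cdf_eq_real, Measure.real, measure_mono_null _ hμ, ENNReal.toReal_zero]
      intro x hx h
      have : x ≤ a := hx
      linarith [h.1]
    · have h1 : μ (Iic a)ᶜ = 0 := measure_mono_null (by
        intro x hx h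
        have : ¬ x ≤ a := hx
        exact this (h.2.trans ha)) hμ
      rw [ProbabilityTheory.cdf_eq_real, Measure.real, (prob_compl_eq_zero_iff measurableSet_Iic).1 h1,
        ENNReal.toReal_one]
  refine Measure.eq_of_cdf μ ω ?_
  ext a
  rcases lt_or_ge a 0 with h0 | h0
  · rw [(hout μ inferInstance hμ).1 a h0, (hout ω inferInstance hω).1 a h0]
  rcases lt_or_ge a 1 with h1 | h1
  · exact le_antisymm (key μ ω inferInstance inferInstance h a h0 h1)
      (key ω μ inferInstance inferInstance (h.mono fun t ht hm => (ht hm).symm) a h0 h1)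
  · rw [(hout μ inferInstance hμ).2 a h1, (hout ω inferInstance hω).2 a h1]

lemma lintegral_logFeature_zero (μ : Measure ℝ) (t : ℝ) :
    ∫⁻ x, logFeature (0, t) x ∂μ = μ (Iio t) := by
  rw [← lintegral_indicator_one measurableSet_Iio]
  refine lintegral_congr fun x => ?_
  by_cases h : x < t <;> simp [logFeature, h]

lemma eq_of_ae_logFeature_eq {μ ω : Measure ℝ} [IsProbabilityMeasure μ] [IsProbabilityMeasure ω]
    (hμ : μ (Ioc 0 1)ᶜ = 0) (hω : ω (Ioc 0 1)ᶜ = 0)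
    (h : ∀ᵐ ϑ ∂logGram, ∫⁻ x, logFeature ϑ x ∂μ = ∫⁻ x, logFeature ϑ x ∂ω) : μ = ω := by
  refine eq_of_ae_measure_Iio_eq hμ hω ?_
  rw [logGram, ae_withDensity_iff measurable_logWeight] at h
  have h1 := Measure.ae_ae_of_ae_prod h
  rw [ae_iff, Measure.count_eq_zero_iff] at h1
  have h2 : ∀ᵐ t : ℝ, logWeight (0, t) ≠ 0 →
      ∫⁻ x, logFeature (0, t) x ∂μ = ∫⁻ x, logFeature (0, t) x ∂ω := by
    by_contra hc
    exact (h1 ▸ notMem_empty (0 : ℕ)) hc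
  filter_upwards [h2] with t ht hmem
  rw [lintegral_logFeature_zero, lintegral_logFeature_zero] at ht
  refine ht ?_
  have := hmem.1
  simp [logWeight, hmem.2, this]

/-! ### Minimality of the limit shape -/

lemma lintegral_le_of_variational {μ ω : Measure ℝ} [IsProbabilityMeasure μ]
    [IsProbabilityMeasure ω] {U : ℝ → ℝ≥0∞} (hU : Measurable U) {c : ℝ≥0∞} (hc : c ≠ ⊤) {S : Set ℝ}
    (hS : MeasurableSet S) (hμ : ∀ᵐ x ∂μ, U x ≤ c) (hω : ∀ᵐ x ∂ω, x ∉ S → c ≤ U x)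
    (hle : ω.restrict S ≤ μ.restrict S) :
    ∫⁻ x, U x ∂μ ≤ ∫⁻ x, U x ∂ω ∧ ∫⁻ x, U x ∂μ ≠ ⊤ := by
  have hsum : ∀ ν : Measure ℝ, ∫⁻ x, U x ∂ν + ∫⁻ x in S, (c - U x) ∂ν =
      ∫⁻ x in S, (U x + (c - U x)) ∂ν + ∫⁻ x in Sᶜ, U x ∂ν := fun ν => by
    rw [lintegral_add_left hU, ← lintegral_add_compl U hS]
    ring
  have hconst : ∀ ν : Measure ℝ, IsProbabilityMeasure ν →
      ∫⁻ _ in S, c ∂ν + ∫⁻ _ in Sᶜ, c ∂ν = c := fun ν _ => by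
    rw [lintegral_add_compl (fun _ => c) hS]
    simp
  have h1 : ∫⁻ x, U x ∂μ + ∫⁻ x in S, (c - U x) ∂μ ≤ c := by
    rw [hsum]
    conv_rhs => rw [← hconst μ inferInstance]
    refine add_le_add (lintegral_mono_ae ?_) (lintegral_mono_ae (ae_restrict_of_ae hμ))
    filter_upwards [ae_restrict_of_ae hμ] with x hx
    rw [add_tsub_cancel_of_le hx]
  have h2 : c ≤ ∫⁻ x, U x ∂ω + ∫⁻ x in S, (c - U x) ∂μ := by
    refine le_trans ?_ (add_le_add_right (lintegral_mono' hle le_rfl) _)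
    rw [hsum]
    conv_lhs => rw [← hconst ω inferInstance]
    refine add_le_add (lintegral_mono fun x => le_add_tsub) (lintegral_mono_ae ?_)
    rw [ae_restrict_iff' hS.compl]
    exact hω
  have h3 : ∫⁻ x in S, (c - U x) ∂μ ≠ ⊤ := ne_top_of_le_ne_top hc (le_add_self.trans h1)
  exact ⟨(ENNReal.add_le_add_iff_right h3).1 (h1.trans h2),
    ne_top_of_le_ne_top hc (le_self_add.trans h1)⟩

namespace Params

/-- The interaction energy of two measures. -/
def pair (p : Params) (μ ω : Measure ℝ) : ℝ≥0∞ := ∫⁻ x, ∫⁻ y, p.kernel x y ∂ω ∂μ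

variable (p : Params)

lemma measurable_kernel : Measurable (Function.uncurry p.kernel) := by
  unfold Params.kernel Function.uncurry
  exact (measurable_negLog.comp (by fun_prop)).add (measurable_negLog.comp (by fun_prop))

lemma measurable_extPot (M : ModelProblem) : Measurable (p.extPot M) := by
  unfold Params.extPot
  refine (Measurable.const_mul ?_ _).add (measurable_negLog.const_mul _)
  have h : Measurable fun z : ℝ × ℝ =>
      negLog (1 - z.1 ^ p.potExp M * Real.exp (-p.β * p.α * z.2)) :=
    measurable_negLog.comp (by fun_prop)
  exact h.lintegral_prod_right'

lemma measurable_rpow_feature :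
    Measurable (Function.uncurry fun ϑ x => logFeature ϑ (x ^ p.ν)) := by
  have h : Measurable fun z : (ℕ × ℝ) × ℝ => (z.1, z.2 ^ p.ν) := by fun_prop
  exact measurable_logFeature.comp h

variable {p}

lemma pair_eq (hν : 0 < p.ν) {μ ω : Measure ℝ} [SFinite μ] [SFinite ω]
    (hμ : ∀ᵐ x ∂μ, x ∈ Ioc (0 : ℝ) 1) (hω : ∀ᵐ x ∂ω, x ∈ Ioc (0 : ℝ) 1) :
    p.pair μ ω = (∫⁻ ϑ, (∫⁻ x, logFeature ϑ x ∂μ) * (∫⁻ x, logFeature ϑ x ∂ω) ∂logGram) +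
      ∫⁻ ϑ, (∫⁻ x, logFeature ϑ (x ^ p.ν) ∂μ) * (∫⁻ x, logFeature ϑ (x ^ p.ν) ∂ω) ∂logGram := by
  have hpow : ∀ x ∈ Ioc (0 : ℝ) 1, x ^ p.ν ∈ Ioc (0 : ℝ) 1 := fun x hx =>
    ⟨Real.rpow_pos_of_pos hx.1 _, Real.rpow_le_one hx.1.le hx.2 hν.le⟩
  rw [← lintegral_gram logGram measurable_logFeature μ ω,
    ← lintegral_gram logGram p.measurable_rpow_feature μ ω, pair]
  have h1 : Measurable fun z : ℝ × ℝ => negLog |z.1 - z.2| := measurable_negLog.comp (by fun_prop)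
  have h2 : ∫⁻ x, ∫⁻ y, p.kernel x y ∂ω ∂μ = (∫⁻ x, ∫⁻ y, negLog |x - y| ∂ω ∂μ) +
      ∫⁻ x, ∫⁻ y, negLog |x ^ p.ν - y ^ p.ν| ∂ω ∂μ := by
    rw [← lintegral_add_left h1.lintegral_prod_right']
    refine lintegral_congr fun x => ?_
    have hx : Measurable fun y => negLog |x - y| := measurable_negLog.comp (by fun_prop)
    rw [← lintegral_add_left hx]
    exact lintegral_congr fun y => add_comm _ _
  rw [h2]
  congr 1
  · refine lintegral_congr_ae (hμ.mono fun x hx => lintegral_congr_ae (hω.mono fun y hy => ?_))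
    exact (lintegral_logGram x y hx hy).symm
  · refine lintegral_congr_ae (hμ.mono fun x hx => lintegral_congr_ae (hω.mono fun y hy => ?_))
    exact (lintegral_logGram _ _ (hpow x hx) (hpow y hy)).symm

lemma two_mul_pair_le (hν : 0 < p.ν) {μ ω : Measure ℝ} [SFinite μ] [SFinite ω]
    (hμ : ∀ᵐ x ∂μ, x ∈ Ioc (0 : ℝ) 1) (hω : ∀ᵐ x ∂ω, x ∈ Ioc (0 : ℝ) 1) :
    2 * p.pair μ ω ≤ p.pair μ μ + p.pair ω ω := by
  have h1 := two_mul_gram_le logGram measurable_logFeature μ ω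
  have h2 := two_mul_gram_le logGram p.measurable_rpow_feature μ ω
  rw [pair_eq hν hμ hω, pair_eq hν hμ hμ, pair_eq hν hω hω, mul_add, add_add_add_comm]
  exact add_le_add h1 h2

/-- The interaction energy is strictly positive definite. -/
lemma eq_of_pair_le (hν : 0 < p.ν) {μ ω : Measure ℝ} [IsProbabilityMeasure μ]
    [IsProbabilityMeasure ω] (hμ : ∀ᵐ x ∂μ, x ∈ Ioc (0 : ℝ) 1) (hω : ∀ᵐ x ∂ω, x ∈ Ioc (0 : ℝ) 1)
    (h : p.pair μ μ + p.pair ω ω ≤ 2 * p.pair μ ω) (hfin : p.pair μ ω ≠ ⊤) : μ = ω := by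
  have h2 := two_mul_gram_le logGram p.measurable_rpow_feature μ ω
  rw [pair_eq hν hμ hω, pair_eq hν hμ hμ, pair_eq hν hω hω, mul_add, add_add_add_comm] at h
  rw [pair_eq hν hμ hω] at hfin
  obtain ⟨f1, f2⟩ := ENNReal.add_ne_top.1 hfin
  refine eq_of_ae_logFeature_eq hμ hω (gram_eq logGram measurable_logFeature μ ω ?_ f1)
  exact (ENNReal.add_le_add_iff_right (ENNReal.mul_ne_top (by simp) f2)).1
    ((add_le_add_right h2 _).trans h)

lemma energy_eq (M : ModelProblem) {ω : Measure ℝ} (hω : ∀ᵐ x ∂ω, x ∈ Ioc (0 : ℝ) 1) :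
    p.energy M ω = 2⁻¹ * p.pair ω ω + ∫⁻ x, p.extPot M x ∂ω := by
  have h : ω.restrict (Icc 0 1) = ω :=
    Measure.restrict_eq_self_of_ae_mem (hω.mono fun x hx => Ioc_subset_Icc_self hx)
  have e : ∫⁻ x, p.extPot M x ∂ω = ENNReal.ofReal (1 / p.κ) * (∫⁻ x, (∫⁻ u in Ioc p.n₁ p.n₂,
        negLog (1 - x ^ p.potExp M * Real.exp (-p.β * p.α * u))) ∂ω) +
      ENNReal.ofReal p.m₁ * (∫⁻ x, negLog x ∂ω) := by
    rw [← lintegral_const_mul' _ _ ENNReal.ofReal_ne_top,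
      ← lintegral_const_mul' _ _ ENNReal.ofReal_ne_top,
      ← lintegral_add_right _ (measurable_negLog.const_mul _)]
    rfl
  rw [energy, h, e, ← add_assoc]
  rfl

namespace Admissible

variable {M : ModelProblem} (hp : p.Admissible M) {S : Set ℝ}
include hp

lemma xmax_le_one : p.xmax ≤ 1 := by
  rw [hp.xmax_eq_exp]
  exact Real.exp_le_one_iff.2 hp.l_nonpos

omit hp in
lemma ae_mem_of_isConstrained {δ : ℝ} {ω : Measure ℝ} (h : IsConstrained δ p.xmax ω) :
    ∀ᵐ x ∂ω, x ∈ Ioo 0 p.xmax := by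
  have h1 : ∀ᵐ x ∂ω, x ∈ Icc 0 p.xmax := h.supp
  filter_upwards [h1, h.ac.ae_le (StripFun.ae_ne 0), h.ac.ae_le (StripFun.ae_ne p.xmax)]
    with x hx h2 h3
  exact ⟨lt_of_le_of_ne hx.1 h2.symm, lt_of_le_of_ne hx.2 h3⟩

lemma shapeDensity_le_upper (hS : p.IsSaturated M S) {x : ℝ} (hx : 0 < x) :
    p.shapeDensity M S x ≤ p.upper x := by
  have h0 : 0 ≤ p.upper x := by
    have := hp.δ_pos
    rw [Params.upper]
    positivity
  rw [shapeDensity]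
  by_cases h1 : x ∈ Ioo (p.a M) (p.b M)
  · have h2 : x ∉ S := fun h' => by
      have := (subset_of_isSaturated hS h').1
      linarith [h1.2]
    rw [indicator_of_mem h1, indicator_of_notMem h2, add_zero]
    exact (hp.bandDensity_mem h1).2.le
  · rw [indicator_of_notMem h1, zero_add]
    exact indicator_le_self' (fun _ _ => h0) x

lemma rnDeriv_shape (hS : p.IsSaturated M S) :
    (p.shape M S).rnDeriv volume =ᵐ[volume] fun x => ENNReal.ofReal (p.shapeDensity M S x) :=
  Measure.rnDeriv_withDensity₀ volume (hp.aemeasurable_shapeDensity hS).ennreal_ofReal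

theorem isConstrained_shape (hS : p.IsSaturated M S) :
    IsConstrained (p.β * p.ρ * p.κ) p.xmax (p.shape M S) where
  prob := hp.isProbabilityMeasure_shape hS
  supp := by
    rw [shape, withDensity_apply _ measurableSet_Icc.compl]
    refine (setLIntegral_congr_fun measurableSet_Icc.compl fun x hx => ?_).trans lintegral_zero
    have : p.shapeDensity M S x = 0 := by
      rcases lt_or_ge x p.xmax with h | h
      · exact hp.shapeDensity_left hS
          ((not_le.1 fun h0 => hx ⟨h0, h.le⟩).le.trans hp.a_nonneg)
      · exact hp.shapeDensity_of_ge hS h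
    rw [this, ENNReal.ofReal_zero]
  ac := withDensity_absolutelyContinuous _ _
  bound := by
    rw [ae_restrict_iff' measurableSet_Ioc]
    filter_upwards [hp.rnDeriv_shape hS] with x hx hmem
    rw [hx]
    exact ENNReal.ofReal_le_ofReal (hp.shapeDensity_le_upper hS hmem.1)

lemma restrict_le_shape (hS : p.IsSaturated M S) {ω : Measure ℝ}
    (hω : IsConstrained (p.β * p.ρ * p.κ) p.xmax ω) :
    ω.restrict S ≤ (p.shape M S).restrict S := by
  have := hω.prob
  have hm := measurableSet_of_isSaturated hS
  have hsub : S ⊆ Ioc 0 p.xmax := fun x hx =>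
    ⟨hp.b_pos.trans (subset_of_isSaturated hS hx).1, (subset_of_isSaturated hS hx).2.le⟩
  rw [← Measure.withDensity_rnDeriv_eq ω volume hω.ac, shape, restrict_withDensity hm,
    restrict_withDensity hm]
  refine withDensity_mono ?_
  rw [EventuallyLE, ae_restrict_iff' hm]
  have hb := hω.bound
  rw [ae_restrict_iff' measurableSet_Ioc] at hb
  filter_upwards [hb] with x hx hmem
  refine (hx (hsub hmem)).trans (ENNReal.ofReal_le_ofReal ?_)
  have h1 := (subset_of_isSaturated hS hmem).1
  rw [shapeDensity, indicator_of_notMem (fun h' => by linarith [h'.2]), indicator_of_mem hmem,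
    zero_add]
  exact le_rfl

/-- The potential of the limit shape has the smallest integral at the limit shape. -/
theorem lintegral_potential_le (hS : p.IsSaturated M S) {ω : Measure ℝ}
    (hω : IsConstrained (p.β * p.ρ * p.κ) p.xmax ω) :
    p.pair (p.shape M S) (p.shape M S) + ∫⁻ x, p.extPot M x ∂(p.shape M S) ≤
      p.pair ω (p.shape M S) + ∫⁻ x, p.extPot M x ∂ω ∧
    p.pair (p.shape M S) (p.shape M S) + ∫⁻ x, p.extPot M x ∂(p.shape M S) ≠ ⊤ := by
  have := hω.prob
  have hμ := hp.isConstrained_shape hS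
  have := hμ.prob
  have hπδ : 0 ≤ 1 / (Real.pi * (p.β * p.ρ * p.κ)) := by
    have := hp.δ_pos
    have := Real.pi_pos
    positivity
  obtain ⟨c, hc⟩ := hp.exists_pot_const hS
  obtain ⟨C, hC⟩ := hp.potential_exp hS
  have hU1 : Measurable fun x => ∫⁻ y, p.kernel x y ∂(p.shape M S) :=
    p.measurable_kernel.lintegral_prod_right'
  set U : ℝ → ℝ≥0∞ := fun x => (∫⁻ y, p.kernel x y ∂(p.shape M S)) + p.extPot M x with hUdef
  have hU : Measurable U := hU1.add (p.measurable_extPot M)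
  have hpair : ∀ ν : Measure ℝ, p.pair ν (p.shape M S) + ∫⁻ x, p.extPot M x ∂ν = ∫⁻ x, U x ∂ν :=
    fun ν => by rw [hUdef, lintegral_add_left hU1]; rfl
  rw [hpair, hpair]
  set k := 1 / (Real.pi * (p.β * p.ρ * p.κ)) with hk
  have hexp : ∀ x ∈ Ioo 0 p.xmax, ∃ u < p.ρ * p.β * p.n₁, x = Real.exp u := fun x hx => by
    refine ⟨Real.log x, ?_, (Real.exp_log hx.1).symm⟩
    have := hx.2
    rw [hp.xmax_eq_exp] at this
    rwa [Real.log_lt_iff_lt_exp hx.1]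
  have hsupp : ∀ᵐ x ∂(p.shape M S), x ∈ Ioo (p.a M) (p.b M) ∨ x ∈ S := by
    rw [shape, ae_withDensity_iff' (hp.aemeasurable_shapeDensity hS).ennreal_ofReal]
    refine Eventually.of_forall fun x hx => ?_
    by_contra! hn
    rw [shapeDensity, indicator_of_notMem hn.1, indicator_of_notMem hn.2] at hx
    simp at hx
  refine lintegral_le_of_variational hU (c := ENNReal.ofReal (k * c + C)) ENNReal.ofReal_ne_top
    (measurableSet_of_isSaturated hS) ?_ ?_ (hp.restrict_le_shape hS hω)
  · filter_upwards [ae_mem_of_isConstrained hμ, hsupp] with x hx hx'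
    obtain ⟨u, hu, rfl⟩ := hexp x hx
    obtain ⟨h1, h2, -⟩ := hc u hu
    have h4 : hp.confMap.pot (p.s₁ M) (p.s₂ M) u ≤ c := by
      rcases hx' with h | h
      · exact (h1 h).le
      · exact h2 h
    rw [hUdef]
    dsimp only
    rw [(hC u hu).1]
    refine ENNReal.ofReal_le_ofReal ?_
    have := mul_le_mul_of_nonneg_left h4 hπδ
    linarith
  · filter_upwards [ae_mem_of_isConstrained hω] with x hx hx'
    obtain ⟨u, hu, rfl⟩ := hexp x hx
    have h4 := (hc u hu).2.2 hx'
    rw [hUdef]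
    dsimp only
    rw [(hC u hu).1]
    refine ENNReal.ofReal_le_ofReal ?_
    have := mul_le_mul_of_nonneg_left h4 hπδ
    linarith

/-- The limit shape is the unique equilibrium measure. -/
theorem isEquilibrium_iff (hS : p.IsSaturated M S) (ω : Measure ℝ) :
    p.IsEquilibrium M ω ↔ ω = p.shape M S := by
  have hμ := hp.isConstrained_shape hS
  have := hμ.prob
  have hν := hp.ν_pos
  have hmem : ∀ ω, IsConstrained (p.β * p.ρ * p.κ) p.xmax ω → ∀ᵐ x ∂ω, x ∈ Ioc (0 : ℝ) 1 :=
    fun ω hω => (ae_mem_of_isConstrained hω).mono fun x hx =>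
      ⟨hx.1, hx.2.le.trans hp.xmax_le_one⟩
  have hhalf : ∀ z : ℝ≥0∞, 2⁻¹ * z + 2⁻¹ * z = z := fun z => by
    rw [← add_mul, ENNReal.inv_two_add_inv_two, one_mul]
  have hsplit : p.energy M (p.shape M S) + 2⁻¹ * p.pair (p.shape M S) (p.shape M S) =
      p.pair (p.shape M S) (p.shape M S) + ∫⁻ x, p.extPot M x ∂(p.shape M S) := by
    rw [energy_eq M (hmem _ hμ)]
    conv_rhs => rw [← hhalf (p.pair (p.shape M S) (p.shape M S))]
    ring
  have hfin := (hp.lintegral_potential_le hS hμ).2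
  have hPfin : 2⁻¹ * p.pair (p.shape M S) (p.shape M S) ≠ ⊤ :=
    ne_top_of_le_ne_top (hsplit ▸ hfin) le_add_self
  have hEfin : p.energy M (p.shape M S) ≠ ⊤ := ne_top_of_le_ne_top (hsplit ▸ hfin) le_self_add
  constructor
  · rintro ⟨hω, hmin⟩
    have := hω.prob
    have hE := hmin _ hμ
    have h1 := (hp.lintegral_potential_le hS hω).1
    rw [← hsplit] at h1
    have h2 := (add_le_add_left hE (2⁻¹ * p.pair (p.shape M S) (p.shape M S))).trans h1
    have hEω : p.energy M ω ≠ ⊤ := ne_top_of_le_ne_top hEfin hE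
    rw [energy_eq M (hmem _ hω)] at h2 hEω
    have hV : ∫⁻ x, p.extPot M x ∂ω ≠ ⊤ := ne_top_of_le_ne_top hEω le_add_self
    have hPω : 2⁻¹ * p.pair ω ω ≠ ⊤ := ne_top_of_le_ne_top hEω le_self_add
    rw [add_right_comm, ENNReal.add_le_add_iff_right hV] at h2
    have h3 : p.pair ω ω + p.pair (p.shape M S) (p.shape M S) ≤ 2 * p.pair ω (p.shape M S) := by
      have := mul_le_mul_right h2 2
      rwa [← mul_add, ← mul_assoc, ENNReal.mul_inv_cancel (by simp) (by simp), one_mul] at this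
    have h4 := two_mul_pair_le hν (hmem _ hω) (hmem _ hμ)
    refine eq_of_pair_le hν (hmem _ hω) (hmem _ hμ) h3 ?_
    have h5 : p.pair ω (p.shape M S) ≤
        2⁻¹ * p.pair ω ω + 2⁻¹ * p.pair (p.shape M S) (p.shape M S) := by
      have := mul_le_mul_right h4 2⁻¹
      rwa [← mul_assoc, ENNReal.inv_mul_cancel (by simp) (by simp), one_mul, mul_add] at this
    exact ne_top_of_le_ne_top (ENNReal.add_ne_top.2 ⟨hPω, hPfin⟩) h5
  · rintro rfl
    refine ⟨hμ, fun ω hω => ?_⟩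
    have := hω.prob
    rw [← ENNReal.add_le_add_iff_right hPfin, hsplit]
    refine (hp.lintegral_potential_le hS hω).1.trans ?_
    rw [energy_eq M (hmem _ hω), add_right_comm]
    refine add_le_add_left ?_ _
    have := mul_le_mul_right (two_mul_pair_le hν (hmem _ hω) (hmem _ hμ)) 2⁻¹
    rwa [← mul_assoc, ENNReal.inv_mul_cancel (by simp) (by simp), one_mul, mul_add] at this

end Admissible

lemma shape_empty (p : Params) (M : ModelProblem) : p.shape M ∅ = p.subShape M := by
  simp only [shape, subShape, shapeDensity, indicator_empty, add_zero]

end Params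

end MuttalibBorodin

end

theorem theorem1p2 (M : MuttalibBorodin.ModelProblem) (p : MuttalibBorodin.Params)
    (hp : p.Admissible M) :
    Set.BijOn (p.J M) (p.sigmaPlus M) ((fun x : ℝ => (x : ℂ)) '' Set.Ioo (p.a M) (p.b M)) ∧
    (∀ x ∈ Set.Ioo (p.a M) (p.b M), 0 < p.bandDensity M x ∧ p.bandDensity M x < p.upper x) ∧
    (p.Subcritical M →
      0 ≤ p.a M ∧ p.a M < p.b M ∧ p.b M ≤ p.xmax ∧
      ∀ ω : MeasureTheory.Measure ℝ, p.IsEquilibrium M ω ↔ ω = p.subShape M) ∧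
    (p.Supercritical M →
      0 ≤ p.a M ∧ p.a M < p.b M ∧ p.b M < p.xmax ∧
      ∀ ω : MeasureTheory.Measure ℝ, p.IsEquilibrium M ω ↔ ω = p.superShape M) := by
  refine ⟨hp.bijOn_J, fun x hx => hp.bandDensity_mem hx, fun h => ?_, fun h => ?_⟩
  · refine ⟨hp.a_nonneg, hp.a_lt_b, hp.b_le_xmax, fun ω => ?_⟩
    rw [← p.shape_empty M]
    exact hp.isEquilibrium_iff (Or.inl ⟨h, rfl⟩) ω
  · exact ⟨hp.a_nonneg, hp.a_lt_b, hp.b_lt_xmax h,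
      fun ω => hp.isEquilibrium_iff (S := Set.Ioo (p.b M) p.xmax) (Or.inr ⟨h, rfl⟩) ω⟩
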